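/- Setting. Let $d\ge 2$, $S\ge 3$, $\beta>0$. Put $\mathcal S(u)=-u(\log u-1)$ for $u\ge 0$ (with $\mathcal S(0)=0$) and, for $u\in\mathbb R_+^S$, $F^{\rm mf}_{\beta,\lambda}(u)=\frac12\sum_{s\ne s'}u_su_{s'}-\lambda\sum_su_s-\frac1\beta\sum_s\mathcal S(u_s)$. Let $\lambda_\beta$ be the critical chemical potential, i.e. $F^{\rm mf}_{\beta,\lambda_\beta}$ has exactly $S+1$ minimizers on $\mathbb R_+^S$, denoted $\rho^{(1)},\dots,\rho^{(S+1)}$, and let $r^{(k)}_s=\sum_{s'\ne s}\rho^{(k)}_{s'}$. Let $J(r,r')$ be a smooth, symmetric, translation invariant probability kernel on $\mathbb R^d$ with $J(r,r')=0$ for $|r-r'|\ge1$, and $J_\gamma(r,r')=\gamma^dJ(\gamma r,\gamma r')$. Scales. Fix $0<a<\alpha_-<\alpha_+<1$ with $2ad+\alpha_-d^2<\frac{\alpha_+}2$, $\frac12-2d\alpha_+>0$, $\frac14-d(\alpha_+-\alpha_-)>0$, $\frac{\alpha_++\alpha_-}{1-\alpha_-}<\frac1d$, $4(\alpha_++\alpha_-)+\frac{\alpha_-}2<\frac14$.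 Set $\zeta=\gamma^a$, $\ell_-=\gamma^{-1+\alpha_-}$, $\ell_+=\gamma^{-1-\alpha_+}$, where $\gamma>0$ ranges over the values for which $\gamma^{-1/2},\ell_-,\ell_+$ all belong to $\{2^n:n\in\mathbb N\}$. For $\ell>0$ let $\mathcal D^{(\ell)}$ be the partition of $\mathbb R^d$ into the cubes $\prod_i[x_i,x_i+\ell)$, $x\in\ell\mathbb Z^d$; the cube containing $r$ is $C^{(\ell)}_r$. A set is $\mathcal D^{(\ell)}$-measurable if it is a union of such cubes, a function if it is constant on each of them. Densities. For $A\subset\mathbb R^d$, $\mathcal X^{(k)}_A$ is the set of non-negative $\mathcal D^{(\gamma^{-1/2})}$-measurable functions $\rho_A(r,s)$, $r\in A$, $s\in\{1,\dots,S\}$ (extended by $0$ outside $A$), such that $\big|\,|C^{(\ell_-)}_r|^{-1}\int_{C^{(\ell_-)}_r}\rho_A(x,s)\,dx-\rho^{(k)}_s\big|\le\zeta$ for all $r\in A$ and all $s$. Functional. Let $\mathfrak L=\gamma^{-1/2}\mathbb Z^d$, let $\hat J_\gamma(x,y)$ be the average of $J_\gamma$ over $C^{(\gamma^{-1/2})}_x\times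 C^{(\gamma^{-1/2})}_y$, and let $\hat V_\gamma(x,x')=\gamma^{-d}\sum_{y\in\mathfrak L}\hat J_\gamma(x,y)\hat J_\gamma(y,x')$ and $(\rho,V^*\rho')=\sum_{x,x'\in\mathfrak L}\sum_{s\ne s'}\hat V_\gamma(x,x')\rho(x,s)\rho'(x',s')$. For $\Lambda$ bounded and $t\in[0,1]$ set $$F^*_{\Lambda,\lambda}(\rho_\Lambda|\bar\rho_{\Lambda^c})=\gamma^{-d/2}\Big\{\tfrac12(\rho_\Lambda,V^*\rho_\Lambda)+(\rho_\Lambda,V^*\bar\rho_{\Lambda^c})-\tfrac1\beta\sum_{x\in\Lambda\cap\mathfrak L}\sum_s\big[\mathcal S(\rho_\Lambda(x,s))+\beta\lambda\rho_\Lambda(x,s)\big]\Big\},$$ $$f_{\Lambda,t}(\rho_\Lambda;\bar\rho_{\Lambda^c})=tF^*_{\Lambda,\lambda_\beta}(\rho_\Lambda|\bar\rho_{\Lambda^c})+(1-t)\gamma^{-d/2}\sum_{x\in\Lambda\cap\mathfrak L}\sum_s\Big[(r^{(k)}_s-\lambda_\beta)\rho_\Lambda(x,s)-\tfrac1\beta\mathcal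 S(\rho_\Lambda(x,s))\Big].$$ Theorem. There are constants $\gamma_0,c,\omega>0$, depending only on $d,S,\beta,J,a,\alpha_-,\alpha_+$ (and on $\lambda_\beta$, $\rho^{(1)},\dots,\rho^{(S+1)}$), such that for every $\gamma\le\gamma_0$ as above, every $k\in\{1,\dots,S+1\}$, every bounded $\mathcal D^{(\ell_+)}$-measurable $\Lambda\subset\mathbb R^d$, every $\bar\rho_{\Lambda^c}\in\mathcal X^{(k)}_{\Lambda^c}$ and every $t\in[0,1]$, the functional $f_{\Lambda,t}(\cdot\,;\bar\rho_{\Lambda^c})$ has a unique minimizer $\hat\rho_\Lambda$ over $\mathcal X^{(k)}_\Lambda$, and $$|\hat\rho_\Lambda(r,s)-\rho^{(k)}_s|\le c\,e^{-\gamma\omega\,{\rm dist}(r,\Lambda^c)}\qquad\text{for all } r\in\Lambda,\ s\in\{1,\dots,S\}.$$ -/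

import Mathlib

open scoped BigOperators
open MeasureTheory

noncomputable section

namespace KacPotts

/-- The space `ℝ^d` with its Euclidean norm. -/
abbrev Space (d : ℕ) : Type := EuclideanSpace ℝ (Fin d)

/-! ### Mean field theory -/

/-- The one-component entropy `S(u) = -u (log u - 1)`, with `S(0) = 0`. -/
def entropy (u : ℝ) : ℝ := -(u * (Real.log u - 1))

/-- The mean field free energy
`F(u) = (1/2) ∑_{s ≠ s'} u_s u_{s'} - lam ∑_s u_s - (1/β) ∑_s S(u_s)`. -/
def meanFieldFreeEnergy {S : ℕ} (β lam : ℝ) (u : Fin S → ℝ) : ℝ :=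
  (1 / 2) * (∑ s, ∑ s', if s ≠ s' then u s * u s' else 0) - lam * (∑ s, u s)
    - (1 / β) * ∑ s, entropy (u s)

/-- `u` minimizes the mean field free energy over `ℝ_+^S`. -/
def IsMeanFieldMinimizer {S : ℕ} (β lam : ℝ) (u : Fin S → ℝ) : Prop :=
  (∀ s, 0 ≤ u s) ∧ IsMinOn (meanFieldFreeEnergy β lam) {v | ∀ s, 0 ≤ v s} u

/-- `lam` is the critical chemical potential `λ_β`, at which the mean field free energy has
`S + 1` minimizers, and `ρ 0, …, ρ S` are these minimizers, listed without repetition. -/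
def IsMeanFieldCoexistence {S : ℕ} (β lam : ℝ) (ρ : Fin (S + 1) → Fin S → ℝ) : Prop :=
  Function.Injective ρ ∧ ∀ u : Fin S → ℝ, IsMeanFieldMinimizer β lam u ↔ ∃ k, ρ k = u

/-! ### The Kac kernel -/

/-- `J` is a smooth, symmetric, translation invariant probability kernel of range one. -/
structure IsKacKernel {d : ℕ} (J : Space d → Space d → ℝ) : Prop where
  smooth : ContDiff ℝ ((⊤ : ℕ∞) : WithTop ℕ∞) (fun p : Space d × Space d => J p.1 p.2)
  symm : ∀ r r', J r r' = J r' r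
  translation : ∀ v r r', J (r + v) (r' + v) = J r r'
  nonneg : ∀ r r', 0 ≤ J r r'
  integral_eq_one : ∀ r, ∫ r', J r r' = 1
  range_one : ∀ r r', 1 ≤ ‖r - r'‖ → J r r' = 0

/-- The scaled kernel `J_γ(r, r') = γ^d J(γ r, γ r')`. -/
def scaledKernel {d : ℕ} (γ : ℝ) (J : Space d → Space d → ℝ) (r r' : Space d) : ℝ :=
  γ ^ d * J (γ • r) (γ • r')

/-! ### Cubes -/

/-- The point `ℓ z` of the lattice `ℓ ℤ^d`. -/
def latticePoint {d : ℕ} (ℓ : ℝ) (z : Fin d → ℤ) : Space d :=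
  WithLp.toLp 2 fun i => ℓ * (z i : ℝ)

/-- The half-open cube of side `ℓ` with lower corner `ℓ z`. -/
def cube {d : ℕ} (ℓ : ℝ) (z : Fin d → ℤ) : Set (Space d) :=
  {r | ∀ i, ℓ * (z i : ℝ) ≤ r i ∧ r i < ℓ * (z i : ℝ) + ℓ}

/-- The cube of side `ℓ` of the partition that contains `r`. -/
def cubeOf {d : ℕ} (ℓ : ℝ) (r : Space d) : Set (Space d) :=
  cube ℓ fun i => ⌊r i / ℓ⌋

/-- A set is a union of cubes of side `ℓ`. -/
def IsCubeSet {d : ℕ} (ℓ : ℝ) (A : Set (Space d)) : Prop :=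
  ∃ I : Set (Fin d → ℤ), A = ⋃ z ∈ I, cube ℓ z

/-- A function is constant on each cube of side `ℓ`. -/
def IsCubeFun {d S : ℕ} (ℓ : ℝ) (f : Space d → Fin S → ℝ) : Prop :=
  ∀ z : Fin d → ℤ, ∀ r ∈ cube ℓ z, ∀ r' ∈ cube ℓ z, f r = f r'

/-! ### Scales and constrained densities -/

/-- The conditions on the exponents in `ζ = γ^a`, `ℓ_- = γ^(-1+αm)`, `ℓ_+ = γ^(-1-αp)`. -/
structure IsExponentChoice (d : ℕ) (a αm αp : ℝ) : Prop where
  a_pos : 0 < a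
  a_lt : a < αm
  αm_lt : αm < αp
  αp_lt : αp < 1
  cond₁ : 2 * a * d + αm * (d : ℝ) ^ 2 < αp / 2
  cond₂ : 0 < 1 / 2 - 2 * d * αp
  cond₃ : 0 < 1 / 4 - d * (αp - αm)
  cond₄ : (αp + αm) / (1 - αm) < 1 / d
  cond₅ : 4 * (αp + αm) + αm / 2 < 1 / 4

/-- The mesh `γ^(-1/2)`. -/
def mesh (γ : ℝ) : ℝ := γ ^ (-(1 / 2) : ℝ)

/-- The scale `ℓ_- = γ^(-1+αm)`. -/
def scaleMinus (αm γ : ℝ) : ℝ := γ ^ (-1 + αm)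

/-- The scale `ℓ_+ = γ^(-1-αp)`. -/
def scalePlus (αp γ : ℝ) : ℝ := γ ^ (-1 - αp)

/-- The three scales are powers `2^n`, `n ∈ ℕ` (hence so is `γ^(-1)`), so that each of the three
partitions into cubes refines the next one. -/
def AreDyadicScales (αm αp γ : ℝ) : Prop :=
  (∃ n : ℕ, mesh γ = 2 ^ n) ∧ (∃ n : ℕ, scaleMinus αm γ = 2 ^ n) ∧
    ∃ n : ℕ, scalePlus αp γ = 2 ^ n

/-- Densities on the region `A`: non-negative functions which are constant on the cubes of side
`γ^(-1/2)`; a function on `A` is represented by its extension by zero. -/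
structure IsDensityOn {d S : ℕ} (γ : ℝ) (A : Set (Space d)) (ρ : Space d → Fin S → ℝ) : Prop where
  nonneg : ∀ r s, 0 ≤ ρ r s
  cubeFun : IsCubeFun (mesh γ) ρ
  eq_zero : ∀ r, r ∉ A → ρ r = 0

/-- The set of densities on `A` that are in the phase with mean field density `u`: in each cube
of side `ℓ_-` met by `A` the averages are within the accuracy `ζ = γ^a` of `u`. -/
def phaseDensities {d S : ℕ} (a αm γ : ℝ) (u : Fin S → ℝ) (A : Set (Space d)) :
    Set (Space d → Fin S → ℝ) :=
  {ρ | IsDensityOn γ A ρ ∧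
    ∀ r ∈ A, ∀ s, |(⨍ x in cubeOf (scaleMinus αm γ) r, ρ x s) - u s| ≤ γ ^ a}

/-! ### The discretized functionals -/

/-- The volume `γ^(-d/2)` of a cube of side `γ^(-1/2)`. -/
def cellVolume (d : ℕ) (γ : ℝ) : ℝ := γ ^ (-(d : ℝ) / 2)

/-- The kernel `J_γ` averaged over pairs of cubes of side `γ^(-1/2)`. -/
def averagedKernel {d : ℕ} (γ : ℝ) (J : Space d → Space d → ℝ) (x y : Fin d → ℤ) : ℝ :=
  ⨍ r in cube (mesh γ) x, ⨍ r' in cube (mesh γ) y, scaledKernel γ J r r'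

/-- The discretization of `J_γ * J_γ`; the sum over `y` has finitely many nonzero terms. -/
def pairKernel {d : ℕ} (γ : ℝ) (J : Space d → Space d → ℝ) (x x' : Fin d → ℤ) : ℝ :=
  cellVolume d γ * ∑' y : Fin d → ℤ,
    averagedKernel γ J x y * (cellVolume d γ * averagedKernel γ J y x')

/-- `(f, g) = ∑_x ∑_s f(x,s) g(x,s)`, the sum being over the lattice `γ^(-1/2) ℤ^d`, whose points
are indexed by `ℤ^d`. It is used when `f` has finite support. -/
def pairing {d S : ℕ} (f g : (Fin d → ℤ) → Fin S → ℝ) : ℝ :=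
  ∑' x : Fin d → ℤ, ∑ s, f x s * g x s

/-- The restriction of a function to the lattice `γ^(-1/2) ℤ^d`. -/
def onLattice {d S : ℕ} (γ : ℝ) (ρ : Space d → Fin S → ℝ) (x : Fin d → ℤ) (s : Fin S) : ℝ :=
  ρ (latticePoint (mesh γ) x) s

/-- The indicator of `A` on the lattice. -/
def latticeIndicator {d S : ℕ} (γ : ℝ) (A : Set (Space d)) (x : Fin d → ℤ) (_s : Fin S) : ℝ :=
  A.indicator (fun _ => (1 : ℝ)) (latticePoint (mesh γ) x)

/-- `(V* g)(x,s) = ∑_{x'} ∑_{s' ≠ s} V(x,x') g(x',s')`, a finite sum as `V` has finite range. -/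
def interaction {d S : ℕ} (γ : ℝ) (J : Space d → Space d → ℝ)
    (g : (Fin d → ℤ) → Fin S → ℝ) (x : Fin d → ℤ) (s : Fin S) : ℝ :=
  ∑' x' : Fin d → ℤ, ∑ s', if s ≠ s' then pairKernel γ J x x' * g x' s' else 0

/-- The discretized free energy `F*_{A,lam}(ρ | ρbar)` of the density `ρ` in `A` given the
boundary density `ρbar` in the complement of `A`. -/
def freeEnergy {d S : ℕ} (β lam γ : ℝ) (J : Space d → Space d → ℝ) (A : Set (Space d))
    (ρ ρbar : Space d → Fin S → ℝ) : ℝ :=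
  cellVolume d γ *
      ((1 / 2) * pairing (onLattice γ ρ) (interaction γ J (onLattice γ ρ))
        - (1 / β) * pairing (latticeIndicator γ A)
            (fun x s => entropy (onLattice γ ρ x s) + β * lam * onLattice γ ρ x s))
    + cellVolume d γ * pairing (onLattice γ ρ) (interaction γ J (onLattice γ ρbar))

/-- The one-body energy `h(ρ) = γ^(-d/2) ∑_s ∑_{x ∈ A} (r_s - lam) ρ(x,s)`, where
`r_s = ∑_{s' ≠ s} u_{s'}` is the mean field potential of the phase `u`. -/
def oneBodyEnergy {d S : ℕ} (lam γ : ℝ) (u : Fin S → ℝ) (A : Set (Space d))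
    (ρ : Space d → Fin S → ℝ) : ℝ :=
  cellVolume d γ * pairing (latticeIndicator γ A)
    (fun x s => ((∑ s', if s' ≠ s then u s' else 0) - lam) * onLattice γ ρ x s)

/-- The interpolated functional
`t F*_{A,lam}(ρ | ρbar) + (1 - t) (h(ρ) - (1/β) γ^(-d/2) ∑_s ∑_{x ∈ A} S(ρ(x,s)))`. -/
def interpolatedFreeEnergy {d S : ℕ} (β lam γ : ℝ) (J : Space d → Space d → ℝ)
    (u : Fin S → ℝ) (A : Set (Space d)) (t : ℝ) (ρbar ρ : Space d → Fin S → ℝ) : ℝ :=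
  t * freeEnergy β lam γ J A ρ ρbar
    + (1 - t) * (oneBodyEnergy lam γ u A ρ
        - (1 / β) * (cellVolume d γ * pairing (latticeIndicator γ A)
            (fun x s => entropy (onLattice γ ρ x s))))

/-- `ρhat` is a minimizer of the interpolated functional over the densities in `A` that are in
the phase `u`. -/
def IsConstrainedMinimizer {d S : ℕ} (β lam γ a αm : ℝ) (J : Space d → Space d → ℝ)
    (u : Fin S → ℝ) (A : Set (Space d)) (t : ℝ) (ρbar ρhat : Space d → Fin S → ℝ) : Prop :=
  ρhat ∈ phaseDensities a αm γ u A ∧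
    IsMinOn (interpolatedFreeEnergy β lam γ J u A t ρbar) (phaseDensities a αm γ u A) ρhat

end KacPotts

end

/-!
The densities are determined by their values on the lattice of mesh `N = γ^(-1/2)`. In units of the
mesh the phase constraint is a condition on averages over blocks of side `L`, with
`L / N = γ^αm ≪ 1`, and the pair interaction is `comp q`, the square of the stochastic kernel `q`
which averaging `J_γ` yields (`IsKacKernel.isLatticeKernel`). The kernel `q` has range `N`, so that
`exp (-γ ω dist)` is exponential decay on the scale of its range. The proof rests on four facts.

* *The mean field minimizers are nondegenerate.* A null direction of the Hessian at a minimizer must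
  also annihilate the third derivative. At the symmetric point `u = 1/β` a cubic perturbation
  excludes this, because `S ≥ 3`. At any other point a null direction forces one component above
  `1/β` and all others equal and below it, and then the second and third order conditions give an
  algebraic relation that contradicts the critical point equation
  (`no_degenerate_pair`, `IsMeanFieldMinimizer.exists_coercive`).

* *Minimizers of the constrained problem are uniformly close to `u`.* The kernel only sees block
  averages, which the constraint keeps within `ζ` of `u`, so the potential is within
  `O(ζ + L / N)` of its mean field value at every site (`IsLatticeKernel.abs_avg_le`). The
  constraint is invariant under exchange of mass inside a block, and it allows a block to be moved
  to `u`. These two variations transfer the bound from the potential to `log f - log u`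
  (`abs_log_sub_log_le`). In particular the constraint never has to be shown to be inactive.

* *The functional is strictly convex near `u`.* As `comp q` is the square of a symmetric contraction
  of `ℓ²`, the quadratic form of the interaction inherits the lower bound of the mean field Hessian
  (`couple_form_ge`). This holds uniformly in `t ∈ [0, 1]`, and gives uniqueness
  (`latticeMinimizer_unique`); existence is compactness.

* *Coercivity survives conjugation with an exponential weight* of rate `ω / N`, `ω` small
  (`weighted_coercive`). The weight is constant on blocks, so that moving `f` towards `u` with
  strength given by the squared weight respects the constraint. The variational inequality then
  bounds the weighted `ℓ²` norm of the deviation by the contribution of the boundary condition,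
  which acts only within distance `2 N` of the boundary (`weighted_deviation_le`). The size
  `N^(-d)` of the kernel turns this into a pointwise bound on the potential
  (`abs_avg_le_of_weighted`), and `abs_log_sub_log_le` into one on the density
  (`lattice_minimizer_decay`).
-/

namespace KacPotts

/-! ### Second order conditions in mean field theory -/

/-- The potential `∑_{s' ≠ s} f s'` felt by the component `s`. -/
noncomputable def offSum {S : ℕ} (f : Fin S → ℝ) (s : Fin S) : ℝ :=
  ∑ s', if s ≠ s' then f s' else 0

theorem offSum_eq {S : ℕ} (f : Fin S → ℝ) (s : Fin S) : offSum f s = ∑ s', f s' - f s := by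
  have h : ∀ s', (if s ≠ s' then f s' else 0) = f s' - if s = s' then f s' else 0 := by
    intro s'; by_cases h : s = s' <;> simp [h]
  unfold offSum
  rw [Finset.sum_congr rfl fun s' _ => h s', Finset.sum_sub_distrib]
  simp

theorem offSum_eq' {S : ℕ} (f : Fin S → ℝ) (s : Fin S) :
    (∑ s', if s' ≠ s then f s' else 0) = offSum f s := by
  simp only [offSum, ne_comm]

theorem sum_mul_offSum_comm {S : ℕ} (v w : Fin S → ℝ) :
    ∑ s, v s * offSum w s = ∑ s, w s * offSum v s := by
  simp only [offSum_eq, mul_sub, Finset.sum_sub_distrib, ← Finset.sum_mul]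
  rw [mul_comm (∑ s, v s)]
  simp only [mul_comm]

theorem offSum_add {S : ℕ} (v w : Fin S → ℝ) (s : Fin S) :
    offSum (fun s => v s + w s) s = offSum v s + offSum w s := by
  simp only [offSum_eq, Finset.sum_add_distrib]; ring

theorem offSum_smul {S : ℕ} (c : ℝ) (v : Fin S → ℝ) (s : Fin S) :
    offSum (fun s => c * v s) s = c * offSum v s := by
  simp only [offSum_eq, ← Finset.mul_sum]; ring

theorem abs_offSum_le {S : ℕ} (f : Fin S → ℝ) (s : Fin S) : |offSum f s| ≤ ∑ s', |f s'| := by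
  refine (Finset.abs_sum_le_sum_abs _ _).trans (Finset.sum_le_sum fun s' _ => ?_)
  split_ifs <;> simp

theorem meanFieldFreeEnergy_eq {S : ℕ} (β lam : ℝ) (u : Fin S → ℝ) :
    meanFieldFreeEnergy β lam u =
      (1 / 2) * (∑ s, u s * offSum u s) - lam * (∑ s, u s) - (1 / β) * ∑ s, entropy (u s) := by
  unfold meanFieldFreeEnergy
  congr 3
  refine Finset.sum_congr rfl fun s _ => ?_
  simp [offSum, Finset.mul_sum]

theorem meanFieldFreeEnergy_add_sub {S : ℕ} (β lam : ℝ) (u v : Fin S → ℝ) :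
    meanFieldFreeEnergy β lam (fun s => u s + v s) - meanFieldFreeEnergy β lam u =
      ∑ s, v s * (offSum u s - lam) + (1 / 2) * ∑ s, v s * offSum v s
        + (1 / β) * ∑ s, (entropy (u s) - entropy (u s + v s)) := by
  simp only [meanFieldFreeEnergy_eq, offSum_add, add_mul, mul_add, Finset.sum_add_distrib,
    mul_sub, Finset.sum_sub_distrib]
  rw [sum_mul_offSum_comm u v, ← Finset.sum_mul]
  ring

/-- Fourth order expansion of `-entropy` around a positive density. -/
theorem entropy_sub_entropy_le {u x : ℝ} (hu : 0 < u) (hx : |x| ≤ 1 / 2) :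
    entropy u - entropy (u + u * x) ≤
      u * x * Real.log u + u * x ^ 2 / 2 - u * x ^ 3 / 6 + 4 * u * x ^ 4 := by
  have hx' := abs_le.mp hx
  have h := Real.abs_log_sub_add_sum_range_le (x := -x) (by rw [abs_neg]; linarith) 3
  have h2 : |(-x)| ^ (3 + 1) / (1 - |(-x)|) ≤ 2 * x ^ 4 := by
    rw [abs_neg, div_le_iff₀ (by linarith)]
    have : |x| ^ (3 + 1) = x ^ 4 := by
      rw [show 3 + 1 = 4 from rfl, ← abs_pow, abs_of_nonneg (by positivity)]
    rw [this]
    nlinarith [show (0 : ℝ) ≤ x ^ 4 by positivity]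
  have h3 := abs_le.mp (h.trans h2)
  simp only [Finset.sum_range_succ, Finset.sum_range_zero, sub_neg_eq_add] at h3
  norm_num at h3
  have hl : Real.log (1 + x) ≤ x - x ^ 2 / 2 + x ^ 3 / 3 + 2 * x ^ 4 := by
    have := h3.2
    have e : (-x) ^ 3 = - x ^ 3 := by ring
    rw [e] at this
    linarith
  have hlog : Real.log (u + u * x) = Real.log u + Real.log (1 + x) := by
    rw [← Real.log_mul hu.ne' (by linarith)]; congr 1; ring
  have h1x : 0 < 1 + x := by linarith
  unfold entropy
  rw [hlog]
  have key : (1 + x) * Real.log (1 + x) ≤ x + x ^ 2 / 2 - x ^ 3 / 6 + 4 * x ^ 4 := by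
    refine (mul_le_mul_of_nonneg_left hl h1x.le).trans ?_
    nlinarith [show (0 : ℝ) ≤ x ^ 4 by positivity]
  nlinarith [mul_le_mul_of_nonneg_left key hu.le]

/-- Necessary conditions at a local minimum, read off from a Taylor polynomial. -/
theorem taylor_coeffs_of_nonneg {c₁ c₂ c₃ C δ : ℝ} (hδ : 0 < δ)
    (h : ∀ τ : ℝ, |τ| ≤ δ → 0 ≤ τ * c₁ + τ ^ 2 * c₂ + τ ^ 3 * c₃ + τ ^ 4 * C) :
    c₁ = 0 ∧ 0 ≤ c₂ ∧ (c₂ = 0 → c₃ = 0) := by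
  -- a continuous function which is nonnegative on a one-sided neighbourhood of `0`
  have lim : ∀ a b c e : ℝ, (∀ τ : ℝ, 0 < τ → τ ≤ δ → 0 ≤ a + τ * b + τ ^ 2 * c + τ ^ 3 * e) →
      0 ≤ a := by
    intro a b c e hh
    have hc : Filter.Tendsto (fun τ : ℝ => a + τ * b + τ ^ 2 * c + τ ^ 3 * e)
        (nhdsWithin 0 (Set.Ioi 0)) (nhds a) := by
      have : Continuous (fun τ : ℝ => a + τ * b + τ ^ 2 * c + τ ^ 3 * e) := by fun_prop
      have := this.tendsto 0
      simp only [zero_mul, add_zero, ne_eq, OfNat.ofNat_ne_zero, not_false_eq_true, zero_pow] at this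
      exact this.mono_left nhdsWithin_le_nhds
    refine ge_of_tendsto hc ?_
    filter_upwards [Ioc_mem_nhdsGT hδ] with τ hτ
    exact hh τ hτ.1 hτ.2
  have pos : ∀ τ : ℝ, 0 < τ → ∀ y : ℝ, 0 ≤ τ * y → 0 ≤ y := fun τ hτ y hy =>
    nonneg_of_mul_nonneg_right hy hτ
  have h1 : 0 ≤ c₁ := by
    refine lim c₁ c₂ c₃ C fun τ h0 h1 => pos τ h0 _ ?_
    have := h τ (by rw [abs_of_pos h0]; exact h1)
    nlinarith
  have h1' : 0 ≤ -c₁ := by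
    refine lim (-c₁) c₂ (-c₃) C fun τ h0 h1 => pos τ h0 _ ?_
    have := h (-τ) (by rw [abs_neg, abs_of_pos h0]; exact h1)
    nlinarith
  have hc1 : c₁ = 0 := by linarith
  subst hc1
  refine ⟨rfl, ?_, ?_⟩
  · refine lim c₂ c₃ C 0 fun τ h0 h1 => pos _ (pow_pos h0 2) _ ?_
    have := h τ (by rw [abs_of_pos h0]; exact h1)
    nlinarith
  · rintro rfl
    have h3 : 0 ≤ c₃ := by
      refine lim c₃ C 0 0 fun τ h0 h1 => pos _ (pow_pos h0 3) _ ?_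
      have := h τ (by rw [abs_of_pos h0]; exact h1)
      nlinarith
    have h3' : 0 ≤ -c₃ := by
      refine lim (-c₃) C 0 0 fun τ h0 h1 => pos _ (pow_pos h0 3) _ ?_
      have := h (-τ) (by rw [abs_neg, abs_of_pos h0]; exact h1)
      nlinarith
    linarith

/-- The Hessian of the mean field free energy at `u`, as a quadratic form. -/
noncomputable def hessForm {S : ℕ} (β : ℝ) (u v : Fin S → ℝ) : ℝ :=
  ∑ s, v s ^ 2 / (β * u s) + ∑ s, v s * offSum v s

section Minimizer

variable {S : ℕ} {β lam : ℝ} {u : Fin S → ℝ}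

/-- A minimizer has positive components, since the slope of the entropy is infinite at `0`. -/
theorem IsMeanFieldMinimizer.pos (hβ : 0 < β) (h : IsMeanFieldMinimizer β lam u) (s : Fin S) :
    0 < u s := by
  refine lt_of_le_of_ne (h.1 s) fun h0 => ?_
  have key : ∀ τ : ℝ, 0 < τ → 0 ≤ offSum u s - lam + (1 / β) * (Real.log τ - 1) := by
    intro τ hτ
    have hm : meanFieldFreeEnergy β lam u ≤
        meanFieldFreeEnergy β lam (fun s' => u s' + if s' = s then τ else 0) :=
      h.2 (show (fun s' => u s' + if s' = s then τ else 0) ∈ {v | ∀ s, 0 ≤ v s} from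
        fun s' => by
          have := h.1 s'
          show 0 ≤ u s' + if s' = s then τ else 0
          split_ifs <;> linarith)
    have e := meanFieldFreeEnergy_add_sub β lam u (fun s' => if s' = s then τ else 0)
    have e1 : ∑ s', (if s' = s then τ else 0) * (offSum u s' - lam) = τ * (offSum u s - lam) := by
      simp
    have e2 : ∑ s', (if s' = s then τ else 0) *
        offSum (fun s' => if s' = s then τ else 0) s' = 0 := by
      simp [offSum_eq]
    have e3 : ∑ s', (entropy (u s') - entropy (u s' + if s' = s then τ else 0))
        = τ * (Real.log τ - 1) := by
      rw [Finset.sum_eq_single s]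
      · simp [← h0, entropy]
      · intro b _ hb; simp [hb]
      · simp
    rw [e1, e2, e3] at e
    have : 0 ≤ τ * (offSum u s - lam + (1 / β) * (Real.log τ - 1)) := by
      linarith
    exact nonneg_of_mul_nonneg_right this hτ
  -- for this `τ` the right-hand side of `key` is `-1 / β`
  have := key (Real.exp (- β * (offSum u s - lam))) (Real.exp_pos _)
  rw [Real.log_exp] at this
  have e : offSum u s - lam + 1 / β * (-β * (offSum u s - lam) - 1) = - (1 / β) := by
    field_simp; ring
  rw [e] at this
  have : 0 < 1 / β := by positivity
  linarith

/-- The Taylor coefficients of the free energy along a line through a minimizer. -/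
theorem IsMeanFieldMinimizer.taylor (hβ : 0 < β) (h : IsMeanFieldMinimizer β lam u)
    (w : Fin S → ℝ) :
    ∑ s, w s * (offSum u s - lam + (1 / β) * Real.log (u s)) = 0 ∧ 0 ≤ hessForm β u w ∧
      (hessForm β u w = 0 → ∑ s, w s ^ 3 / u s ^ 2 = 0) := by
  have hu := h.pos hβ
  set B := ∑ s, |w s / u s| with hB
  have hB0 : 0 ≤ B := Finset.sum_nonneg fun _ _ => abs_nonneg _
  have hwB : ∀ s, |w s / u s| ≤ B := fun s =>
    Finset.single_le_sum (f := fun s => |w s / u s|) (fun _ _ => abs_nonneg _) (Finset.mem_univ s)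
  obtain ⟨r1, r2, r3⟩ := taylor_coeffs_of_nonneg (δ := 1 / (2 * (1 + B)))
    (c₁ := ∑ s, w s * (offSum u s - lam + (1 / β) * Real.log (u s)))
    (c₂ := (1 / 2) * hessForm β u w) (c₃ := - (1 / (6 * β)) * ∑ s, w s ^ 3 / u s ^ 2)
    (C := (1 / β) * ∑ s, 4 * u s * (w s / u s) ^ 4) (by positivity) (by
      intro τ hτ
      have hx : ∀ s, |τ * (w s / u s)| ≤ 1 / 2 := by
        intro s
        rw [abs_mul]
        calc |τ| * |w s / u s| ≤ 1 / (2 * (1 + B)) * B := by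
              gcongr; exact hwB s
          _ ≤ 1 / 2 := by
              rw [div_mul_eq_mul_div, div_le_iff₀ (by positivity)]; linarith
      have hx2 : ∀ s, u s * (τ * (w s / u s)) = τ * w s := fun s => by
        have := (hu s).ne'; field_simp
      have hm : meanFieldFreeEnergy β lam u ≤ meanFieldFreeEnergy β lam (fun s => u s + τ * w s) :=
        h.2 (show (fun s => u s + τ * w s) ∈ {v | ∀ s, 0 ≤ v s} from fun s => by
          have := (abs_le.mp (hx s)).1
          have := hx2 s
          show 0 ≤ u s + τ * w s
          nlinarith [hu s])
      have e := meanFieldFreeEnergy_add_sub β lam u (fun s => τ * w s)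
      have hs : ∑ s, (entropy (u s) - entropy (u s + τ * w s)) ≤
          ∑ s, (τ * (w s * Real.log (u s)) + τ ^ 2 * (w s ^ 2 / u s / 2)
            - τ ^ 3 * (w s ^ 3 / u s ^ 2 / 6) + τ ^ 4 * (4 * u s * (w s / u s) ^ 4)) := by
        refine Finset.sum_le_sum fun s _ => ?_
        have := entropy_sub_entropy_le (hu s) (hx s)
        rw [hx2] at this
        refine this.trans (le_of_eq ?_)
        have := (hu s).ne'
        field_simp
      rw [Finset.sum_add_distrib (f := fun s => τ * (w s * Real.log (u s))
            + τ ^ 2 * (w s ^ 2 / u s / 2) - τ ^ 3 * (w s ^ 3 / u s ^ 2 / 6)),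
        Finset.sum_sub_distrib (f := fun s => τ * (w s * Real.log (u s))
            + τ ^ 2 * (w s ^ 2 / u s / 2)), Finset.sum_add_distrib,
        ← Finset.mul_sum, ← Finset.mul_sum, ← Finset.mul_sum, ← Finset.mul_sum,
        ← Finset.sum_div, ← Finset.sum_div] at hs
      have hs' := mul_le_mul_of_nonneg_left hs (show 0 ≤ 1 / β by positivity)
      have f1 : ∑ s, τ * w s * (offSum u s - lam) = τ * ∑ s, w s * (offSum u s - lam) := by
        rw [Finset.mul_sum]; exact Finset.sum_congr rfl fun _ _ => by ring
      have f2 : ∑ s, τ * w s * offSum (fun s => τ * w s) s = τ ^ 2 * ∑ s, w s * offSum w s := by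
        rw [Finset.mul_sum]; refine Finset.sum_congr rfl fun _ _ => ?_
        rw [offSum_smul]; ring
      have f3 : ∑ s, w s * (offSum u s - lam + (1 / β) * Real.log (u s)) =
          ∑ s, w s * (offSum u s - lam) + (1 / β) * ∑ s, w s * Real.log (u s) := by
        rw [Finset.mul_sum, ← Finset.sum_add_distrib]
        exact Finset.sum_congr rfl fun _ _ => by ring
      have f4 : ∑ s, w s ^ 2 / (β * u s) = (1 / β) * ∑ s, w s ^ 2 / u s := by
        rw [Finset.mul_sum]; refine Finset.sum_congr rfl fun s _ => ?_
        have := (hu s).ne'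
        field_simp
      simp only [f1, f2] at e
      rw [f3]
      unfold hessForm
      rw [f4]
      have f5 : (1:ℝ) / (6 * β) = (1 / β) / 6 := by field_simp
      rw [f5]
      linarith)
  refine ⟨r1, by linarith, fun h0 => ?_⟩
  have := r3 (by rw [h0]; ring)
  rcases mul_eq_zero.mp this with h6 | h6
  · have : 0 < 1 / (6 * β) := by positivity
    linarith
  · exact h6

theorem IsMeanFieldMinimizer.critical (hβ : 0 < β) (h : IsMeanFieldMinimizer β lam u)
    (s : Fin S) : offSum u s - lam + (1 / β) * Real.log (u s) = 0 := by
  have := (h.taylor hβ (fun s' => if s' = s then 1 else 0)).1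
  simpa using this

end Minimizer

/-- The transcendental equation of two coexisting component densities and the algebraic equation
for a Hessian which degenerates to third order have no common solution. -/
theorem no_degenerate_pair {A B : ℝ} (hA : 0 < A) (hA1 : A < 1) (hB : 1 < B)
    (hlog : Real.log B - B = Real.log A - A) (h : B * (1 - A) ^ 2 = (B - 1) ^ 2) : False := by
  obtain ⟨y, hy, rfl⟩ : ∃ y : ℝ, 1 < y ∧ y ^ 2 = B :=
    ⟨√B, by rw [← Real.sqrt_one]; exact Real.sqrt_lt_sqrt zero_le_one hB,
      Real.sq_sqrt (by linarith)⟩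
  have hy0 : 0 < y := by linarith
  have hyA : y * (1 - A) = y ^ 2 - 1 := by
    have h1 : (y * (1 - A)) ^ 2 = (y ^ 2 - 1) ^ 2 := by rw [mul_pow]; exact h
    rwa [sq_eq_sq₀ (by nlinarith) (by nlinarith)] at h1
  have hAy : A = 1 - y + y⁻¹ := by
    field_simp; linarith
  -- `D x` is the defect of the transcendental equation when `B = x ^ 2` and `A = 1 - x + x⁻¹`, the
  -- solution of the algebraic equation; it vanishes at `x = 1` and is increasing
  let D : ℝ → ℝ := fun x => 2 * Real.log x - Real.log (1 - x + x⁻¹) - x ^ 2 + (1 - x + x⁻¹)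
  -- positivity of the smaller density on the whole interval
  have hpos : ∀ x ∈ Set.Icc 1 y, 0 < 1 - x + x⁻¹ := by
    intro x hx
    have : y⁻¹ ≤ x⁻¹ := inv_anti₀ (by linarith [hx.1]) hx.2
    linarith [hx.2]
  have hder : ∀ x ∈ Set.Icc 1 y, HasDerivAt D
      (2 * x⁻¹ - (-1 + -(x ^ 2)⁻¹) / (1 - x + x⁻¹) - 2 * x + (-1 + -(x ^ 2)⁻¹)) x := by
    intro x hx
    have hx0 : x ≠ 0 := by linarith [hx.1]
    have h1 : HasDerivAt (fun x : ℝ => 1 - x + x⁻¹) (-1 + -(x ^ 2)⁻¹) x :=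
      ((hasDerivAt_id x).const_sub 1).add (hasDerivAt_inv hx0)
    have h2 := h1.log (hpos x hx).ne'
    have h3 := (Real.hasDerivAt_log hx0).const_mul 2
    have h4 := hasDerivAt_pow 2 x
    have h5 := ((h3.sub h2).sub h4).add h1
    refine h5.congr_deriv ?_
    norm_num
  have hmono : StrictMonoOn D (Set.Icc 1 y) := by
    refine strictMonoOn_of_deriv_pos (convex_Icc 1 y)
      (fun x hx => (hder x hx).continuousAt.continuousWithinAt) fun x hx => ?_
    rw [interior_Icc] at hx
    rw [(hder x ⟨hx.1.le, hx.2.le⟩).deriv]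
    have hx1 : 1 < x := hx.1
    have hx0 : 0 < x := by linarith
    have ha := hpos x ⟨hx.1.le, hx.2.le⟩
    have ha' : 0 < x * (1 - x) + 1 := by
      have : x * (1 - x + x⁻¹) = x * (1 - x) + 1 := by field_simp
      rw [← this]; positivity
    have : 2 * x⁻¹ - (-1 + -(x ^ 2)⁻¹) / (1 - x + x⁻¹) - 2 * x + (-1 + -(x ^ 2)⁻¹)
        = (x ^ 2 - 1) ^ 2 * (2 * x - 1) / (x ^ 2 * (x * (1 - x) + 1)) := by
      have e : 1 - x + x⁻¹ = (x * (1 - x) + 1) / x := by field_simp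
      rw [e]
      have := ha'.ne'
      field_simp
      ring
    rw [this]
    have : x ^ 2 - 1 ≠ 0 := by nlinarith
    have : 0 < 2 * x - 1 := by linarith
    positivity
  have := hmono (Set.left_mem_Icc.mpr hy.le) (Set.right_mem_Icc.mpr hy.le) hy
  simp only [D] at this
  rw [← hAy] at this
  have h2 : Real.log (y ^ 2) = 2 * Real.log y := by rw [Real.log_pow]; norm_num
  rw [h2] at hlog
  norm_num at this
  linarith

theorem log_sub_self_ne {x y : ℝ} (hx : 0 < x) (hxy : x < y) (hy : y ≤ 1) :
    Real.log x - x ≠ Real.log y - y := by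
  intro h
  have hy0 : 0 < y := by linarith
  have h1 := Real.log_lt_sub_one_of_pos (div_pos hx hy0) (by
    intro h; rw [div_eq_one_iff_eq hy0.ne'] at h; linarith)
  rw [Real.log_div hx.ne' hy0.ne'] at h1
  have h2 : x / y ≤ 1 - (y - x) := by
    rw [div_le_iff₀ hy0]; nlinarith
  linarith

section Minimizer

variable {S : ℕ} {β lam : ℝ} {u : Fin S → ℝ}

theorem hessForm_eq (v : Fin S → ℝ) :
    hessForm β u v = ∑ s, ((β * u s)⁻¹ - 1) * v s ^ 2 + (∑ s, v s) ^ 2 := by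
  unfold hessForm
  simp only [offSum_eq, mul_sub, Finset.sum_sub_distrib, ← Finset.sum_mul, sub_mul]
  rw [sq (∑ s, v s)]
  simp only [div_eq_inv_mul, one_mul, ← sq]
  ring

theorem sum_eq_add_of_forall_eq_zero {S : ℕ} (f : Fin S → ℝ) (a b : Fin S) (hab : a ≠ b)
    (h : ∀ s, s ≠ a → s ≠ b → f s = 0) : ∑ s, f s = f a + f b := by
  rw [← Finset.sum_pair hab]
  refine (Finset.sum_subset (Finset.subset_univ _) fun s _ hs => ?_).symm
  simp only [Finset.mem_insert, Finset.mem_singleton, not_or] at hs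
  exact h s hs.1 hs.2

/-- The Hessian at a minimizer has trivial kernel. A null direction would have to annihilate the
third derivative as well, and for three or more components this is incompatible with the critical
point equation. -/
theorem IsMeanFieldMinimizer.hessForm_ne_zero (hS : 3 ≤ S) (hβ : 0 < β)
    (h : IsMeanFieldMinimizer β lam u) (v : Fin S → ℝ) (hv : hessForm β u v = 0) : v = 0 := by
  have hu := h.pos hβ
  have hform := hessForm_eq (β := β) (u := u)
  have hcrit := h.critical hβ
  have htay := h.taylor hβ
  -- the Hessian is the diagonal form `κ` plus the square of the sum of the components
  set κ : Fin S → ℝ := fun s => (β * u s)⁻¹ - 1 with hκ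
  set σ := ∑ s, v s with hσ
  have hW : ∀ s, 0 < β * u s := fun s => mul_pos hβ (hu s)
  have hlog : ∀ s s', Real.log (β * u s) - β * u s = Real.log (β * u s') - β * u s' := by
    intro s s'
    have e1 := hcrit s
    have e2 := hcrit s'
    rw [offSum_eq] at e1 e2
    rw [Real.log_mul hβ.ne' (hu s).ne', Real.log_mul hβ.ne' (hu s').ne']
    have e1' : β * (∑ s', u s' - u s - lam + 1 / β * Real.log (u s)) = 0 := by rw [e1]; ring
    have e2' : β * (∑ s', u s' - u s' - lam + 1 / β * Real.log (u s')) = 0 := by rw [e2]; ring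
    have e3 : β * (1 / β * Real.log (u s)) = Real.log (u s) := by field_simp
    have e4 : β * (1 / β * Real.log (u s')) = Real.log (u s') := by field_simp
    linarith
  -- null directions of a nonnegative form lie in its kernel
  have hnull : ∀ s, κ s * v s + σ = 0 := by
    intro s
    have := (taylor_coeffs_of_nonneg (c₁ := 2 * (κ s * v s + σ)) (c₂ := κ s + 1) (c₃ := 0)
      (C := 0) one_pos (fun τ _ => by
        have h0 := (htay (fun s' => v s' + if s' = s then τ else 0)).2.1
        rw [hform] at h0 hv
        have e1 : ∑ s', (v s' + if s' = s then τ else 0) = σ + τ := by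
          rw [Finset.sum_add_distrib]; simp [hσ]
        have e2 : ∑ s', ((β * u s')⁻¹ - 1) * (v s' + if s' = s then τ else 0) ^ 2 =
            ∑ s', ((β * u s')⁻¹ - 1) * v s' ^ 2 + (2 * τ * (κ s * v s) + τ ^ 2 * κ s) := by
          rw [← sub_eq_iff_eq_add', ← Finset.sum_sub_distrib, Finset.sum_eq_single s]
          · simp only [if_true, hκ]; ring
          · intro b _ hb; simp [hb]
          · simp
        rw [e1, e2] at h0
        have : (σ + τ) ^ 2 = σ ^ 2 + 2 * τ * σ + τ ^ 2 := by ring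
        linarith)).1
    linarith
  by_cases hσ0 : σ = 0
  · by_contra hv0
    obtain ⟨s, hs⟩ : ∃ s, v s ≠ 0 := by
      by_contra hcon
      push Not at hcon
      exact hv0 (funext hcon)
    have hκs : κ s = 0 := by
      have := hnull s
      rw [hσ0, add_zero] at this
      exact (mul_eq_zero.mp this).resolve_right hs
    have hWs : β * u s = 1 := by
      have : (β * u s)⁻¹ = 1 := by simp only [hκ] at hκs; linarith
      exact inv_eq_one.mp this
    have hWall : ∀ s', β * u s' = 1 := by
      intro s'
      by_contra hne
      have h1 := Real.log_lt_sub_one_of_pos (hW s') hne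
      have h2 := hlog s' s
      rw [hWs, Real.log_one] at h2
      linarith
    -- the symmetric point `u = 1 / β`, excluded by a cubic perturbation
    let i0 : Fin S := ⟨0, by omega⟩
    let i1 : Fin S := ⟨1, by omega⟩
    let i2 : Fin S := ⟨2, by omega⟩
    have h01 : i0 ≠ i1 := by simp [i0, i1]
    have h02 : i0 ≠ i2 := by simp [i0, i2]
    have h12 : i1 ≠ i2 := by simp [i1, i2]
    let w : Fin S → ℝ := fun s =>
      2 * (if s = i0 then 1 else 0) - (if s = i1 then 1 else 0) - (if s = i2 then 1 else 0)
    have hw0 : ∑ s, w s = 0 := by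
      simp only [w, Finset.sum_sub_distrib, ← Finset.mul_sum, Finset.sum_ite_eq',
        Finset.mem_univ, if_true]
      norm_num
    have hw1 : hessForm β u w = 0 := by
      rw [hform, hw0]; simp [hWall]
    have hw3 := (htay w).2.2 hw1
    have hui : ∀ s, u s = 1 / β := fun s => by
      rw [eq_div_iff hβ.ne', mul_comm]; exact hWall s
    have : ∑ s, w s ^ 3 / u s ^ 2 = 6 * β ^ 2 := by
      have e : ∀ s, w s ^ 3 / u s ^ 2 = β ^ 2 * (8 * (if s = i0 then 1 else 0)
          - (if s = i1 then 1 else 0) - (if s = i2 then 1 else 0)) := by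
        intro s
        rw [hui s]
        simp only [w]
        by_cases a0 : s = i0
        · subst a0; simp [h01, h02]; ring
        · by_cases a1 : s = i1
          · subst a1; simp [h01.symm, h12]; ring
          · by_cases a2 : s = i2
            · subst a2; simp [h02.symm, h12.symm]; ring
            · simp [a0, a1, a2]
      rw [Finset.sum_congr rfl fun s _ => e s, ← Finset.mul_sum]
      simp only [Finset.sum_sub_distrib, ← Finset.mul_sum, Finset.sum_ite_eq',
        Finset.mem_univ, if_true]
      ring
    rw [this] at hw3
    have : 0 < 6 * β ^ 2 := by positivity
    linarith
  · exfalso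
    have hκ0 : ∀ s, κ s ≠ 0 := fun s hs => by
      have := hnull s
      rw [hs] at this
      exact hσ0 (by linarith)
    have hvs : ∀ s, v s = -σ / κ s := fun s => by
      rw [eq_div_iff (hκ0 s)]; linarith [hnull s]
    -- exactly one component lies above `1 / β`: at least one by the nullity of the form, at most
    -- one by its nonnegativity on vectors of zero sum
    obtain ⟨s0, hs0⟩ : ∃ s, κ s < 0 := by
      by_contra hcon
      push Not at hcon
      rw [hform] at hv
      have h1 : 0 ≤ ∑ s, ((β * u s)⁻¹ - 1) * v s ^ 2 :=
        Finset.sum_nonneg fun s _ => mul_nonneg (hcon s) (sq_nonneg _)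
      have : 0 < (∑ s, v s) ^ 2 := by positivity
      linarith
    have hother : ∀ s, s ≠ s0 → 0 < κ s := by
      intro s hs
      have h0 := (htay (fun s' => (if s' = s then 1 else 0) - if s' = s0 then 1 else 0)).2.1
      rw [hform, sum_eq_add_of_forall_eq_zero _ s s0 hs (fun a h1 h2 => by simp [h1, h2])] at h0
      simp only [Finset.sum_sub_distrib, Finset.sum_ite_eq', Finset.mem_univ, if_true, if_neg hs,
        if_neg hs.symm] at h0
      have : 0 ≤ κ s + κ s0 := by simp only [hκ]; linarith
      linarith
    have hB : 1 < β * u s0 := by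
      have : (β * u s0)⁻¹ < 1 := by simp only [hκ] at hs0; linarith
      exact (inv_lt_one₀ (hW s0)).mp this
    have hA : ∀ s, s ≠ s0 → β * u s < 1 := fun s hs => by
      have : 1 < (β * u s)⁻¹ := by have := hother s hs; simp only [hκ] at this; linarith
      exact (one_lt_inv₀ (hW s)).mp this
    obtain ⟨s1, hs1⟩ : ∃ s1, s1 ≠ s0 := by
      have : Nontrivial (Fin S) := Fin.nontrivial_iff_two_le.mpr (by omega)
      exact exists_ne s0
    -- the critical point equation has one solution below `1 / β`, so the other components agree
    have hWeq : ∀ s, s ≠ s0 → u s = u s1 := by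
      intro s hs
      rcases lt_trichotomy (β * u s) (β * u s1) with h1 | h1 | h1
      · exact (log_sub_self_ne (hW s) h1 (hA s1 hs1).le (hlog s s1)).elim
      · exact mul_left_cancel₀ hβ.ne' h1
      · exact (log_sub_self_ne (hW s1) h1 (hA s hs).le (hlog s1 s)).elim
    have hsplit : ∀ f : Fin S → ℝ, (∀ s, s ≠ s0 → f s = f s1) →
        ∑ s, f s = f s0 + ((S : ℝ) - 1) * f s1 := by
      intro f hf
      rw [← Finset.add_sum_erase _ _ (Finset.mem_univ s0),
        Finset.sum_congr rfl (fun s hs => hf s (Finset.ne_of_mem_erase hs)), Finset.sum_const,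
        Finset.card_erase_of_mem (Finset.mem_univ _), Finset.card_univ, Fintype.card_fin,
        nsmul_eq_mul, Nat.cast_sub (by omega), Nat.cast_one]
    have hvw : ∀ s, s ≠ s0 → v s = v s1 := fun s hs => by
      rw [hvs s, hvs s1]; simp only [hκ, hWeq s hs]
    have hsum := hsplit v hvw
    have hcub := (htay v).2.2 hv
    rw [hsplit _ (fun s hs => by rw [hvw s hs, hWeq s hs])] at hcub
    rw [← hσ] at hsum
    set B := β * u s0 with hBdef
    set A := β * u s1 with hAdef
    have hA1 := hA s1 hs1
    have hA0 := hW s1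
    have hB0 := hW s0
    rw [← hAdef] at hA1 hA0
    rw [← hBdef] at hB0
    have hv0 : v s0 = σ * B / (B - 1) := by
      rw [hvs s0, div_eq_div_iff (hκ0 s0) (by linarith)]
      simp only [hκ, ← hBdef]
      field_simp; ring
    have hv1 : v s1 = -(σ * A / (1 - A)) := by
      rw [hvs s1, ← neg_div, div_eq_div_iff (hκ0 s1) (by linarith)]
      simp only [hκ, ← hAdef]
      field_simp
    have hu0 : u s0 = B / β := by rw [hBdef]; field_simp
    have hu1 : u s1 = A / β := by rw [hAdef]; field_simp
    have hB1 : B - 1 ≠ 0 := by linarith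
    have hA2 : 1 - A ≠ 0 := by linarith
    rw [hv0, hv1] at hsum
    -- the kernel equation; it eliminates `S` from the third order condition `hcub`
    have hn : ((S : ℝ) - 1) * (A / (1 - A)) = 1 / (B - 1) := by
      have : σ * (1 - B / (B - 1) + ((S : ℝ) - 1) * (A / (1 - A))) = 0 := by
        linear_combination hsum
      have := (mul_eq_zero.mp this).resolve_left hσ0
      have e : 1 - B / (B - 1) = - (1 / (B - 1)) := by field_simp; ring
      rw [e] at this; linarith
    rw [hv0, hv1, hu0, hu1] at hcub
    have e1 : (σ * B / (B - 1)) ^ 3 / (B / β) ^ 2 = σ ^ 3 * β ^ 2 * (B / (B - 1) ^ 3) := by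
      field_simp
    have e2 : (-(σ * A / (1 - A))) ^ 3 / (A / β) ^ 2
        = - (σ ^ 3 * β ^ 2 * ((A / (1 - A)) * (1 / (1 - A) ^ 2))) := by
      field_simp
    rw [e1, e2] at hcub
    have hc : σ ^ 3 * β ^ 2 * (B / (B - 1) ^ 3 - (((S : ℝ) - 1) * (A / (1 - A))) *
        (1 / (1 - A) ^ 2)) = 0 := by linear_combination hcub
    have hc' := (mul_eq_zero.mp hc).resolve_left (by positivity)
    rw [hn] at hc'
    refine no_degenerate_pair hA0 hA1 hB (hlog s0 s1) ?_
    field_simp at hc'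
    linarith

/-- The Hessian at a minimizer is positive definite. -/
theorem IsMeanFieldMinimizer.exists_coercive (hS : 3 ≤ S) (hβ : 0 < β)
    (h : IsMeanFieldMinimizer β lam u) :
    ∃ κ : ℝ, 0 < κ ∧ ∀ v : Fin S → ℝ, κ * ∑ s, v s ^ 2 ≤ hessForm β u v := by
  have hcont : Continuous (hessForm β u) := by
    unfold hessForm
    simp only [offSum_eq]
    fun_prop
  have : Nontrivial (Fin S) := Fin.nontrivial_iff_two_le.mpr (by omega)
  obtain ⟨z, hz, hmin⟩ := (isCompact_sphere (0 : Fin S → ℝ) 1).exists_isMinOn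
    (NormedSpace.sphere_nonempty.mpr zero_le_one) hcont.continuousOn
  have hz1 : ‖z‖ = 1 := by simpa using hz
  have hpos : 0 < hessForm β u z := by
    refine lt_of_le_of_ne (h.taylor hβ z).2.1 fun h0 => ?_
    have := h.hessForm_ne_zero hS hβ z h0.symm
    rw [this] at hz1; simp at hz1
  have hS0 : (0 : ℝ) < S := by exact_mod_cast (by omega : 0 < S)
  refine ⟨hessForm β u z / S, by positivity, fun v => ?_⟩
  by_cases hv : v = 0
  · subst hv; simp [hessForm, offSum]
  have hn : 0 < ‖v‖ := norm_pos_iff.mpr hv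
  have h1 : hessForm β u z ≤ hessForm β u (fun s => ‖v‖⁻¹ * v s) := by
    refine hmin (show (fun s => ‖v‖⁻¹ * v s) ∈ Metric.sphere (0 : Fin S → ℝ) 1 from ?_)
    have : (fun s => ‖v‖⁻¹ * v s) = ‖v‖⁻¹ • v := rfl
    rw [this, mem_sphere_zero_iff_norm, norm_smul, norm_inv, norm_norm, inv_mul_cancel₀ hn.ne']
  have h2 : hessForm β u (fun s => ‖v‖⁻¹ * v s) = (‖v‖⁻¹) ^ 2 * hessForm β u v := by
    unfold hessForm
    simp only [offSum_smul, mul_add, Finset.mul_sum]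
    congr 1 <;> exact Finset.sum_congr rfl fun _ _ => by ring
  have h3 : ∑ s, v s ^ 2 ≤ S * ‖v‖ ^ 2 := by
    calc ∑ s, v s ^ 2 ≤ ∑ _s : Fin S, ‖v‖ ^ 2 := Finset.sum_le_sum fun s _ => by
          rw [← sq_abs]; gcongr; exact norm_le_pi_norm v s
      _ = S * ‖v‖ ^ 2 := by simp
  rw [h2] at h1
  calc hessForm β u z / S * ∑ s, v s ^ 2 ≤ hessForm β u z / S * (S * ‖v‖ ^ 2) := by gcongr
    _ = hessForm β u z * ‖v‖ ^ 2 := by field_simp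
    _ ≤ ((‖v‖⁻¹) ^ 2 * hessForm β u v) * ‖v‖ ^ 2 := by gcongr
    _ = hessForm β u v := by field_simp

end Minimizer

/-! ### Blocks and stochastic kernels on the lattice -/

section Lattice

variable {d : ℕ}

/-- The sites at distance at most `R` from `x`, in the supremum norm. -/
noncomputable def box (x : Fin d → ℤ) (R : ℕ) : Finset (Fin d → ℤ) :=
  Finset.Icc (fun i => x i - R) (fun i => x i + R)

theorem mem_box_iff {x y : Fin d → ℤ} {R : ℕ} : y ∈ box x R ↔ dist x y ≤ R := by
  rw [box, Finset.mem_Icc, dist_pi_le_iff (Nat.cast_nonneg R), Pi.le_def, Pi.le_def,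
    ← forall_and]
  refine forall_congr' fun i => ?_
  rw [Int.dist_eq, abs_le]
  constructor
  · rintro ⟨h1, h2⟩
    have h1' : ((x i - R : ℤ) : ℝ) ≤ y i := by exact_mod_cast h1
    have h2' : (y i : ℝ) ≤ ((x i + R : ℤ) : ℝ) := by exact_mod_cast h2
    push_cast at h1' h2'
    constructor <;> linarith
  · rintro ⟨h1, h2⟩
    constructor
    · have : ((x i - R : ℤ) : ℝ) ≤ y i := by push_cast; linarith
      exact_mod_cast this
    · have : (y i : ℝ) ≤ ((x i + R : ℤ) : ℝ) := by push_cast; linarith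
      exact_mod_cast this

theorem card_box (x : Fin d → ℤ) (R : ℕ) : (box x R).card = (2 * R + 1) ^ d := by
  rw [box, Pi.card_Icc]
  have : ∀ i, (Finset.Icc (x i - R) (x i + R)).card = 2 * R + 1 := by
    intro i; rw [Int.card_Icc]; omega
  simp [this]

/-- The index of the block of side `L` that contains the site `z`. -/
def blk (L : ℕ) (z : Fin d → ℤ) : Fin d → ℤ := fun i => z i / L

/-- The block of side `L` with index `b`. -/
noncomputable def block (L : ℕ) (b : Fin d → ℤ) : Finset (Fin d → ℤ) :=
  Fintype.piFinset fun i => Finset.Ico (L * b i) (L * b i + L)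

theorem mem_block_iff {L : ℕ} (hL : 0 < L) {b z : Fin d → ℤ} : z ∈ block L b ↔ blk L z = b := by
  have hL' : (0 : ℤ) < L := by exact_mod_cast hL
  rw [block, Fintype.mem_piFinset, funext_iff]
  refine forall_congr' fun i => ?_
  rw [Finset.mem_Ico, blk, Int.ediv_eq_iff_of_pos hL']
  constructor <;> rintro ⟨h1, h2⟩ <;> constructor <;> nlinarith

theorem card_block (L : ℕ) (b : Fin d → ℤ) : (block L b).card = L ^ d := by
  simp [block]

theorem dist_le_of_mem_block {L : ℕ} {b z z' : Fin d → ℤ} (hz : z ∈ block L b)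
    (hz' : z' ∈ block L b) : dist z z' ≤ L := by
  rw [dist_pi_le_iff (Nat.cast_nonneg L)]
  intro i
  have h1 := Finset.mem_Ico.mp (Fintype.mem_piFinset.mp hz i)
  have h2 := Finset.mem_Ico.mp (Fintype.mem_piFinset.mp hz' i)
  have h3 : |z i - z' i| ≤ L := by rw [abs_le]; constructor <;> linarith [h1.1, h1.2, h2.1, h2.2]
  rw [Int.dist_eq]
  exact_mod_cast h3

/-- The lower corner of a block. -/
def corner (L : ℕ) (b : Fin d → ℤ) : Fin d → ℤ := fun i => L * b i

theorem corner_mem_block {L : ℕ} (hL : 0 < L) (b : Fin d → ℤ) : corner L b ∈ block L b := by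
  rw [block, Fintype.mem_piFinset]
  intro i
  have hL' : (0 : ℤ) < L := by exact_mod_cast hL
  simpa [corner] using hL

/-- A symmetric stochastic kernel of range `R` on the lattice, which varies on the scale `N`:
it is of order `N^(-d)` and its oscillation at distance `r` is of relative order `r / N`. -/
structure IsLatticeKernel (N R : ℕ) (Q : ℝ) (q : (Fin d → ℤ) → (Fin d → ℤ) → ℝ) : Prop where
  const_nonneg : 0 ≤ Q
  nonneg : ∀ x y, 0 ≤ q x y
  symm : ∀ x y, q x y = q y x
  range : ∀ x y, (R : ℝ) < dist x y → q x y = 0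
  sum_box : ∀ x, ∑ y ∈ box x R, q x y = 1
  bound : ∀ x y, q x y ≤ Q / (N : ℝ) ^ d
  osc : ∀ x y y', |q x y - q x y'| ≤ Q / (N : ℝ) ^ d * (dist y y' / N)

/-- The action of a kernel on functions. -/
noncomputable def avg (P : (Fin d → ℤ) → (Fin d → ℤ) → ℝ) (f : (Fin d → ℤ) → ℝ)
    (x : Fin d → ℤ) : ℝ :=
  ∑' y, P x y * f y

/-- The composition of a kernel with itself. -/
noncomputable def comp (q : (Fin d → ℤ) → (Fin d → ℤ) → ℝ) (x y : Fin d → ℤ) : ℝ :=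
  ∑' z, q x z * q z y

namespace IsLatticeKernel

variable {N R : ℕ} {Q : ℝ} {q : (Fin d → ℤ) → (Fin d → ℤ) → ℝ}

theorem eq_zero (h : IsLatticeKernel N R Q q) {x y : Fin d → ℤ} (hy : y ∉ box x R) :
    q x y = 0 := by
  refine h.range x y ?_
  rw [mem_box_iff] at hy
  exact not_le.mp hy

theorem sum_eq_one (h : IsLatticeKernel N R Q q) {x : Fin d → ℤ} {F : Finset (Fin d → ℤ)}
    (hF : box x R ⊆ F) : ∑ y ∈ F, q x y = 1 := by
  rw [← h.sum_box x]
  exact (Finset.sum_subset hF fun y _ hy => h.eq_zero hy).symm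

theorem sum_le_one (h : IsLatticeKernel N R Q q) (x : Fin d → ℤ) (F : Finset (Fin d → ℤ)) :
    ∑ y ∈ F, q x y ≤ 1 := by
  rw [← h.sum_eq_one (F := F ∪ box x R) Finset.subset_union_right]
  exact Finset.sum_le_sum_of_subset_of_nonneg Finset.subset_union_left fun _ _ _ => h.nonneg _ _

theorem avg_eq_sum (h : IsLatticeKernel N R Q q) (f : (Fin d → ℤ) → ℝ) {x : Fin d → ℤ}
    {F : Finset (Fin d → ℤ)} (hF : box x R ⊆ F) : avg q f x = ∑ y ∈ F, q x y * f y := by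
  refine tsum_eq_sum fun y hy => ?_
  rw [h.eq_zero fun hy' => hy (hF hy'), zero_mul]

theorem avg_eq_sum_of_support (f : (Fin d → ℤ) → ℝ) (x : Fin d → ℤ)
    {T : Finset (Fin d → ℤ)} (hf : ∀ y, y ∉ T → f y = 0) : avg q f x = ∑ y ∈ T, q x y * f y := by
  refine tsum_eq_sum fun y hy => ?_
  rw [hf y hy, mul_zero]

theorem avg_add (h : IsLatticeKernel N R Q q) (f g : (Fin d → ℤ) → ℝ) (x : Fin d → ℤ) :
    avg q (fun y => f y + g y) x = avg q f x + avg q g x := by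
  simp only [h.avg_eq_sum _ (subset_refl (box x R)), mul_add, Finset.sum_add_distrib]

theorem avg_sub (h : IsLatticeKernel N R Q q) (f g : (Fin d → ℤ) → ℝ) (x : Fin d → ℤ) :
    avg q (fun y => f y - g y) x = avg q f x - avg q g x := by
  simp only [h.avg_eq_sum _ (subset_refl (box x R)), mul_sub, Finset.sum_sub_distrib]

theorem avg_const (h : IsLatticeKernel N R Q q) (c : ℝ) (x : Fin d → ℤ) :
    avg q (fun _ => c) x = c := by
  rw [h.avg_eq_sum _ (subset_refl (box x R)), ← Finset.sum_mul, h.sum_box, one_mul]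

theorem comp_eq_sum (h : IsLatticeKernel N R Q q) {x y : Fin d → ℤ}
    {F : Finset (Fin d → ℤ)} (hF : box x R ⊆ F) : comp q x y = ∑ z ∈ F, q x z * q z y :=
  h.avg_eq_sum _ hF

/-- Composition with a stochastic kernel adds the ranges, and preserves the size and the modulus of
continuity. -/
theorem comp_self (h : IsLatticeKernel N R Q q) : IsLatticeKernel N (R + R) Q (comp q) where
  const_nonneg := h.const_nonneg
  nonneg x y := by
    rw [h.comp_eq_sum (subset_refl _)]
    exact Finset.sum_nonneg fun z _ => mul_nonneg (h.nonneg _ _) (h.nonneg _ _)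
  symm x y := by
    refine tsum_congr fun z => ?_
    rw [h.symm x z, h.symm z y, mul_comm]
  range x y hxy := by
    rw [h.comp_eq_sum (subset_refl _)]
    refine Finset.sum_eq_zero fun z hz => ?_
    rw [mem_box_iff] at hz
    rw [h.range z y, mul_zero]
    push_cast at hxy
    linarith [dist_triangle x z y]
  sum_box x := by
    have hsub : ∀ z ∈ box x R, box z R ⊆ box x (R + R) := by
      intro z hz y hy
      rw [mem_box_iff] at hz hy ⊢
      push_cast
      linarith [dist_triangle x z y]
    simp only [h.comp_eq_sum (subset_refl (box x R))]
    rw [Finset.sum_comm, ← h.sum_box x]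
    refine Finset.sum_congr rfl fun z hz => ?_
    rw [← Finset.mul_sum, h.sum_eq_one (hsub z hz), mul_one]
  bound x y := by
    rw [h.comp_eq_sum (subset_refl _)]
    calc ∑ z ∈ box x R, q x z * q z y ≤ ∑ z ∈ box x R, q x z * (Q / (N : ℝ) ^ d) :=
          Finset.sum_le_sum fun z _ => mul_le_mul_of_nonneg_left (h.bound _ _) (h.nonneg _ _)
      _ = Q / (N : ℝ) ^ d := by rw [← Finset.sum_mul, h.sum_box, one_mul]
  osc x y y' := by
    rw [h.comp_eq_sum (subset_refl _), h.comp_eq_sum (subset_refl _), ← Finset.sum_sub_distrib]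
    calc |∑ z ∈ box x R, (q x z * q z y - q x z * q z y')|
        ≤ ∑ z ∈ box x R, |q x z * q z y - q x z * q z y'| := Finset.abs_sum_le_sum_abs _ _
      _ ≤ ∑ z ∈ box x R, q x z * (Q / (N : ℝ) ^ d * (dist y y' / N)) := by
          refine Finset.sum_le_sum fun z _ => ?_
          rw [← mul_sub, abs_mul, abs_of_nonneg (h.nonneg _ _)]
          exact mul_le_mul_of_nonneg_left (h.osc _ _ _) (h.nonneg _ _)
      _ = Q / (N : ℝ) ^ d * (dist y y' / N) := by rw [← Finset.sum_mul, h.sum_box, one_mul]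

/-- A kernel varying on the scale `N` only sees block averages: its action on a function is small
if the averages over blocks of side `L ≪ N` are small, however rough the function is. -/
theorem abs_avg_le (h : IsLatticeKernel N R Q q) (hR : R ≤ 2 * N) {L : ℕ} (hL : 0 < L)
    (hLN : L ≤ N) {f : (Fin d → ℤ) → ℝ} {ζ U : ℝ} (hζ : 0 ≤ ζ) (hU : 0 ≤ U)
    (h1 : ∀ b, |∑ z ∈ block L b, f z| ≤ ζ * (L : ℝ) ^ d)
    (h2 : ∀ b, ∑ z ∈ block L b, |f z| ≤ U * (L : ℝ) ^ d) (x : Fin d → ℤ) :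
    |avg q f x| ≤ Q * 7 ^ d * (ζ + U * (L / N)) := by
  classical
  have hN : 0 < N := by omega
  have hNr : (0 : ℝ) < N := by exact_mod_cast hN
  have hQ := h.const_nonneg
  obtain ⟨𝔅, h𝔅⟩ : ∃ 𝔅, 𝔅 = (box x R).image (blk L) := ⟨_, rfl⟩
  obtain ⟨F, hF⟩ : ∃ F, F = 𝔅.biUnion (block L) := ⟨_, rfl⟩
  have hbF : box x R ⊆ F := fun z hz => by
    rw [hF, h𝔅]
    exact Finset.mem_biUnion.mpr ⟨blk L z, Finset.mem_image_of_mem _ hz, (mem_block_iff hL).mpr rfl⟩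
  have hdisj : (↑𝔅 : Set (Fin d → ℤ)).PairwiseDisjoint (block L) := by
    intro b _ b' _ hbb
    refine Finset.disjoint_left.mpr fun z hz hz' => hbb ?_
    rw [mem_block_iff hL] at hz hz'
    rw [← hz, ← hz']
  have hcard : (𝔅.card : ℝ) * (L : ℝ) ^ d ≤ 7 ^ d * (N : ℝ) ^ d := by
    have e1 : F.card = 𝔅.card * L ^ d := by
      rw [hF, Finset.card_biUnion hdisj]
      simp [card_block]
    have e2 : F ⊆ box x (R + L) := by
      intro z hz
      rw [hF] at hz
      obtain ⟨b, hb, hzb⟩ := Finset.mem_biUnion.mp hz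
      rw [h𝔅] at hb
      obtain ⟨y, hy, rfl⟩ := Finset.mem_image.mp hb
      have h3 := dist_le_of_mem_block ((mem_block_iff hL).mpr (rfl : blk L y = blk L y)) hzb
      rw [mem_box_iff] at hy ⊢
      push_cast
      linarith [dist_triangle x y z]
    have e3 := Finset.card_le_card e2
    rw [e1, card_box] at e3
    have e4 : (2 * (R + L) + 1) ^ d ≤ (7 * N) ^ d := Nat.pow_le_pow_left (by omega) d
    have e5 : 𝔅.card * L ^ d ≤ 7 ^ d * N ^ d := by rw [← mul_pow]; exact e3.trans e4
    exact_mod_cast e5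
  have hblock : ∀ b, |∑ z ∈ block L b, q x z * f z| ≤
      (Q / (N : ℝ) ^ d * (ζ + U * (L / N))) * (L : ℝ) ^ d := by
    intro b
    have e : ∑ z ∈ block L b, q x z * f z = q x (corner L b) * ∑ z ∈ block L b, f z
        + ∑ z ∈ block L b, (q x z - q x (corner L b)) * f z := by
      rw [Finset.mul_sum, ← Finset.sum_add_distrib]
      exact Finset.sum_congr rfl fun _ _ => by ring
    rw [e]
    have i1 : |q x (corner L b) * ∑ z ∈ block L b, f z| ≤ Q / (N : ℝ) ^ d * (ζ * (L : ℝ) ^ d) := by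
      rw [abs_mul, abs_of_nonneg (h.nonneg _ _)]
      exact mul_le_mul (h.bound _ _) (h1 b) (abs_nonneg _) (by positivity)
    have i2 : |∑ z ∈ block L b, (q x z - q x (corner L b)) * f z| ≤
        Q / (N : ℝ) ^ d * (L / N) * (U * (L : ℝ) ^ d) := by
      calc _ ≤ ∑ z ∈ block L b, |(q x z - q x (corner L b)) * f z| :=
            Finset.abs_sum_le_sum_abs _ _
        _ ≤ ∑ z ∈ block L b, Q / (N : ℝ) ^ d * (L / N) * |f z| := by
            refine Finset.sum_le_sum fun z hz => ?_
            rw [abs_mul]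
            refine mul_le_mul_of_nonneg_right ((h.osc _ _ _).trans ?_) (abs_nonneg _)
            have := dist_le_of_mem_block hz (corner_mem_block hL b)
            gcongr
        _ = Q / (N : ℝ) ^ d * (L / N) * ∑ z ∈ block L b, |f z| := by rw [Finset.mul_sum]
        _ ≤ _ := mul_le_mul_of_nonneg_left (h2 b) (by positivity)
    refine (abs_add_le _ _).trans ((add_le_add i1 i2).trans (le_of_eq ?_))
    ring
  rw [h.avg_eq_sum f hbF, hF, Finset.sum_biUnion hdisj]
  calc |∑ b ∈ 𝔅, ∑ z ∈ block L b, q x z * f z|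
      ≤ ∑ b ∈ 𝔅, |∑ z ∈ block L b, q x z * f z| := Finset.abs_sum_le_sum_abs _ _
    _ ≤ ∑ _b ∈ 𝔅, (Q / (N : ℝ) ^ d * (ζ + U * (L / N))) * (L : ℝ) ^ d :=
        Finset.sum_le_sum fun b _ => hblock b
    _ = (Q / (N : ℝ) ^ d * (ζ + U * (L / N))) * (𝔅.card * (L : ℝ) ^ d) := by
        rw [Finset.sum_const, nsmul_eq_mul]; ring
    _ ≤ (Q / (N : ℝ) ^ d * (ζ + U * (L / N))) * (7 ^ d * (N : ℝ) ^ d) := by gcongr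
    _ = Q * 7 ^ d * (ζ + U * (L / N)) := by
        field_simp

/-- A stochastic symmetric kernel is a contraction of `ℓ²`. -/
theorem sum_sq_le (h : IsLatticeKernel N R Q q) (T Y : Finset (Fin d → ℤ))
    (k : (Fin d → ℤ) → ℝ) :
    ∑ y ∈ Y, (∑ x ∈ T, q y x * k x) ^ 2 ≤ ∑ x ∈ T, k x ^ 2 := by
  calc ∑ y ∈ Y, (∑ x ∈ T, q y x * k x) ^ 2
      ≤ ∑ y ∈ Y, ∑ x ∈ T, q y x * k x ^ 2 := by
        refine Finset.sum_le_sum fun y _ => ?_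
        have := Finset.sum_sq_le_sum_mul_sum_of_sq_le_mul T (r := fun x => q y x * k x)
          (f := fun x => q y x) (g := fun x => q y x * k x ^ 2) (fun x _ => h.nonneg _ _)
          (fun x _ => mul_nonneg (h.nonneg _ _) (sq_nonneg _)) (fun x _ => le_of_eq (by ring))
        refine this.trans ?_
        have h0 : 0 ≤ ∑ x ∈ T, q y x * k x ^ 2 :=
          Finset.sum_nonneg fun x _ => mul_nonneg (h.nonneg _ _) (sq_nonneg _)
        have := mul_le_mul_of_nonneg_right (h.sum_le_one y T) h0
        rwa [one_mul] at this
    _ = ∑ x ∈ T, (∑ y ∈ Y, q x y) * k x ^ 2 := by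
        rw [Finset.sum_comm]
        refine Finset.sum_congr rfl fun x _ => ?_
        rw [Finset.sum_mul]
        exact Finset.sum_congr rfl fun y _ => by rw [h.symm]
    _ ≤ ∑ x ∈ T, k x ^ 2 := by
        refine Finset.sum_le_sum fun x _ => ?_
        have := mul_le_mul_of_nonneg_right (h.sum_le_one x Y) (sq_nonneg (k x))
        rwa [one_mul] at this

/-- Schur's bound for the bilinear form of a stochastic symmetric kernel. -/
theorem sum_mul_mul_le (h : IsLatticeKernel N R Q q) (T : Finset (Fin d → ℤ))
    (m : (Fin d → ℤ) → ℝ) :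
    ∑ x ∈ T, m x * ∑ y ∈ T, q x y * m y ≤ ∑ x ∈ T, m x ^ 2 := by
  have h1 := h.sum_sq_le T T m
  have h2 := Finset.sum_mul_sq_le_sq_mul_sq T m (fun x => ∑ y ∈ T, q x y * m y)
  have h3 : 0 ≤ ∑ x ∈ T, m x ^ 2 := Finset.sum_nonneg fun _ _ => sq_nonneg _
  refine le_of_sq_le_sq ?_ h3
  calc _ ≤ _ := h2
    _ ≤ (∑ x ∈ T, m x ^ 2) * ∑ x ∈ T, m x ^ 2 := mul_le_mul_of_nonneg_left h1 h3
    _ = _ := (sq _).symm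

theorem sum_mul_avg_comp (h : IsLatticeKernel N R Q q) {T Y : Finset (Fin d → ℤ)}
    (hY : ∀ x ∈ T, box x R ⊆ Y) (f : (Fin d → ℤ) → ℝ) {g : (Fin d → ℤ) → ℝ}
    (hg : ∀ x, x ∉ T → g x = 0) :
    ∑ x ∈ T, f x * avg (comp q) g x =
      ∑ y ∈ Y, (∑ x ∈ T, q y x * f x) * ∑ x ∈ T, q y x * g x := by
  have e : ∀ x ∈ T, f x * avg (comp q) g x =
      ∑ y ∈ Y, (q y x * f x) * ∑ x' ∈ T, q y x' * g x' := by
    intro x hx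
    rw [avg_eq_sum_of_support g x hg, Finset.mul_sum]
    simp only [h.comp_eq_sum (hY x hx), Finset.mul_sum, Finset.sum_mul]
    rw [Finset.sum_comm]
    refine Finset.sum_congr rfl fun y _ => Finset.sum_congr rfl fun x' _ => ?_
    rw [h.symm x y]; ring
  rw [Finset.sum_congr rfl e, Finset.sum_comm]
  exact Finset.sum_congr rfl fun y _ => by rw [← Finset.sum_mul]

end IsLatticeKernel

end Lattice

/-! ### The interaction and its coercivity -/

section Lattice

variable {d S N R : ℕ} {Q : ℝ} {q P : (Fin d → ℤ) → (Fin d → ℤ) → ℝ}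

/-- The potential `∑_{s' ≠ s} ∑_y P(x,y) g(y,s')` which a configuration `g` generates. -/
noncomputable def couple (P : (Fin d → ℤ) → (Fin d → ℤ) → ℝ) (g : (Fin d → ℤ) → Fin S → ℝ)
    (x : Fin d → ℤ) (s : Fin S) : ℝ :=
  offSum (fun s' => avg P (fun y => g y s') x) s

theorem couple_add (h : IsLatticeKernel N R Q P) (f g : (Fin d → ℤ) → Fin S → ℝ)
    (x : Fin d → ℤ) (s : Fin S) :
    couple P (fun y s => f y s + g y s) x s = couple P f x s + couple P g x s := by
  simp only [couple, h.avg_add, offSum_add]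

theorem couple_sub (h : IsLatticeKernel N R Q P) (f g : (Fin d → ℤ) → Fin S → ℝ)
    (x : Fin d → ℤ) (s : Fin S) :
    couple P (fun y s => f y s - g y s) x s = couple P f x s - couple P g x s := by
  simp only [couple, h.avg_sub, offSum_eq, Finset.sum_sub_distrib]
  ring

theorem couple_const (h : IsLatticeKernel N R Q P) (u : Fin S → ℝ)
    (x : Fin d → ℤ) (s : Fin S) : couple P (fun _ => u) x s = offSum u s := by
  simp only [couple, h.avg_const]

theorem couple_smul (c : ℝ) (f : (Fin d → ℤ) → Fin S → ℝ) (x : Fin d → ℤ) (s : Fin S) :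
    couple P (fun y s => c * f y s) x s = c * couple P f x s := by
  have : ∀ s', avg P (fun y => c * f y s') x = c * avg P (fun y => f y s') x := by
    intro s'
    unfold avg
    rw [← tsum_mul_left]
    exact tsum_congr fun y => by ring
  simp only [couple, this, offSum_smul]

theorem abs_couple_le {g : (Fin d → ℤ) → Fin S → ℝ} {x : Fin d → ℤ} {B : ℝ}
    (hB : ∀ s, |avg P (fun y => g y s) x| ≤ B) (s : Fin S) : |couple P g x s| ≤ S * B := by
  refine (abs_offSum_le _ s).trans ((Finset.sum_le_sum fun s' _ => hB s').trans ?_)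
  simp

theorem sum_couple_comm (hP : ∀ x y, P x y = P y x) (T : Finset (Fin d → ℤ))
    {f g : (Fin d → ℤ) → Fin S → ℝ} (hf : ∀ x, x ∉ T → f x = 0) (hg : ∀ x, x ∉ T → g x = 0) :
    ∑ x ∈ T, ∑ s, f x s * couple P g x s = ∑ x ∈ T, ∑ s, g x s * couple P f x s := by
  have e : ∀ f g : (Fin d → ℤ) → Fin S → ℝ, (∀ x, x ∉ T → g x = 0) →
      ∑ x ∈ T, ∑ s, f x s * couple P g x s =
        ∑ x ∈ T, ∑ y ∈ T, P x y * ∑ s, f x s * offSum (g y) s := by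
    intro f g hg
    refine Finset.sum_congr rfl fun x _ => ?_
    have : ∀ s, couple P g x s = ∑ y ∈ T, P x y * offSum (g y) s := by
      intro s
      unfold couple
      have h1 : ∀ s', avg P (fun y => g y s') x = ∑ y ∈ T, P x y * g y s' := fun s' =>
        IsLatticeKernel.avg_eq_sum_of_support _ _ fun y hy => by rw [hg y hy]; rfl
      simp only [h1, offSum_eq, mul_sub, Finset.sum_sub_distrib, Finset.mul_sum]
      rw [Finset.sum_comm]
    simp only [this, Finset.mul_sum]
    rw [Finset.sum_comm]
    exact Finset.sum_congr rfl fun _ _ => Finset.sum_congr rfl fun _ _ => by ring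
  rw [e f g hg, e g f hf, Finset.sum_comm]
  refine Finset.sum_congr rfl fun x _ => Finset.sum_congr rfl fun y _ => ?_
  rw [hP y x, sum_mul_offSum_comm]

/-- Since `comp q` is the square of a symmetric contraction, the interaction inherits the lower
bound of the mean field Hessian, wherever between `0` and `1` its Fourier modes lie. -/
theorem couple_form_ge (h : IsLatticeKernel N R Q q) {β κ : ℝ} {u : Fin S → ℝ}
    (hκ : ∀ v : Fin S → ℝ, κ * ∑ s, v s ^ 2 ≤ hessForm β u v)
    (hκu : ∀ s, κ ≤ 1 / (β * u s)) {T : Finset (Fin d → ℤ)} {k : (Fin d → ℤ) → Fin S → ℝ}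
    (hk : ∀ x, x ∉ T → k x = 0) :
    -∑ x ∈ T, ∑ s, (1 / (β * u s) - κ) * k x s ^ 2 ≤
      ∑ x ∈ T, ∑ s, k x s * couple (comp q) k x s := by
  classical
  set Y := T.biUnion fun x => box x R with hYdef
  have hY : ∀ x ∈ T, box x R ⊆ Y := fun x hx => Finset.subset_biUnion_of_mem (fun x => box x R) hx
  set K : (Fin d → ℤ) → Fin S → ℝ := fun y s => ∑ x ∈ T, q y x * k x s with hK
  have e1 : ∑ x ∈ T, ∑ s, k x s * couple (comp q) k x s = ∑ y ∈ Y, ∑ s, K y s * offSum (K y) s := by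
    rw [Finset.sum_comm, Finset.sum_comm (s := Y)]
    refine Finset.sum_congr rfl fun s _ => ?_
    simp only [couple, offSum, Finset.mul_sum]
    rw [Finset.sum_comm, Finset.sum_comm (s := Y)]
    refine Finset.sum_congr rfl fun s' _ => ?_
    by_cases hs : s = s'
    · simp [hs]
    · simp only [ne_eq, hs, not_false_eq_true, if_true]
      exact h.sum_mul_avg_comp hY (fun x => k x s) fun x hx => by rw [hk x hx]; rfl
  have e2 : ∀ y, -∑ s, (1 / (β * u s) - κ) * K y s ^ 2 ≤ ∑ s, K y s * offSum (K y) s := by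
    intro y
    have := hκ (K y)
    unfold hessForm at this
    have e3 : ∑ s, (1 / (β * u s) - κ) * K y s ^ 2 =
        ∑ s, K y s ^ 2 / (β * u s) - κ * ∑ s, K y s ^ 2 := by
      rw [Finset.mul_sum, ← Finset.sum_sub_distrib]
      exact Finset.sum_congr rfl fun _ _ => by ring
    rw [e3]; linarith
  rw [e1]
  calc -∑ x ∈ T, ∑ s, (1 / (β * u s) - κ) * k x s ^ 2
      ≤ -∑ y ∈ Y, ∑ s, (1 / (β * u s) - κ) * K y s ^ 2 := by
        refine neg_le_neg ?_
        rw [Finset.sum_comm, Finset.sum_comm (s := T)]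
        refine Finset.sum_le_sum fun s _ => ?_
        rw [← Finset.mul_sum, ← Finset.mul_sum]
        exact mul_le_mul_of_nonneg_left (h.sum_sq_le T Y fun x => k x s)
          (sub_nonneg.mpr (hκu s))
    _ = ∑ y ∈ Y, -∑ s, (1 / (β * u s) - κ) * K y s ^ 2 := by rw [Finset.sum_neg_distrib]
    _ ≤ _ := Finset.sum_le_sum fun y _ => e2 y

/-- Coercivity survives conjugation with a weight which is nearly constant on the range of the
interaction, and a small error in the entropic term `l`. -/
theorem weighted_coercive (h : IsLatticeKernel N R Q q) {β κ A e t : ℝ} {u : Fin S → ℝ}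
    (hκ : ∀ v : Fin S → ℝ, κ * ∑ s, v s ^ 2 ≤ hessForm β u v)
    (hκu : ∀ s, κ ≤ 1 / (β * u s)) (hA : ∀ s, 1 / (β * u s) ≤ A) (he : 0 ≤ e)
    (ht : t ∈ Set.Icc (0 : ℝ) 1) {T : Finset (Fin d → ℤ)} {v l : (Fin d → ℤ) → Fin S → ℝ}
    (hv : ∀ x, x ∉ T → v x = 0) {w : (Fin d → ℤ) → ℝ} (hw : ∀ x, 0 < w x)
    (hwe : ∀ x y, dist x y ≤ ((R + R : ℕ) : ℝ) → |w x / w y - 1| ≤ e)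
    (hl : ∀ x ∈ T, ∀ s, (1 - e) * (1 / (β * u s)) * v x s ^ 2 ≤ v x s * l x s) :
    (κ - e * (A + S)) * ∑ x ∈ T, ∑ s, (w x * v x s) ^ 2 ≤
      ∑ x ∈ T, ∑ s, w x ^ 2 * v x s * (t * couple (comp q) v x s + l x s) := by
  set k : (Fin d → ℤ) → Fin S → ℝ := fun x s => w x * v x s with hkdef
  have hk : ∀ x, x ∉ T → k x = 0 := fun x hx => by
    funext s; simp [hkdef, hv x hx]
  have hp := h.comp_self
  have hform := couple_form_ge h hκ hκu hk
  set X := ∑ x ∈ T, ∑ s, k x s ^ 2 with hX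
  have hX0 : 0 ≤ X := Finset.sum_nonneg fun _ _ => Finset.sum_nonneg fun _ _ => sq_nonneg _
  -- the commutator of the interaction with the weight
  have hcomm : ∀ x ∈ T, ∀ s, |w x * couple (comp q) v x s - couple (comp q) k x s| ≤
      e * ∑ y ∈ T, comp q x y * ∑ s', |k y s'| := by
    intro x _ s
    have e0 : w x * couple (comp q) v x s - couple (comp q) k x s =
        offSum (fun s' => ∑ y ∈ T, comp q x y * ((w x / w y - 1) * k y s')) s := by
      have h1 : ∀ s', avg (comp q) (fun y => v y s') x = ∑ y ∈ T, comp q x y * v y s' := fun s' =>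
        IsLatticeKernel.avg_eq_sum_of_support _ _ fun y hy => by rw [hv y hy]; rfl
      have h2 : ∀ s', avg (comp q) (fun y => k y s') x = ∑ y ∈ T, comp q x y * k y s' := fun s' =>
        IsLatticeKernel.avg_eq_sum_of_support _ _ fun y hy => by rw [hk y hy]; rfl
      have h3 : ∀ s', ∑ y ∈ T, comp q x y * ((w x / w y - 1) * k y s') =
          w x * ∑ y ∈ T, comp q x y * v y s' - ∑ y ∈ T, comp q x y * k y s' := by
        intro s'
        rw [Finset.mul_sum, ← Finset.sum_sub_distrib]
        refine Finset.sum_congr rfl fun y _ => ?_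
        have := (hw y).ne'
        simp only [hkdef]
        field_simp
      simp only [couple, h1, h2, h3, offSum_eq, Finset.sum_sub_distrib, ← Finset.mul_sum]
      ring
    rw [e0]
    refine (abs_offSum_le _ s).trans ?_
    calc ∑ s', |∑ y ∈ T, comp q x y * ((w x / w y - 1) * k y s')|
        ≤ ∑ s', ∑ y ∈ T, comp q x y * (e * |k y s'|) := by
          refine Finset.sum_le_sum fun s' _ => (Finset.abs_sum_le_sum_abs _ _).trans
            (Finset.sum_le_sum fun y _ => ?_)
          rw [abs_mul, abs_of_nonneg (hp.nonneg _ _), abs_mul]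
          by_cases hd : dist x y ≤ ((R + R : ℕ) : ℝ)
          · exact mul_le_mul_of_nonneg_left
              (mul_le_mul_of_nonneg_right (hwe x y hd) (abs_nonneg _)) (hp.nonneg _ _)
          · rw [hp.range x y (not_le.mp hd)]; simp
      _ = e * ∑ y ∈ T, comp q x y * ∑ s', |k y s'| := by
          rw [Finset.sum_comm, Finset.mul_sum]
          refine Finset.sum_congr rfl fun y _ => ?_
          rw [Finset.mul_sum, Finset.mul_sum]
          exact Finset.sum_congr rfl fun _ _ => by ring
  have hschur : ∑ x ∈ T, ∑ s, |k x s| * ∑ y ∈ T, comp q x y * ∑ s', |k y s'| ≤ S * X := by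
    simp only [← Finset.sum_mul]
    refine (hp.sum_mul_mul_le T fun x => ∑ s, |k x s|).trans ?_
    rw [hX, Finset.mul_sum]
    refine Finset.sum_le_sum fun x _ => ?_
    have := sq_sum_le_card_mul_sum_sq (s := (Finset.univ : Finset (Fin S))) (f := fun s => |k x s|)
    simpa using this
  have hcross : -(e * (S * X)) ≤
      ∑ x ∈ T, ∑ s, k x s * (w x * couple (comp q) v x s - couple (comp q) k x s) := by
    refine neg_le_of_abs_le ?_
    calc |∑ x ∈ T, ∑ s, k x s * (w x * couple (comp q) v x s - couple (comp q) k x s)|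
        ≤ ∑ x ∈ T, ∑ s, |k x s| * (e * ∑ y ∈ T, comp q x y * ∑ s', |k y s'|) := by
          refine (Finset.abs_sum_le_sum_abs _ _).trans (Finset.sum_le_sum fun x hx =>
            (Finset.abs_sum_le_sum_abs _ _).trans (Finset.sum_le_sum fun s _ => ?_))
          rw [abs_mul]
          exact mul_le_mul_of_nonneg_left (hcomm x hx s) (abs_nonneg _)
      _ = e * ∑ x ∈ T, ∑ s, |k x s| * ∑ y ∈ T, comp q x y * ∑ s', |k y s'| := by
          simp only [Finset.mul_sum]
          refine Finset.sum_congr rfl fun _ _ => Finset.sum_congr rfl fun _ _ =>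
            Finset.sum_congr rfl fun _ _ => Finset.sum_congr rfl fun _ _ => by ring
      _ ≤ e * (S * X) := mul_le_mul_of_nonneg_left hschur he
  have hent : ∑ x ∈ T, ∑ s, (1 / (β * u s)) * k x s ^ 2 - e * A * X ≤
      ∑ x ∈ T, ∑ s, w x ^ 2 * v x s * l x s := by
    rw [hX, Finset.mul_sum, ← Finset.sum_sub_distrib]
    refine Finset.sum_le_sum fun x hx => ?_
    rw [Finset.mul_sum, ← Finset.sum_sub_distrib]
    refine Finset.sum_le_sum fun s _ => ?_
    have h1 := mul_le_mul_of_nonneg_left (hl x hx s) (sq_nonneg (w x))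
    have h2 : e * (1 / (β * u s)) * k x s ^ 2 ≤ e * A * k x s ^ 2 :=
      mul_le_mul_of_nonneg_right (mul_le_mul_of_nonneg_left (hA s) he) (sq_nonneg _)
    have h3 : k x s ^ 2 = w x ^ 2 * v x s ^ 2 := by simp only [hkdef]; ring
    rw [h3] at h2 ⊢
    nlinarith
  have hsplit : ∑ x ∈ T, ∑ s, w x ^ 2 * v x s * (t * couple (comp q) v x s + l x s) =
      t * ∑ x ∈ T, ∑ s, k x s * couple (comp q) k x s
        + t * ∑ x ∈ T, ∑ s, k x s * (w x * couple (comp q) v x s - couple (comp q) k x s)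
        + ∑ x ∈ T, ∑ s, w x ^ 2 * v x s * l x s := by
    simp only [Finset.mul_sum, ← Finset.sum_add_distrib]
    refine Finset.sum_congr rfl fun x _ => Finset.sum_congr rfl fun s _ => ?_
    simp only [hkdef]
    ring
  have hpos : 0 ≤ ∑ x ∈ T, ∑ s, (1 / (β * u s) - κ) * k x s ^ 2 :=
    Finset.sum_nonneg fun x _ => Finset.sum_nonneg fun s _ =>
      mul_nonneg (sub_nonneg.mpr (hκu s)) (sq_nonneg _)
  have hdiff : ∑ x ∈ T, ∑ s, (1 / (β * u s) - κ) * k x s ^ 2 =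
      ∑ x ∈ T, ∑ s, (1 / (β * u s)) * k x s ^ 2 - κ * X := by
    rw [hX]
    simp only [Finset.mul_sum, ← Finset.sum_sub_distrib]
    exact Finset.sum_congr rfl fun _ _ => Finset.sum_congr rfl fun _ _ => by ring
  have t1 : -∑ x ∈ T, ∑ s, (1 / (β * u s) - κ) * k x s ^ 2 ≤
      t * ∑ x ∈ T, ∑ s, k x s * couple (comp q) k x s := by
    have := mul_le_mul_of_nonneg_left hform ht.1
    nlinarith [ht.2]
  have t2 : -(e * (S * X)) ≤
      t * ∑ x ∈ T, ∑ s, k x s * (w x * couple (comp q) v x s - couple (comp q) k x s) := by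
    have := mul_le_mul_of_nonneg_left hcross ht.1
    have h0 : 0 ≤ e * (S * X) := by positivity
    nlinarith [ht.2]
  rw [hsplit]
  have : (κ - e * (A + S)) * X = κ * X - e * A * X - e * (S * X) := by ring
  rw [this]
  linarith

end Lattice

/-! ### Minimizers of the lattice functional -/

section Lattice

variable {d S N R L : ℕ} {Q β lam t ζ : ℝ} {u : Fin S → ℝ}
  {P : (Fin d → ℤ) → (Fin d → ℤ) → ℝ} {T : Finset (Fin d → ℤ)}
  {f f' g : (Fin d → ℤ) → Fin S → ℝ}

/-- The interpolated functional on the lattice, with the cell volume divided out, of a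
configuration `f` on `T` with boundary condition `g`. -/
noncomputable def latticeEnergy (β lam t : ℝ) (u : Fin S → ℝ)
    (P : (Fin d → ℤ) → (Fin d → ℤ) → ℝ) (T : Finset (Fin d → ℤ))
    (g f : (Fin d → ℤ) → Fin S → ℝ) : ℝ :=
  ∑ x ∈ T, ∑ s, (t * (1 / 2 * (f x s * couple P f x s) + f x s * couple P g x s)
    + ((1 - t) * offSum u s - lam) * f x s - (1 / β) * entropy (f x s))

/-- The nonnegative configurations on `T` whose averages over blocks of side `L` are within `ζ`
of `u`. -/
def latticePhase (ζ : ℝ) (L : ℕ) (u : Fin S → ℝ) (T : Set (Fin d → ℤ)) :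
    Set ((Fin d → ℤ) → Fin S → ℝ) :=
  {f | (∀ x s, 0 ≤ f x s) ∧ (∀ x, x ∉ T → f x = 0) ∧
    ∀ x ∈ T, ∀ s, |(∑ z ∈ block L (blk L x), f z s) / (L : ℝ) ^ d - u s| ≤ ζ}

/-- `T` is a union of blocks of side `L`. -/
def IsBlockSet (L : ℕ) (T : Set (Fin d → ℤ)) : Prop :=
  ∀ x y, blk L x = blk L y → x ∈ T → y ∈ T

/-- The deviation of the potential at `x` from its mean field value. -/
noncomputable def excess (t : ℝ) (u : Fin S → ℝ) (P : (Fin d → ℤ) → (Fin d → ℤ) → ℝ)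
    (g f : (Fin d → ℤ) → Fin S → ℝ) (x : Fin d → ℤ) (s : Fin S) : ℝ :=
  t * (couple P f x s + couple P g x s - offSum u s)

theorem entropy_sub_entropy_le_tangent {a b : ℝ} (ha : 0 ≤ a) (hb : 0 < b) :
    entropy a - entropy b ≤ (b - a) * Real.log b := by
  unfold entropy
  rcases ha.eq_or_lt with rfl | ha
  · simp; linarith
  · have h := Real.log_le_sub_one_of_pos (div_pos hb ha)
    rw [Real.log_div hb.ne' ha.ne'] at h
    have := mul_le_mul_of_nonneg_left h ha.le
    have e : a * (b / a - 1) = b - a := by field_simp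
    rw [e] at this
    linarith

/-- The constraint is convex block by block: interpolation with a strength that is constant on
blocks respects it. -/
theorem latticePhase_convex {T : Set (Fin d → ℤ)} (hf : f ∈ latticePhase ζ L u T)
    (hf' : f' ∈ latticePhase ζ L u T) {w : (Fin d → ℤ) → ℝ} (hw : ∀ x, w x ∈ Set.Icc (0 : ℝ) 1)
    (hwb : ∀ b, ∀ x ∈ block L b, ∀ y ∈ block L b, w x = w y) (hL : 0 < L) :
    (fun x s => f x s + w x * (f' x s - f x s)) ∈ latticePhase ζ L u T := by
  refine ⟨fun x s => ?_, fun x hx => ?_, fun x hx s => ?_⟩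
  · have h1 := mul_nonneg (sub_nonneg.mpr (hw x).2) (hf.1 x s)
    have h2 := mul_nonneg (hw x).1 (hf'.1 x s)
    nlinarith
  · funext s; simp [hf.2.1 x hx, hf'.2.1 x hx]
  · have hx' : x ∈ block L (blk L x) := (mem_block_iff hL).mpr rfl
    have e : ∑ z ∈ block L (blk L x), (f z s + w z * (f' z s - f z s)) =
        (1 - w x) * ∑ z ∈ block L (blk L x), f z s + w x * ∑ z ∈ block L (blk L x), f' z s := by
      rw [Finset.mul_sum, Finset.mul_sum, ← Finset.sum_add_distrib]
      refine Finset.sum_congr rfl fun z hz => ?_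
      rw [hwb _ z hz x hx']; ring
    rw [e]
    have h1 := hf.2.2 x hx s
    have h2 := hf'.2.2 x hx s
    obtain ⟨hw0, hw1⟩ := hw x
    have e2 : ((1 - w x) * ∑ z ∈ block L (blk L x), f z s
        + w x * ∑ z ∈ block L (blk L x), f' z s) / (L : ℝ) ^ d - u s =
        (1 - w x) * ((∑ z ∈ block L (blk L x), f z s) / (L : ℝ) ^ d - u s)
        + w x * ((∑ z ∈ block L (blk L x), f' z s) / (L : ℝ) ^ d - u s) := by ring
    rw [e2]
    refine (abs_add_le _ _).trans ?_
    rw [abs_mul, abs_mul, abs_of_nonneg hw0, abs_of_nonneg (sub_nonneg.mpr hw1)]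
    nlinarith [mul_le_mul_of_nonneg_left h1 (sub_nonneg.mpr hw1),
      mul_le_mul_of_nonneg_left h2 hw0]

theorem block_subset (hT : IsBlockSet L (T : Set (Fin d → ℤ))) (hL : 0 < L) {x z : Fin d → ℤ}
    (hx : x ∈ T) (hz : z ∈ block L (blk L x)) : z ∈ T :=
  hT x z ((mem_block_iff hL).mp hz).symm hx

theorem const_mem_latticePhase (hT : IsBlockSet L (T : Set (Fin d → ℤ))) (hL : 0 < L)
    (hζ : 0 ≤ ζ) (hu : ∀ s, 0 < u s) :
    (fun x => if x ∈ T then u else 0) ∈ latticePhase ζ L u (T : Set (Fin d → ℤ)) := by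
  refine ⟨fun x s => ?_, fun x hx => ?_, fun x hx s => ?_⟩
  · dsimp only
    split_ifs
    · exact (hu s).le
    · exact le_rfl
  · exact if_neg (by simpa using hx)
  · have : ∑ z ∈ block L (blk L x), (if z ∈ T then u else 0) s = (L : ℝ) ^ d * u s := by
      rw [Finset.sum_congr rfl fun z hz => by
        rw [if_pos (block_subset hT hL (by simpa using hx) hz)]]
      simp [card_block]
    have hL' : (0 : ℝ) < L := by exact_mod_cast hL
    rw [this, mul_div_cancel_left₀ _ (by positivity), sub_self, abs_zero]
    exact hζ

/-- Minimality along a step `τ` towards `f'`, with the entropy bounded by its tangent at the end of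
the step. This is meaningful even where `f` vanishes. -/
theorem latticeEnergy_step (hP : IsLatticeKernel N R Q P) (hβ : 0 < β) (hL : 0 < L)
    (hf : f ∈ latticePhase ζ L u (T : Set (Fin d → ℤ)))
    (hmin : IsMinOn (latticeEnergy β lam t u P T g) (latticePhase ζ L u T) f)
    (hf' : f' ∈ latticePhase ζ L u (T : Set (Fin d → ℤ))) {τ : ℝ} (hτ : 0 < τ) (hτ1 : τ ≤ 1)
    (hpos : ∀ x ∈ T, ∀ s, 0 < f x s + τ * (f' x s - f x s)) :
    0 ≤ ∑ x ∈ T, ∑ s, (f' x s - f x s) *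
          (t * (couple P f x s + couple P g x s) + (1 - t) * offSum u s - lam)
      + τ * (t / 2 * ∑ x ∈ T, ∑ s, (f' x s - f x s) * couple P (fun x s => f' x s - f x s) x s)
      + (1 / β) * ∑ x ∈ T, ∑ s, (f' x s - f x s) *
          Real.log (f x s + τ * (f' x s - f x s)) := by
  set η : (Fin d → ℤ) → Fin S → ℝ := fun x s => f' x s - f x s with hη
  have hη0 : ∀ x, x ∉ T → η x = 0 := fun x hx => by
    funext s; simp [hη, hf.2.1 x (by simpa using hx), hf'.2.1 x (by simpa using hx)]
  have hmem : (fun x s => f x s + τ * η x s) ∈ latticePhase ζ L u (T : Set (Fin d → ℤ)) :=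
    latticePhase_convex hf hf' (fun _ => ⟨hτ.le, hτ1⟩) (fun _ _ _ _ _ => rfl) hL
  have h0 : latticeEnergy β lam t u P T g f ≤
      latticeEnergy β lam t u P T g (fun x s => f x s + τ * η x s) := hmin hmem
  have hc : ∀ x s, couple P (fun x s => f x s + τ * η x s) x s =
      couple P f x s + τ * couple P η x s := by
    intro x s
    rw [couple_add hP f (fun x s => τ * η x s), couple_smul]
  have hsymm := sum_couple_comm hP.symm T
    (f := f) (g := η) (fun x hx => hf.2.1 x (by simpa using hx)) hη0
  have hent : ∑ x ∈ T, ∑ s, (entropy (f x s) - entropy (f x s + τ * η x s)) ≤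
      ∑ x ∈ T, ∑ s, τ * (η x s * Real.log (f x s + τ * η x s)) := by
    refine Finset.sum_le_sum fun x hx => Finset.sum_le_sum fun s _ => ?_
    refine (entropy_sub_entropy_le_tangent (hf.1 x s) (hpos x hx s)).trans (le_of_eq ?_)
    ring
  have hdiff : latticeEnergy β lam t u P T g (fun x s => f x s + τ * η x s)
      - latticeEnergy β lam t u P T g f =
      τ * ∑ x ∈ T, ∑ s, η x s *
          (t * (couple P f x s + couple P g x s) + (1 - t) * offSum u s - lam)
      + t / 2 * τ * (∑ x ∈ T, ∑ s, f x s * couple P η x s - ∑ x ∈ T, ∑ s, η x s * couple P f x s)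
      + τ * (τ * (t / 2 * ∑ x ∈ T, ∑ s, η x s * couple P η x s))
      + (1 / β) * ∑ x ∈ T, ∑ s, (entropy (f x s) - entropy (f x s + τ * η x s)) := by
    unfold latticeEnergy
    simp only [hc, Finset.mul_sum, ← Finset.sum_sub_distrib, ← Finset.sum_add_distrib]
    refine Finset.sum_congr rfl fun x _ => Finset.sum_congr rfl fun s _ => ?_
    ring
  rw [hsymm, sub_self, mul_zero, add_zero] at hdiff
  have h1 := mul_le_mul_of_nonneg_left hent (show 0 ≤ 1 / β by positivity)
  have e : ∑ x ∈ T, ∑ s, τ * (η x s * Real.log (f x s + τ * η x s)) =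
      τ * ∑ x ∈ T, ∑ s, η x s * Real.log (f x s + τ * η x s) := by
    simp only [Finset.mul_sum]
  rw [e] at h1
  refine nonneg_of_mul_nonneg_right (a := τ) ?_ hτ
  rw [mul_add, mul_add]
  linarith

/-- A minimizer is positive, since the slope of the entropy is infinite at `0`. -/
theorem latticeMinimizer_pos (hP : IsLatticeKernel N R Q P) (hβ : 0 < β) (hL : 0 < L)
    (hζ : 0 ≤ ζ) (hu : ∀ s, 0 < u s) (hT : IsBlockSet L (T : Set (Fin d → ℤ)))
    (hf : f ∈ latticePhase ζ L u (T : Set (Fin d → ℤ)))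
    (hmin : IsMinOn (latticeEnergy β lam t u P T g) (latticePhase ζ L u T) f) :
    ∀ x ∈ T, ∀ s, 0 < f x s := by
  intro x0 hx0 s0
  refine lt_of_le_of_ne (hf.1 x0 s0) fun hzero => ?_
  set v : (Fin d → ℤ) → Fin S → ℝ := fun x => if x ∈ T then u else 0 with hv
  have hvT : ∀ x ∈ T, ∀ s, v x s = u s := fun x hx s => by simp [hv, hx]
  have hvm := const_mem_latticePhase hT hL hζ hu
  obtain ⟨c1, hc1⟩ : ∃ c, c = ∑ x ∈ T, ∑ s, (v x s - f x s) *
          (t * (couple P f x s + couple P g x s) + (1 - t) * offSum u s - lam) := ⟨_, rfl⟩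
  obtain ⟨c2, hc2⟩ : ∃ c, c = t / 2 * ∑ x ∈ T, ∑ s, (v x s - f x s) *
    couple P (fun x s => v x s - f x s) x s := ⟨_, rfl⟩
  obtain ⟨c3, hc3⟩ : ∃ c, c = ∑ x ∈ T, ∑ s, (u s - f x s) * Real.log (u s) := ⟨_, rfl⟩
  have key : ∀ τ : ℝ, 0 < τ → τ < 1 → 0 ≤ c1 + |c2| + (1 / β) * (c3 + u s0 * Real.log τ) := by
    intro τ h0 h1
    have hposT : ∀ x ∈ T, ∀ s, 0 < f x s + τ * (v x s - f x s) := fun x hx s => by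
      rw [hvT x hx s]
      have := mul_pos h0 (hu s)
      have := mul_nonneg (sub_nonneg.mpr h1.le) (hf.1 x s)
      nlinarith
    have hs := latticeEnergy_step hP hβ hL hf hmin hvm h0 h1.le hposT
    rw [← hc1, ← hc2] at hs
    have hle : ∑ x ∈ T, ∑ s, (v x s - f x s) * Real.log (f x s + τ * (v x s - f x s)) ≤
        c3 + u s0 * Real.log τ := by
      have hterm : ∀ x ∈ T, ∀ s, (v x s - f x s) * Real.log (f x s + τ * (v x s - f x s)) ≤
          (u s - f x s) * Real.log (u s) + if x = x0 then if s = s0 then u s0 * Real.log τ else 0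
            else 0 := by
        intro x hx s
        rw [hvT x hx s]
        have hp := hposT x hx s
        rw [hvT x hx s] at hp
        by_cases hxs : x = x0 ∧ s = s0
        · obtain ⟨rfl, rfl⟩ := hxs
          simp only [if_true, ← hzero, sub_zero, zero_add]
          rw [Real.log_mul h0.ne' (hu s).ne']
          exact le_of_eq (by ring)
        · have : (if x = x0 then if s = s0 then u s0 * Real.log τ else 0 else 0) = 0 := by
            split_ifs with a b
            · exact (hxs ⟨a, b⟩).elim
            · rfl
            · rfl
          rw [this, add_zero]
          rcases le_total (f x s) (u s) with h | h
          · refine mul_le_mul_of_nonneg_left (Real.log_le_log hp ?_) (sub_nonneg.mpr h)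
            nlinarith
          · refine mul_le_mul_of_nonpos_left (Real.log_le_log (hu s) ?_) (sub_nonpos.mpr h)
            nlinarith
      refine (Finset.sum_le_sum fun x hx => Finset.sum_le_sum fun s _ => hterm x hx s).trans
        (le_of_eq ?_)
      simp only [Finset.sum_add_distrib, ← hc3]
      congr 1
      rw [Finset.sum_eq_single x0]
      · simp
      · intro b _ hb; simp [hb]
      · intro h; exact (h hx0).elim
    have h2 := mul_le_mul_of_nonneg_left hle (show 0 ≤ 1 / β by positivity)
    have h3 : τ * c2 ≤ |c2| := by
      nlinarith [le_abs_self c2, abs_nonneg c2]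
    linarith
  -- the right-hand side of `key` tends to `-∞` as `τ → 0`; this `τ` makes it negative
  have hM := key (Real.exp (-(|β * (c1 + |c2|) + c3| + 1) / u s0)) (Real.exp_pos _)
    (Real.exp_lt_one_iff.mpr (div_neg_of_neg_of_pos
      (by have := abs_nonneg (β * (c1 + |c2|) + c3); linarith) (hu s0)))
  rw [Real.log_exp, mul_div_cancel₀ _ (hu s0).ne'] at hM
  have h4 := mul_nonneg hβ.le hM
  have e : β * (c1 + |c2| + 1 / β * (c3 + -(|β * (c1 + |c2|) + c3| + 1))) =
    (β * (c1 + |c2|) + c3) - |β * (c1 + |c2|) + c3| - 1 := by field_simp; ring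
  rw [e] at h4
  linarith [le_abs_self (β * (c1 + |c2|) + c3)]

/-- The variational inequality at a minimizer. The terms at the critical density `u` are
subtracted from the derivative, to which they contribute nothing. -/
theorem first_variation (hP : IsLatticeKernel N R Q P) (hβ : 0 < β) (hL : 0 < L)
    (hcrit : ∀ s, offSum u s - lam + (1 / β) * Real.log (u s) = 0)
    (hf : f ∈ latticePhase ζ L u (T : Set (Fin d → ℤ)))
    (hmin : IsMinOn (latticeEnergy β lam t u P T g) (latticePhase ζ L u T) f)
    (hfpos : ∀ x ∈ T, ∀ s, 0 < f x s)
    (hf' : f' ∈ latticePhase ζ L u (T : Set (Fin d → ℤ))) :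
    0 ≤ ∑ x ∈ T, ∑ s, (f' x s - f x s) *
      (excess t u P g f x s + (1 / β) * (Real.log (f x s) - Real.log (u s))) := by
  obtain ⟨c1, hc1⟩ : ∃ c, c = ∑ x ∈ T, ∑ s, (f' x s - f x s) *
          (t * (couple P f x s + couple P g x s) + (1 - t) * offSum u s - lam) := ⟨_, rfl⟩
  obtain ⟨c2, hc2⟩ : ∃ c, c = t / 2 * ∑ x ∈ T, ∑ s, (f' x s - f x s) *
    couple P (fun x s => f' x s - f x s) x s := ⟨_, rfl⟩
  have hstep : ∀ τ : ℝ, 0 < τ → τ < 1 → 0 ≤ c1 + τ * c2 + (1 / β) * ∑ x ∈ T, ∑ s,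
      (f' x s - f x s) * Real.log (f x s + τ * (f' x s - f x s)) := by
    intro τ h0 h1
    rw [hc1, hc2]
    refine latticeEnergy_step hP hβ hL hf hmin hf' h0 h1.le fun x hx s => ?_
    have := mul_pos (sub_pos.mpr h1) (hfpos x hx s)
    have := mul_nonneg h0.le (hf'.1 x s)
    nlinarith
  have hlim : Filter.Tendsto (fun τ : ℝ => c1 + τ * c2 + (1 / β) * ∑ x ∈ T, ∑ s,
      (f' x s - f x s) * Real.log (f x s + τ * (f' x s - f x s))) (nhdsWithin 0 (Set.Ioi 0))
      (nhds (c1 + 0 * c2 + (1 / β) * ∑ x ∈ T, ∑ s, (f' x s - f x s) *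
        Real.log (f x s + 0 * (f' x s - f x s)))) := by
    refine Filter.Tendsto.mono_left ?_ nhdsWithin_le_nhds
    refine ((tendsto_const_nhds.add (Filter.tendsto_id.mul_const _)).add
      (Filter.Tendsto.const_mul _ (tendsto_finsetSum _ fun x hx => tendsto_finsetSum _ fun s _ =>
        Filter.Tendsto.const_mul _ ?_)))
    have hc : ContinuousAt (fun τ : ℝ => Real.log (f x s + τ * (f' x s - f x s))) 0 := by
      refine ContinuousAt.log (by fun_prop) ?_
      rw [zero_mul, add_zero]
      exact (hfpos x hx s).ne'
    exact hc
  have h0 := ge_of_tendsto hlim (by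
    filter_upwards [Ioo_mem_nhdsGT (zero_lt_one (α := ℝ))] with τ hτ using hstep τ hτ.1 hτ.2)
  rw [hc1] at h0
  refine h0.trans (le_of_eq ?_)
  simp only [zero_mul, add_zero, Finset.mul_sum, ← Finset.sum_add_distrib]
  refine Finset.sum_congr rfl fun x _ => Finset.sum_congr rfl fun s _ => ?_
  unfold excess
  linear_combination (f' x s - f x s) * hcrit s

end Lattice

section Lattice

variable {d S N R L : ℕ} {Q β lam t ζ : ℝ} {u : Fin S → ℝ}
  {q P : (Fin d → ℤ) → (Fin d → ℤ) → ℝ} {T : Finset (Fin d → ℤ)}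
  {f f' g : (Fin d → ℤ) → Fin S → ℝ}

/-- Transfer of mass between two sites of a block. -/
theorem transfer_mem_latticePhase (hL : 0 < L) (hT : IsBlockSet L (T : Set (Fin d → ℤ)))
    (hf : f ∈ latticePhase ζ L u (T : Set (Fin d → ℤ))) {z₁ z₂ : Fin d → ℤ} (hz : z₁ ∈ T)
    (hzz : blk L z₂ = blk L z₁) (s : Fin S) :
    (fun z s' => f z s' + f z₁ s * ((if z = z₂ then if s' = s then 1 else 0 else 0) -
      (if z = z₁ then if s' = s then 1 else 0 else 0))) ∈
        latticePhase ζ L u (T : Set (Fin d → ℤ)) := by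
  have hz2 : z₂ ∈ T := hT z₁ z₂ hzz.symm hz
  have h0 := hf.1 z₁ s
  refine ⟨fun z s' => ?_, fun z hzT => ?_, fun x hx s' => ?_⟩
  · have h1 := hf.1 z s'
    by_cases h : z = z₁ ∧ s' = s
    · obtain ⟨rfl, rfl⟩ := h
      simp only [if_true]
      split_ifs <;> nlinarith
    · have e : (if z = z₁ then if s' = s then (1 : ℝ) else 0 else 0) = 0 := by
        split_ifs with a b
        · exact (h ⟨a, b⟩).elim
        · rfl
        · rfl
      simp only [e, sub_zero]
      split_ifs <;> nlinarith
  · have h1 : z ≠ z₁ := fun h => hzT (by rw [h]; exact hz)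
    have h2 : z ≠ z₂ := fun h => hzT (by rw [h]; exact hz2)
    funext s'
    simp [hf.2.1 z hzT, h1, h2]
  · have e : ∑ z ∈ block L (blk L x), (f z s' + f z₁ s *
        ((if z = z₂ then if s' = s then 1 else 0 else 0) -
      (if z = z₁ then if s' = s then 1 else 0 else 0))) = ∑ z ∈ block L (blk L x), f z s' := by
      rw [Finset.sum_add_distrib, ← Finset.mul_sum, Finset.sum_sub_distrib, Finset.sum_ite_eq',
        Finset.sum_ite_eq']
      simp only [mem_block_iff hL, hzz, sub_self, mul_zero, add_zero]
    rw [e]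
    exact hf.2.2 x hx s'

/-- In each block a minimizer deviates from the critical density by no more than the potential
does. Exchanging mass inside the block shows that the derivative is constant there, and moving the
block towards `u` shows that this constant and the deviation have opposite signs. -/
theorem abs_log_sub_log_le (hP : IsLatticeKernel N R Q P) (hβ : 0 < β) (hL : 0 < L)
    (hζ : 0 ≤ ζ) (hu : ∀ s, 0 < u s) (hT : IsBlockSet L (T : Set (Fin d → ℤ)))
    (hcrit : ∀ s, offSum u s - lam + (1 / β) * Real.log (u s) = 0)
    (hf : f ∈ latticePhase ζ L u (T : Set (Fin d → ℤ)))
    (hmin : IsMinOn (latticeEnergy β lam t u P T g) (latticePhase ζ L u T) f)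
    {x : Fin d → ℤ} (hx : x ∈ T) {s : Fin S} {M : ℝ}
    (hM : ∀ z ∈ block L (blk L x), |excess t u P g f z s| ≤ M) :
    |Real.log (f x s) - Real.log (u s)| ≤ 3 * β * M := by
  have hfpos := latticeMinimizer_pos hP hβ hL hζ hu hT hf hmin
  have hBT : ∀ z ∈ block L (blk L x), z ∈ T := fun z hz => block_subset hT hL hx hz
  have hxB : x ∈ block L (blk L x) := (mem_block_iff hL).mpr rfl
  set D : (Fin d → ℤ) → ℝ := fun z =>
    excess t u P g f z s + (1 / β) * (Real.log (f z s) - Real.log (u s)) with hD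
  -- moving all the mass of component `s` from `z₁` to `z₂` does not lower the energy
  have hexch : ∀ z₁ ∈ block L (blk L x), ∀ z₂ ∈ block L (blk L x), D z₁ ≤ D z₂ := by
    intro z₁ h1 z₂ h2
    have hz1 := (mem_block_iff hL).mp h1
    have hz2 := (mem_block_iff hL).mp h2
    have hv := first_variation hP hβ hL hcrit hf hmin hfpos
      (transfer_mem_latticePhase hL hT hf (hBT z₁ h1) (hz2.trans hz1.symm) s)
    have e : ∀ z ∈ T, ∑ s', (f z s' + f z₁ s * ((if z = z₂ then if s' = s then 1 else 0 else 0) -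
        (if z = z₁ then if s' = s then 1 else 0 else 0)) - f z s') *
        (excess t u P g f z s' + (1 / β) * (Real.log (f z s') - Real.log (u s'))) =
        f z₁ s * ((if z = z₂ then D z else 0) - (if z = z₁ then D z else 0)) := by
      intro z _
      rw [Finset.sum_eq_single s]
      · simp only [if_true, hD]
        split_ifs <;> ring
      · intro b _ hb; simp [hb]
      · simp
    rw [Finset.sum_congr rfl e, ← Finset.mul_sum, Finset.sum_sub_distrib, Finset.sum_ite_eq',
      Finset.sum_ite_eq', if_pos (hBT z₁ h1), if_pos (hBT z₂ h2)] at hv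
    have := nonneg_of_mul_nonneg_right hv (hfpos z₁ (hBT z₁ h1) s)
    linarith
  -- otherwise `D` has the sign of `f - u` on the whole block, and replacing `f` by `u` there
  -- would lower the energy
  obtain ⟨z, hz, hzM⟩ : ∃ z ∈ block L (blk L x), |Real.log (f z s) - Real.log (u s)| ≤ β * M := by
    by_contra hcon
    push Not at hcon
    have hmem : (fun z s' => f z s' + if z ∈ block L (blk L x) then
        (if s' = s then u s - f z s else 0) else 0) ∈
        latticePhase ζ L u (T : Set (Fin d → ℤ)) := by
      refine ⟨fun z s' => ?_, fun z hzT => ?_, fun y hy s' => ?_⟩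
      · have h1 := hf.1 z s'
        have h2 := (hu s').le
        dsimp only
        split_ifs with a b
        · subst b; linarith
        · linarith
        · linarith
      · have : z ∉ block L (blk L x) := fun h => hzT (hBT z h)
        funext s'
        simp [hf.2.1 z hzT, this]
      · by_cases h : blk L y = blk L x ∧ s' = s
        · obtain ⟨h, rfl⟩ := h
          have hL' : (0 : ℝ) < L := by exact_mod_cast hL
          have e : ∀ z ∈ block L (blk L x), (f z s' + if z ∈ block L (blk L x) then
              (if s' = s' then u s' - f z s' else 0) else 0) = u s' := fun z hz => by
            rw [if_pos hz, if_pos rfl, add_sub_cancel]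
          rw [h, Finset.sum_congr rfl e]
          simp only [Finset.sum_const, card_block, nsmul_eq_mul, Nat.cast_pow]
          rw [mul_div_cancel_left₀ _ (by positivity), sub_self, abs_zero]
          exact hζ
        · have e : ∀ z ∈ block L (blk L y), (f z s' + if z ∈ block L (blk L x) then
              (if s' = s then u s - f z s else 0) else 0) = f z s' := fun z hz => by
            rw [mem_block_iff hL] at hz
            split_ifs with a b
            · exact (h ⟨by rw [← hz, (mem_block_iff hL).mp a], b⟩).elim
            · exact add_zero _
            · exact add_zero _
          rw [Finset.sum_congr rfl e]
          exact hf.2.2 y hy s'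
    have hv := first_variation hP hβ hL hcrit hf hmin hfpos hmem
    have hneg : ∑ z ∈ T, ∑ s', ((f z s' + if z ∈ block L (blk L x) then
        (if s' = s then u s - f z s else 0) else 0) - f z s') *
        (excess t u P g f z s' + (1 / β) * (Real.log (f z s') - Real.log (u s'))) < 0 := by
      have e : ∀ z ∈ T, ∑ s', ((f z s' + if z ∈ block L (blk L x) then
          (if s' = s then u s - f z s else 0) else 0) - f z s') *
          (excess t u P g f z s' + (1 / β) * (Real.log (f z s') - Real.log (u s'))) =
          if z ∈ block L (blk L x) then (u s - f z s) * D z else 0 := by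
        intro z _
        rw [Finset.sum_eq_single s]
        · simp only [if_true, hD]
          split_ifs <;> ring
        · intro b _ hb; simp [hb]
        · simp
      rw [Finset.sum_congr rfl e]
      have hterm : ∀ z ∈ block L (blk L x), (u s - f z s) * D z < 0 := by
        intro z hz
        have h1 := hcon z hz
        have h2 := abs_le.mp (hM z hz)
        have hf0 := hfpos z (hBT z hz) s
        have e1 : D z = (1 / β) * (β * excess t u P g f z s +
          (Real.log (f z s) - Real.log (u s))) := by
          simp only [hD]; field_simp
        have hb : 0 < 1 / β := by positivity
        have h3 : β * excess t u P g f z s ≤ β * M := mul_le_mul_of_nonneg_left h2.2 hβ.le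
        have h4 : β * (-M) ≤ β * excess t u P g f z s := mul_le_mul_of_nonneg_left h2.1 hβ.le
        rcases lt_abs.mp h1 with h | h
        · have hd : 0 < D z := by rw [e1]; exact mul_pos hb (by linarith)
          have hM0 : 0 ≤ β * M := by nlinarith
          have : u s < f z s := (Real.log_lt_log_iff (hu s) hf0).mp (by linarith)
          exact mul_neg_of_neg_of_pos (by linarith) hd
        · have hd : D z < 0 := by rw [e1]; exact mul_neg_of_pos_of_neg hb (by linarith)
          have hM0 : 0 ≤ β * M := by nlinarith
          have : f z s < u s := (Real.log_lt_log_iff hf0 (hu s)).mp (by linarith)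
          exact mul_neg_of_pos_of_neg (by linarith) hd
      refine Finset.sum_neg' (fun z _ => ?_) ⟨x, hx, ?_⟩
      · split_ifs with a
        · exact (hterm z a).le
        · exact le_rfl
      · rw [if_pos hxB]; exact hterm x hxB
    linarith
  have heq : D x = D z := le_antisymm (hexch x hxB z hz) (hexch z hz x hxB)
  have h1 := abs_le.mp (hM x hxB)
  have h2 := abs_le.mp (hM z hz)
  have h3 : Real.log (f x s) - Real.log (u s) = (Real.log (f z s) - Real.log (u s)) +
      β * (excess t u P g f z s - excess t u P g f x s) := by
    have e1 : β * D x = β * D z := by rw [heq]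
    simp only [hD, mul_add] at e1
    have e2 : ∀ y : ℝ, β * (1 / β * y) = y := fun y => by field_simp
    rw [e2, e2] at e1
    linarith
  rw [h3]
  refine (abs_add_le _ _).trans ?_
  have h4 : |β * (excess t u P g f z s - excess t u P g f x s)| ≤ β * (2 * M) := by
    rw [abs_mul, abs_of_pos hβ]
    refine mul_le_mul_of_nonneg_left (abs_le.mpr ⟨?_, ?_⟩) hβ.le <;> linarith
  linarith

theorem continuous_entropy : Continuous entropy := by
  have : entropy = fun x => -(x * Real.log x - x) := by
    funext x; unfold entropy; ring
  rw [this]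
  exact (Real.continuous_mul_log.sub continuous_id).neg

theorem exists_latticeMinimizer (hP : IsLatticeKernel N R Q P) (hL : 0 < L)
    (hζ : 0 ≤ ζ) (hu : ∀ s, 0 < u s) (hT : IsBlockSet L (T : Set (Fin d → ℤ))) :
    ∃ f ∈ latticePhase ζ L u (T : Set (Fin d → ℤ)),
      IsMinOn (latticeEnergy β lam t u P T g) (latticePhase ζ L u T) f := by
  have hev : ∀ (x : Fin d → ℤ) (s : Fin S),
      Continuous fun f : (Fin d → ℤ) → Fin S → ℝ => f x s := fun x s => by fun_prop
  have hclosed : IsClosed (latticePhase ζ L u (T : Set (Fin d → ℤ))) := by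
    unfold latticePhase
    simp only [Set.ofPred_and, Set.ofPred_forall]
    refine IsClosed.inter ?_ (IsClosed.inter ?_ ?_)
    · exact isClosed_iInter fun x => isClosed_iInter fun s =>
        isClosed_le continuous_const (hev x s)
    · exact isClosed_iInter fun x => isClosed_iInter fun _ =>
        isClosed_eq (continuous_apply x) continuous_const
    · refine isClosed_iInter fun x => isClosed_iInter fun _ => isClosed_iInter fun s =>
        isClosed_le (Continuous.abs (Continuous.sub (Continuous.div_const
          (continuous_finsetSum _ fun z _ => hev z s) _) continuous_const)) continuous_const
  have hcomp : IsCompact (latticePhase ζ L u (T : Set (Fin d → ℤ))) := by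
    refine IsCompact.of_isClosed_subset (isCompact_univ_pi fun _ : Fin d → ℤ =>
      isCompact_univ_pi fun s : Fin S => isCompact_Icc (a := (0 : ℝ))
        (b := (u s + ζ) * (L : ℝ) ^ d)) hclosed fun f hf => ?_
    refine Set.mem_univ_pi.mpr fun x => Set.mem_univ_pi.mpr fun s => ⟨hf.1 x s, ?_⟩
    have hL' : (0 : ℝ) < (L : ℝ) ^ d := by have : (0 : ℝ) < L := by exact_mod_cast hL
                                           positivity
    by_cases hx : x ∈ (T : Set (Fin d → ℤ))
    · have h1 := (abs_le.mp (hf.2.2 x hx s)).2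
      have h2 : f x s ≤ ∑ z ∈ block L (blk L x), f z s :=
        Finset.single_le_sum (f := fun z => f z s) (fun z _ => hf.1 z s)
          ((mem_block_iff hL).mpr rfl)
      refine h2.trans ?_
      rw [← div_le_iff₀ hL']
      linarith
    · rw [hf.2.1 x hx]
      have := hu s
      simp only [Pi.zero_apply]
      positivity
  have hcoup : ∀ x s, Continuous fun f : (Fin d → ℤ) → Fin S → ℝ => couple P f x s := by
    intro x s
    simp only [couple, hP.avg_eq_sum _ (subset_refl (box x R)), offSum_eq]
    exact (continuous_finsetSum _ fun s' _ => continuous_finsetSum _ fun y _ =>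
      continuous_const.mul (hev y s')).sub
        (continuous_finsetSum _ fun y _ => continuous_const.mul (hev y s))
  have hcont : Continuous (latticeEnergy β lam t u P T g) := by
    unfold latticeEnergy
    refine continuous_finsetSum _ fun x _ => continuous_finsetSum _ fun s _ => ?_
    exact ((continuous_const.mul ((continuous_const.mul ((hev x s).mul (hcoup x s))).add
      ((hev x s).mul continuous_const))).add (continuous_const.mul (hev x s))).sub
        (continuous_const.mul (continuous_entropy.comp (hev x s)))
  exact hcomp.exists_isMinOn ⟨_, const_mem_latticePhase hT hL hζ hu⟩ hcont.continuousOn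

end Lattice

/-! ### A priori bound and uniqueness -/

section Lattice

variable {d S N R L : ℕ} {Q β lam t ζ : ℝ} {u : Fin S → ℝ}
  {q P : (Fin d → ℤ) → (Fin d → ℤ) → ℝ} {T : Finset (Fin d → ℤ)}
  {f f' g : (Fin d → ℤ) → Fin S → ℝ}

/-- The deviation of `f` from `u` on `A`, extended by zero. -/
noncomputable def deviation (u : Fin S → ℝ) (A : Set (Fin d → ℤ)) (f : (Fin d → ℤ) → Fin S → ℝ)
    (x : Fin d → ℤ) (s : Fin S) : ℝ :=
  A.indicator (fun x => f x s - u s) x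

theorem deviation_of_mem {A : Set (Fin d → ℤ)} {x : Fin d → ℤ} (hx : x ∈ A) (s : Fin S) :
    deviation u A f x s = f x s - u s :=
  Set.indicator_of_mem hx _

theorem deviation_of_notMem {A : Set (Fin d → ℤ)} {x : Fin d → ℤ} (hx : x ∉ A) (s : Fin S) :
    deviation u A f x s = 0 :=
  Set.indicator_of_notMem hx _

/-- The kernel smooths the deviation of a configuration in the phase `u`, since block averages of
the deviation are at most `ζ` and its block `ℓ¹` averages are at most `2 U + ζ`. -/
theorem abs_avg_deviation_le (hP : IsLatticeKernel N R Q P) (hR : R ≤ 2 * N) (hL : 0 < L)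
    (hLN : L ≤ N) (hζ : 0 ≤ ζ) (hζ1 : ζ ≤ 1) (hu : ∀ s, 0 < u s) {U : ℝ} (hU : ∀ s, u s ≤ U)
    {A : Set (Fin d → ℤ)} (hA : IsBlockSet L A) (hf : f ∈ latticePhase ζ L u A)
    (x : Fin d → ℤ) (s : Fin S) :
    |avg P (fun y => deviation u A f y s) x| ≤ Q * 7 ^ d * (ζ + (2 * U + 1) * (L / N)) := by
  have hL' : (0 : ℝ) < (L : ℝ) ^ d := by
    have : (0 : ℝ) < L := by exact_mod_cast hL
    positivity
  have hU0 : 0 ≤ 2 * U + 1 := by linarith [hu s, hU s]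
  have hin : ∀ b, (∀ z ∈ block L b, z ∈ A) ∨ (∀ z ∈ block L b, z ∉ A) := by
    intro b
    by_cases hb : corner L b ∈ A
    · left
      intro z hz
      refine hA _ z ?_ hb
      rw [(mem_block_iff hL).mp hz, (mem_block_iff hL).mp (corner_mem_block hL b)]
    · right
      intro z hz hzA
      refine hb (hA z _ ?_ hzA)
      rw [(mem_block_iff hL).mp hz, (mem_block_iff hL).mp (corner_mem_block hL b)]
  have hsum : ∀ b, (∀ z ∈ block L b, z ∈ A) →
      |∑ z ∈ block L b, (f z s - u s)| ≤ ζ * (L : ℝ) ^ d := by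
    intro b hb
    have h1 := hf.2.2 _ (hb _ (corner_mem_block hL b)) s
    rw [(mem_block_iff hL).mp (corner_mem_block hL b)] at h1
    have e : ∑ z ∈ block L b, (f z s - u s) =
        ((∑ z ∈ block L b, f z s) / (L : ℝ) ^ d - u s) * (L : ℝ) ^ d := by
      rw [Finset.sum_sub_distrib]
      simp only [Finset.sum_const, card_block, nsmul_eq_mul, Nat.cast_pow]
      field_simp
    rw [e, abs_mul, abs_of_pos hL']
    exact mul_le_mul_of_nonneg_right h1 hL'.le
  refine hP.abs_avg_le hR hL hLN hζ hU0 (fun b => ?_) (fun b => ?_) x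
  · rcases hin b with hb | hb
    · rw [Finset.sum_congr rfl fun z hz => deviation_of_mem (hb z hz) s]
      exact hsum b hb
    · rw [Finset.sum_congr rfl fun z hz => deviation_of_notMem (hb z hz) s]
      simp only [Finset.sum_const_zero, abs_zero]
      positivity
  · rcases hin b with hb | hb
    · have e : ∀ z ∈ block L b, |deviation u A f z s| ≤ (f z s - u s) + 2 * u s := by
        intro z hz
        rw [deviation_of_mem (hb z hz)]
        have := hf.1 z s
        have := hu s
        rw [abs_le]; constructor <;> linarith
      refine (Finset.sum_le_sum e).trans ?_
      rw [Finset.sum_add_distrib]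
      have h1 := (abs_le.mp (hsum b hb)).2
      have h2 : ∑ _z ∈ block L b, 2 * u s = 2 * u s * (L : ℝ) ^ d := by
        simp only [Finset.sum_const, card_block, nsmul_eq_mul, Nat.cast_pow]; ring
      rw [h2]
      have h3 : ζ * (L : ℝ) ^ d ≤ 1 * (L : ℝ) ^ d := mul_le_mul_of_nonneg_right hζ1 hL'.le
      have h4 : 2 * u s * (L : ℝ) ^ d ≤ 2 * U * (L : ℝ) ^ d :=
        mul_le_mul_of_nonneg_right (by linarith [hU s]) hL'.le
      linarith
    · have e : ∀ z ∈ block L b, |deviation u A f z s| = 0 := by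
        intro z hz
        rw [deviation_of_notMem (hb z hz), abs_zero]
      rw [Finset.sum_congr rfl e]
      simp only [Finset.sum_const_zero]
      positivity

/-- A constant configuration `u` generates the mean field potential, hence the excess is generated
by the deviations from `u` on the two sides of the boundary. -/
theorem excess_eq (hP : IsLatticeKernel N R Q P) {A : Set (Fin d → ℤ)}
    (hf : f ∈ latticePhase ζ L u A) (hg : g ∈ latticePhase ζ L u Aᶜ)
    (x : Fin d → ℤ) (s : Fin S) :
    excess t u P g f x s = t * couple P (deviation u A f) x s
      + t * couple P (deviation u Aᶜ g) x s := by
  unfold excess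
  rw [← mul_add, ← couple_add hP, ← couple_add hP, ← couple_const hP u x s, ← couple_sub hP]
  congr 2
  funext y s'
  by_cases hy : y ∈ A
  · have h1 : g y = 0 := hg.2.1 y (by simpa using hy)
    simp [deviation, hy, h1]
  · have h1 : f y = 0 := hf.2.1 y hy
    simp [deviation, hy, h1]

theorem isBlockSet_compl {A : Set (Fin d → ℤ)} (hA : IsBlockSet L A) : IsBlockSet L Aᶜ :=
  fun x y hxy hx hy => hx (hA y x hxy.symm hy)

theorem abs_excess_le (hP : IsLatticeKernel N R Q P) (hR : R ≤ 2 * N) (hL : 0 < L)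
    (hLN : L ≤ N) (hζ : 0 ≤ ζ) (hζ1 : ζ ≤ 1) (hu : ∀ s, 0 < u s) {U : ℝ} (hU : ∀ s, u s ≤ U)
    (ht : t ∈ Set.Icc (0 : ℝ) 1) {A : Set (Fin d → ℤ)} (hA : IsBlockSet L A)
    (hf : f ∈ latticePhase ζ L u A) (hg : g ∈ latticePhase ζ L u Aᶜ)
    (x : Fin d → ℤ) (s : Fin S) :
    |excess t u P g f x s| ≤ 2 * (S * (Q * 7 ^ d * (ζ + (2 * U + 1) * (L / N)))) := by
  rw [excess_eq hP hf hg, ← mul_add, abs_mul, abs_of_nonneg ht.1]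
  have h1 := abs_couple_le (abs_avg_deviation_le hP hR hL hLN hζ hζ1 hu hU hA hf x) s
  have h2 := abs_couple_le
    (abs_avg_deviation_le hP hR hL hLN hζ hζ1 hu hU (isBlockSet_compl hA) hg x) s
  have h3 := abs_add_le (couple P (deviation u A f) x s) (couple P (deviation u Aᶜ g) x s)
  have h4 := mul_le_of_le_one_left (abs_nonneg
    (couple P (deviation u A f) x s + couple P (deviation u Aᶜ g) x s)) ht.2
  linarith

/-- Strong monotonicity of the logarithm on densities close to `c`. -/
theorem mul_log_sub_log_ge {a b c e β : ℝ} (ha : 0 < a) (hb : 0 < b) (hc : 0 < c) (hβ : 0 < β)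
    (h1 : |Real.log a - Real.log c| ≤ e) (h2 : |Real.log b - Real.log c| ≤ e) :
    (1 - e) * (1 / (β * c)) * (a - b) ^ 2 ≤
      (a - b) * ((1 / β) * (Real.log a - Real.log b)) := by
  have hle : ∀ a, 0 < a → |Real.log a - Real.log c| ≤ e → a ≤ c * Real.exp e := by
    intro a ha h
    rw [← Real.exp_log ha, ← Real.exp_log hc, ← Real.exp_add]
    refine Real.exp_le_exp.mpr ?_
    linarith [(abs_le.mp h).2]
  -- the case `b ≤ a`
  have main : ∀ a b, 0 < a → 0 < b → a ≤ c * Real.exp e → b ≤ a →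
      (1 - e) * (1 / c) * (a - b) ^ 2 ≤ (a - b) * (Real.log a - Real.log b) := by
    intro a b ha hb hac hba
    have h3 := Real.one_sub_inv_le_log_of_pos (div_pos ha hb)
    rw [Real.log_div ha.ne' hb.ne', inv_div] at h3
    have h4 : (1 - e) * (1 / c) * (a - b) ≤ 1 - b / a := by
      have h5 : 1 - b / a = (a - b) * (1 / a) := by field_simp
      rw [h5, mul_comm]
      refine mul_le_mul_of_nonneg_left ?_ (sub_nonneg.mpr hba)
      rw [mul_one_div, div_le_div_iff₀ hc ha]
      have h6 : (1 - e) ≤ Real.exp (-e) := by linarith [Real.add_one_le_exp (-e)]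
      calc (1 - e) * a ≤ Real.exp (-e) * a := mul_le_mul_of_nonneg_right h6 ha.le
        _ ≤ Real.exp (-e) * (c * Real.exp e) :=
          mul_le_mul_of_nonneg_left hac (Real.exp_pos _).le
        _ = 1 * c := by rw [Real.exp_neg]; field_simp
    have := mul_le_mul_of_nonneg_left (h4.trans h3) (sub_nonneg.mpr hba)
    linarith [this, show (1 - e) * (1 / c) * (a - b) ^ 2 = (a - b) * ((1 - e) * (1 / c) * (a - b)) by
      ring]
  have h0 : (1 - e) * (1 / c) * (a - b) ^ 2 ≤ (a - b) * (Real.log a - Real.log b) := by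
    rcases le_total b a with h | h
    · exact main a b ha hb (hle a ha h1) h
    · have := main b a hb ha (hle b hb h2) h
      nlinarith
  have h5 := mul_le_mul_of_nonneg_left h0 (show 0 ≤ 1 / β by positivity)
  have e1 : (1 - e) * (1 / (β * c)) * (a - b) ^ 2 =
      1 / β * ((1 - e) * (1 / c) * (a - b) ^ 2) := by field_simp
  rw [e1]
  refine h5.trans (le_of_eq (by ring))

/-- Minimizers which are close to `u` are unique, by strict convexity near `u`. -/
theorem latticeMinimizer_unique (hq : IsLatticeKernel N R Q q) (hβ : 0 < β) (hL : 0 < L)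
    (hζ : 0 ≤ ζ) (hu : ∀ s, 0 < u s) (hT : IsBlockSet L (T : Set (Fin d → ℤ)))
    (hcrit : ∀ s, offSum u s - lam + (1 / β) * Real.log (u s) = 0) {κ A e : ℝ}
    (hκ : ∀ v : Fin S → ℝ, κ * ∑ s, v s ^ 2 ≤ hessForm β u v)
    (hκu : ∀ s, κ ≤ 1 / (β * u s)) (hA : ∀ s, 1 / (β * u s) ≤ A) (he : 0 ≤ e)
    (heκ : 0 < κ - e * (A + S)) (ht : t ∈ Set.Icc (0 : ℝ) 1)
    (hf : f ∈ latticePhase ζ L u (T : Set (Fin d → ℤ)))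
    (hmin : IsMinOn (latticeEnergy β lam t u (comp q) T g) (latticePhase ζ L u T) f)
    (hf' : f' ∈ latticePhase ζ L u (T : Set (Fin d → ℤ)))
    (hmin' : IsMinOn (latticeEnergy β lam t u (comp q) T g) (latticePhase ζ L u T) f')
    (hc : ∀ x ∈ T, ∀ s, |Real.log (f x s) - Real.log (u s)| ≤ e)
    (hc' : ∀ x ∈ T, ∀ s, |Real.log (f' x s) - Real.log (u s)| ≤ e) : f = f' := by
  have hP := hq.comp_self
  have hpos := latticeMinimizer_pos hP hβ hL hζ hu hT hf hmin
  have hpos' := latticeMinimizer_pos hP hβ hL hζ hu hT hf' hmin'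
  have v1 := first_variation hP hβ hL hcrit hf hmin hpos hf'
  have v2 := first_variation hP hβ hL hcrit hf' hmin' hpos' hf
  have hco := weighted_coercive hq hκ hκu hA he ht (T := T) (v := fun x s => f x s - f' x s)
    (l := fun x s => (1 / β) * (Real.log (f x s) - Real.log (f' x s)))
    (fun x hx => by funext s; simp [hf.2.1 x (by simpa using hx), hf'.2.1 x (by simpa using hx)])
    (w := fun _ => 1) (fun _ => one_pos) (fun _ _ _ => by simpa using he)
    (fun x hx s => mul_log_sub_log_ge (hpos x hx s) (hpos' x hx s) (hu s) hβ (hc x hx s)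
      (hc' x hx s))
  have hsum : ∑ x ∈ T, ∑ s, (1 : ℝ) ^ 2 * (f x s - f' x s) *
      (t * couple (comp q) (fun x s => f x s - f' x s) x s
        + (1 / β) * (Real.log (f x s) - Real.log (f' x s))) =
      -(∑ x ∈ T, ∑ s, (f' x s - f x s) *
      (excess t u (comp q) g f x s + (1 / β) * (Real.log (f x s) - Real.log (u s)))
      + ∑ x ∈ T, ∑ s, (f x s - f' x s) *
      (excess t u (comp q) g f' x s + (1 / β) * (Real.log (f' x s) - Real.log (u s)))) := by
    simp only [← Finset.sum_add_distrib, ← Finset.sum_neg_distrib]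
    refine Finset.sum_congr rfl fun x _ => Finset.sum_congr rfl fun s _ => ?_
    rw [couple_sub hP]
    unfold excess
    ring
  rw [hsum] at hco
  have hle : ∑ x ∈ T, ∑ s, (1 * (f x s - f' x s)) ^ 2 ≤ 0 := by
    by_contra hcon
    push Not at hcon
    have := mul_pos heκ hcon
    linarith
  funext x s
  by_cases hx : x ∈ T
  · have h0 : ∑ x ∈ T, ∑ s, (1 * (f x s - f' x s)) ^ 2 = 0 :=
      le_antisymm hle (Finset.sum_nonneg fun _ _ => Finset.sum_nonneg fun _ _ => sq_nonneg _)
    have h1 := (Finset.sum_eq_zero_iff_of_nonneg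
      (fun _ _ => Finset.sum_nonneg fun _ _ => sq_nonneg _)).mp h0 x hx
    have h2 := (Finset.sum_eq_zero_iff_of_nonneg (fun _ _ => sq_nonneg _)).mp h1 s
      (Finset.mem_univ s)
    have h3 := pow_eq_zero_iff (two_ne_zero) |>.mp h2
    linarith
  · rw [hf.2.1 x (by simpa using hx), hf'.2.1 x (by simpa using hx)]

end Lattice

/-! ### Exponential decay of the deviation -/

section Lattice

variable {d S N L : ℕ} {Q β lam t ζ : ℝ} {u : Fin S → ℝ}
  {q : (Fin d → ℤ) → (Fin d → ℤ) → ℝ} {T : Finset (Fin d → ℤ)}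
  {f g : (Fin d → ℤ) → Fin S → ℝ}

theorem sum_int_exp_le {s : ℝ} (hs : 0 < s) (a : ℤ) (K : ℕ) :
    ∑ n ∈ Finset.Icc (a - K) (a + K), Real.exp (-(s * |((n - a : ℤ) : ℝ)|)) ≤ 2 + 2 / s := by
  classical
  set r := Real.exp (-s) with hr
  have hr0 : 0 < r := Real.exp_pos _
  have hr1 : r < 1 := Real.exp_lt_one_iff.mpr (by linarith)
  have hgeom : ∑ j ∈ Finset.range (K + 1), r ^ j ≤ 1 + 1 / s := by
    have h1 : ∑ j ∈ Finset.range (K + 1), r ^ j ≤ (1 - r)⁻¹ := by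
      rw [← tsum_geometric_of_lt_one hr0.le hr1]
      exact (summable_geometric_of_lt_one hr0.le hr1).sum_le_tsum _ fun _ _ => by positivity
    refine h1.trans ?_
    have h2 : r * (1 + s) ≤ 1 := by
      have := mul_le_mul_of_nonneg_left (Real.add_one_le_exp s) hr0.le
      rw [hr, ← Real.exp_add, neg_add_cancel, Real.exp_zero] at this
      rw [hr]; linarith
    rw [inv_le_iff_one_le_mul₀ (by linarith)]
    have e : (1 + 1 / s) * (1 - r) = (1 + s - r * (1 + s)) / s := by field_simp; ring
    rw [e, le_div_iff₀ hs]
    linarith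
  have hsub : Finset.Icc (a - K) (a + K) ⊆
      (Finset.range (K + 1)).image (fun j : ℕ => a + j) ∪
        (Finset.range (K + 1)).image (fun j : ℕ => a - j) := by
    intro n hn
    rw [Finset.mem_Icc] at hn
    rw [Finset.mem_union, Finset.mem_image, Finset.mem_image]
    rcases le_total a n with h | h
    · exact Or.inl ⟨(n - a).toNat, by rw [Finset.mem_range]; omega, by omega⟩
    · exact Or.inr ⟨(a - n).toNat, by rw [Finset.mem_range]; omega, by omega⟩
  have hi1 : ∑ n ∈ (Finset.range (K + 1)).image (fun j : ℕ => a + j),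
      Real.exp (-(s * |((n - a : ℤ) : ℝ)|)) = ∑ j ∈ Finset.range (K + 1), r ^ j := by
    rw [Finset.sum_image fun x _ y _ h => by simpa using h]
    refine Finset.sum_congr rfl fun j _ => ?_
    rw [hr, ← Real.exp_nat_mul]
    congr 1
    push_cast
    rw [add_sub_cancel_left, Nat.abs_cast]; ring
  have hi2 : ∑ n ∈ (Finset.range (K + 1)).image (fun j : ℕ => a - j),
      Real.exp (-(s * |((n - a : ℤ) : ℝ)|)) = ∑ j ∈ Finset.range (K + 1), r ^ j := by
    rw [Finset.sum_image fun x _ y _ h => by simpa using h]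
    refine Finset.sum_congr rfl fun j _ => ?_
    rw [hr, ← Real.exp_nat_mul]
    congr 1
    push_cast
    rw [show (a : ℝ) - j - a = -(j : ℝ) by ring, abs_neg, Nat.abs_cast]; ring
  calc _ ≤ ∑ n ∈ (Finset.range (K + 1)).image (fun j : ℕ => a + j) ∪
        (Finset.range (K + 1)).image (fun j : ℕ => a - j), Real.exp (-(s * |((n - a : ℤ) : ℝ)|)) :=
        Finset.sum_le_sum_of_subset_of_nonneg hsub fun _ _ _ => (Real.exp_pos _).le
    _ ≤ ∑ j ∈ Finset.range (K + 1), r ^ j + ∑ j ∈ Finset.range (K + 1), r ^ j := by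
        have h := Finset.sum_union_inter (s₁ := (Finset.range (K + 1)).image (fun j : ℕ => a + j))
          (s₂ := (Finset.range (K + 1)).image (fun j : ℕ => a - j))
          (f := fun n => Real.exp (-(s * |((n - a : ℤ) : ℝ)|)))
        rw [hi1, hi2] at h
        rw [← h]
        exact le_add_of_nonneg_right (Finset.sum_nonneg fun _ _ => (Real.exp_pos _).le)
    _ ≤ 2 + 2 / s := by
        have : 2 / s = 1 / s + 1 / s := by ring
        linarith

/-- The exponential weight of rate `ω / N` has total mass of order `N ^ d`. -/
theorem sum_exp_dist_le (hd : 0 < d) (hN : 0 < N) {ω : ℝ} (hω : 0 < ω)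
    (T : Finset (Fin d → ℤ)) (x₀ : Fin d → ℤ) :
    ∑ x ∈ T, Real.exp (-(ω / N * dist x x₀)) ≤ ((2 + 2 * d / ω) * N) ^ d := by
  have hN' : (1 : ℝ) ≤ N := by exact_mod_cast hN
  have hd' : (0 : ℝ) < d := by exact_mod_cast hd
  obtain ⟨K, hK⟩ : ∃ K : ℕ, ∀ x ∈ T, dist x x₀ ≤ K :=
    ⟨T.sup fun x => ⌈dist x x₀⌉₊, fun x hx => (Nat.le_ceil _).trans
      (by exact_mod_cast Finset.le_sup (f := fun x => ⌈dist x x₀⌉₊) hx)⟩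
  set s := ω / (d * N) with hs
  have hs0 : 0 < s := by positivity
  have hterm : ∀ x, Real.exp (-(ω / N * dist x x₀)) ≤
      ∏ i, Real.exp (-(s * |((x i - x₀ i : ℤ) : ℝ)|)) := by
    intro x
    rw [← Real.exp_sum]
    refine Real.exp_le_exp.mpr ?_
    rw [Finset.sum_neg_distrib, neg_le_neg_iff, ← Finset.mul_sum]
    have h1 : ∑ i, |((x i - x₀ i : ℤ) : ℝ)| ≤ ∑ _i : Fin d, dist x x₀ := by
      refine Finset.sum_le_sum fun i _ => ?_
      have := dist_le_pi_dist x x₀ i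
      rw [Int.dist_eq] at this
      push_cast
      exact this
    rw [Finset.sum_const, Finset.card_univ, Fintype.card_fin, nsmul_eq_mul] at h1
    calc s * ∑ i, |((x i - x₀ i : ℤ) : ℝ)| ≤ s * (d * dist x x₀) := by gcongr
      _ = ω / N * dist x x₀ := by rw [hs]; field_simp
  have hsub : T ⊆ Fintype.piFinset fun i => Finset.Icc (x₀ i - K) (x₀ i + K) := by
    intro x hx
    have h1 := mem_box_iff.mpr (by rw [dist_comm]; exact hK x hx : dist x₀ x ≤ (K : ℝ))
    rw [box, Finset.mem_Icc, Pi.le_def, Pi.le_def] at h1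
    rw [Fintype.mem_piFinset]
    exact fun i => Finset.mem_Icc.mpr ⟨h1.1 i, h1.2 i⟩
  calc ∑ x ∈ T, Real.exp (-(ω / N * dist x x₀))
      ≤ ∑ x ∈ T, ∏ i, Real.exp (-(s * |((x i - x₀ i : ℤ) : ℝ)|)) :=
        Finset.sum_le_sum fun x _ => hterm x
    _ ≤ ∑ x ∈ Fintype.piFinset fun i => Finset.Icc (x₀ i - K) (x₀ i + K),
          ∏ i, Real.exp (-(s * |((x i - x₀ i : ℤ) : ℝ)|)) :=
        Finset.sum_le_sum_of_subset_of_nonneg hsub fun _ _ _ =>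
          Finset.prod_nonneg fun _ _ => (Real.exp_pos _).le
    _ = ∏ i, ∑ n ∈ Finset.Icc (x₀ i - K) (x₀ i + K),
          Real.exp (-(s * |((n - x₀ i : ℤ) : ℝ)|)) :=
        (Finset.prod_univ_sum (fun i => Finset.Icc (x₀ i - K) (x₀ i + K))
          (fun i n => Real.exp (-(s * |((n - x₀ i : ℤ) : ℝ)|)))).symm
    _ ≤ ∏ _i : Fin d, ((2 + 2 * d / ω) * N) := by
        refine Finset.prod_le_prod (fun _ _ => Finset.sum_nonneg fun _ _ => (Real.exp_pos _).le)
          fun i _ => (sum_int_exp_le hs0 _ _).trans ?_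
        have : 2 / s = 2 * d / ω * N := by rw [hs]; field_simp
        rw [this, add_mul]
        linarith
    _ = ((2 + 2 * d / ω) * N) ^ d := by simp

theorem abs_exp_sub_one_le (z : ℝ) : |Real.exp z - 1| ≤ Real.exp |z| - 1 := by
  rcases le_total 0 z with h | h
  · rw [abs_of_nonneg h, abs_of_nonneg (by linarith [Real.add_one_le_exp z])]
  · rw [abs_of_nonpos h, abs_of_nonpos (by linarith [Real.exp_le_one_iff.mpr h])]
    linarith [Real.add_one_le_exp z, Real.add_one_le_exp (-z)]

/-- An exponential weight centred at `x₀`, which is constant on the blocks of side `L`. -/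
noncomputable def blockWeight (ω : ℝ) (N L : ℕ) (x₀ x : Fin d → ℤ) : ℝ :=
  Real.exp (-(ω / N * dist (corner L (blk L x)) x₀))

theorem blockWeight_pos (ω : ℝ) (x₀ x : Fin d → ℤ) : 0 < blockWeight ω N L x₀ x :=
  Real.exp_pos _

theorem dist_corner_le (hL : 0 < L) (x : Fin d → ℤ) : dist (corner L (blk L x)) x ≤ L :=
  dist_le_of_mem_block (corner_mem_block hL _) ((mem_block_iff hL).mpr rfl)

theorem blockWeight_le_one {ω : ℝ} (hω : 0 ≤ ω) (x₀ x : Fin d → ℤ) :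
    blockWeight ω N L x₀ x ≤ 1 := by
  refine Real.exp_le_one_iff.mpr (neg_nonpos.mpr ?_)
  have := dist_nonneg (x := corner L (blk L x)) (y := x₀)
  positivity

theorem blockWeight_ratio (hN : 0 < N) (hL : 0 < L) (hLN : L ≤ N) {ω : ℝ} (hω : 0 ≤ ω)
    (x₀ x y : Fin d → ℤ) (hxy : dist x y ≤ ((N + N : ℕ) : ℝ)) :
    |blockWeight ω N L x₀ x / blockWeight ω N L x₀ y - 1| ≤ Real.exp (4 * ω) - 1 := by
  have hN' : (0 : ℝ) < N := by exact_mod_cast hN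
  have hLN' : (L : ℝ) ≤ N := by exact_mod_cast hLN
  unfold blockWeight
  rw [← Real.exp_sub]
  refine (abs_exp_sub_one_le _).trans (sub_le_sub_right (Real.exp_le_exp.mpr ?_) 1)
  have e : -(ω / N * dist (corner L (blk L x)) x₀) - -(ω / N * dist (corner L (blk L y)) x₀) =
      ω / N * (dist (corner L (blk L y)) x₀ - dist (corner L (blk L x)) x₀) := by ring
  rw [e, abs_mul, abs_of_nonneg (by positivity)]
  have h1 := abs_dist_sub_le (corner L (blk L y)) (corner L (blk L x)) x₀
  have h2 := dist_corner_le hL x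
  have h3 := dist_corner_le hL y
  have h4 : dist (corner L (blk L y)) (corner L (blk L x)) ≤ 4 * N := by
    have t1 := dist_triangle (corner L (blk L y)) y (corner L (blk L x))
    have t2 := dist_triangle y x (corner L (blk L x))
    rw [dist_comm y x, dist_comm x (corner L (blk L x))] at t2
    push_cast at hxy
    linarith
  calc ω / N * _ ≤ ω / N * (4 * N) := by gcongr; exact h1.trans h4
    _ = 4 * ω := by field_simp

/-- The pair kernel of `q` acts only within distance `2 N`. -/
theorem couple_eq_zero (hP : IsLatticeKernel N (N + N) Q (comp q)) {v : (Fin d → ℤ) → Fin S → ℝ}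
    {x : Fin d → ℤ} (h : ∀ y, dist x y ≤ ((N + N : ℕ) : ℝ) → v y = 0) (s : Fin S) :
    couple (comp q) v x s = 0 := by
  have : ∀ s', avg (comp q) (fun y => v y s') x = 0 := by
    intro s'
    rw [hP.avg_eq_sum _ (subset_refl _)]
    refine Finset.sum_eq_zero fun y hy => ?_
    rw [h y (mem_box_iff.mp hy)]; simp
  simp [couple, this, offSum]

/-- The weighted `ℓ²` estimate for the deviation of a minimizer from `u`: the deviation is
driven by the boundary condition alone, hence only by sites at distance of order `N` from the
boundary. -/
theorem weighted_deviation_le (hq : IsLatticeKernel N N Q q) (hd : 0 < d) (hβ : 0 < β)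
    (hN : 0 < N) (hL : 0 < L) (hLN : L ≤ N) (hζ : 0 ≤ ζ) (hu : ∀ s, 0 < u s)
    (hT : IsBlockSet L (T : Set (Fin d → ℤ)))
    (hcrit : ∀ s, offSum u s - lam + (1 / β) * Real.log (u s) = 0) {κ A e ω G : ℝ} (hκ0 : 0 < κ)
    (hκ : ∀ v : Fin S → ℝ, κ * ∑ s, v s ^ 2 ≤ hessForm β u v)
    (hκu : ∀ s, κ ≤ 1 / (β * u s)) (hA : ∀ s, 1 / (β * u s) ≤ A) (he : 0 ≤ e)
    (heκ : κ / 2 ≤ κ - e * (A + S)) (hω : 0 < ω) (hωe : Real.exp (4 * ω) - 1 ≤ e)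
    (ht : t ∈ Set.Icc (0 : ℝ) 1)
    (hf : f ∈ latticePhase ζ L u (T : Set (Fin d → ℤ)))
    (hg : g ∈ latticePhase ζ L u (T : Set (Fin d → ℤ))ᶜ)
    (hmin : IsMinOn (latticeEnergy β lam t u (comp q) T g) (latticePhase ζ L u T) f)
    (hc : ∀ x ∈ T, ∀ s, |Real.log (f x s) - Real.log (u s)| ≤ e)
    (hG : ∀ x s, |couple (comp q) (deviation u (T : Set (Fin d → ℤ))ᶜ g) x s| ≤ G)
    {x₀ : Fin d → ℤ} {r : ℝ} (hr : ∀ y, y ∉ T → r ≤ dist y x₀) :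
    ∑ x ∈ T, ∑ s, (blockWeight ω N L x₀ x * deviation u T f x s) ^ 2 ≤
      (2 / κ) ^ 2 * (S * (G ^ 2 * (Real.exp (4 * ω) * Real.exp (-(ω / N * r))
        * ((2 + 2 * d / ω) * N) ^ d))) := by
  have hP := hq.comp_self
  have hN' : (0 : ℝ) < N := by exact_mod_cast hN
  have hLN' : (L : ℝ) ≤ N := by exact_mod_cast hLN
  have hpos := latticeMinimizer_pos hP hβ hL hζ hu hT hf hmin
  set w := blockWeight ω N L x₀ with hw
  have hw0 : ∀ x, 0 < w x := blockWeight_pos ω x₀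
  set h := deviation u (T : Set (Fin d → ℤ)) f with hh
  set g' := deviation u (T : Set (Fin d → ℤ))ᶜ g with hg'
  have hT0 : ∀ x, x ∉ T → h x = 0 := fun x hx => by
    funext s; exact deviation_of_notMem (by simpa using hx) s
  have hhT : ∀ x ∈ T, ∀ s, h x s = f x s - u s := fun x hx s =>
    deviation_of_mem (by simpa using hx) s
  -- moving `f` towards `u` with strength `w ^ 2`
  have hvar := first_variation hP hβ hL hcrit hf hmin hpos
    (latticePhase_convex hf (const_mem_latticePhase hT hL hζ hu) (w := fun x => w x ^ 2)
      (fun x => ⟨sq_nonneg _, pow_le_one₀ (hw0 x).le (blockWeight_le_one hω.le x₀ x)⟩)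
      (fun b x hx y hy => by
        simp only [hw, blockWeight, (mem_block_iff hL).mp hx, (mem_block_iff hL).mp hy]) hL)
  have hco := weighted_coercive hq hκ hκu hA he ht (T := T) (v := h)
    (l := fun x s => (1 / β) * (Real.log (f x s) - Real.log (u s))) hT0 hw0
    (fun x y hxy => (blockWeight_ratio hN hL hLN hω.le x₀ x y hxy).trans hωe)
    (fun x hx s => by
      rw [hhT x hx s]
      exact mul_log_sub_log_ge (hpos x hx s) (hu s) (hu s) hβ (hc x hx s) (by simpa using he))
  -- the boundary condition acts only at sites within `2 N` of the complement of `T`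
  set b : (Fin d → ℤ) → ℝ := fun x => if r - 2 * N ≤ dist x x₀ then w x * G else 0 with hb
  have hcouple : ∀ x ∈ T, ∀ s, w x * |couple (comp q) g' x s| ≤ b x := by
    intro x _ s
    simp only [hb]
    split_ifs with hx
    · exact mul_le_mul_of_nonneg_left (hG x s) (hw0 x).le
    · rw [couple_eq_zero hP, abs_zero, mul_zero]
      intro y hy
      funext s'
      refine deviation_of_notMem ?_ s'
      by_contra hyT
      have h1 := hr y (by simpa using hyT)
      have h2 := dist_triangle y x x₀
      rw [dist_comm y x] at h2
      push_cast at hy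
      linarith
  set X := ∑ x ∈ T, ∑ s, (w x * h x s) ^ 2 with hX
  have hX0 : 0 ≤ X := Finset.sum_nonneg fun _ _ => Finset.sum_nonneg fun _ _ => sq_nonneg _
  have hle : κ / 2 * X ≤ ∑ p ∈ T ×ˢ (Finset.univ : Finset (Fin S)), |w p.1 * h p.1 p.2| * b p.1 := by
    refine (mul_le_mul_of_nonneg_right heκ hX0).trans (hco.trans ?_)
    rw [Finset.sum_product]
    have : ∑ x ∈ T, ∑ s, w x ^ 2 * h x s * (t * couple (comp q) h x s +
        1 / β * (Real.log (f x s) - Real.log (u s))) ≤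
        ∑ x ∈ T, ∑ s, -(w x ^ 2 * h x s * (t * couple (comp q) g' x s)) := by
      rw [← sub_nonneg, ← Finset.sum_sub_distrib]
      refine hvar.trans (le_of_eq (Finset.sum_congr rfl fun x hx => ?_))
      rw [← Finset.sum_sub_distrib]
      refine Finset.sum_congr rfl fun s _ => ?_
      rw [excess_eq hP hf hg, hhT x hx s, if_pos hx]
      ring
    refine this.trans (Finset.sum_le_sum fun x hx => Finset.sum_le_sum fun s _ => ?_)
    refine (neg_le_abs _).trans ?_
    have e1 : |w x ^ 2 * h x s * (t * couple (comp q) g' x s)| =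
        t * (|w x * h x s| * (w x * |couple (comp q) g' x s|)) := by
      rw [abs_mul, abs_mul, abs_mul, abs_mul, abs_of_nonneg ht.1, abs_of_pos (hw0 x),
        abs_of_nonneg (sq_nonneg (w x))]
      ring
    rw [e1]
    have h1 : |w x * h x s| * (w x * |couple (comp q) g' x s|) ≤ |w x * h x s| * b x :=
      mul_le_mul_of_nonneg_left (hcouple x hx s) (abs_nonneg _)
    have h2 : 0 ≤ |w x * h x s| * (w x * |couple (comp q) g' x s|) :=
      mul_nonneg (abs_nonneg _) (mul_nonneg (hw0 x).le (abs_nonneg _))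
    exact (mul_le_of_le_one_left h2 ht.2).trans h1
  have hcs := Finset.sum_mul_sq_le_sq_mul_sq (T ×ˢ (Finset.univ : Finset (Fin S)))
    (fun p => |w p.1 * h p.1 p.2|) (fun p => b p.1)
  have hXp : ∑ p ∈ T ×ˢ (Finset.univ : Finset (Fin S)), |w p.1 * h p.1 p.2| ^ 2 = X := by
    rw [Finset.sum_product]
    simp only [sq_abs, hX]
  have hBp : ∑ p ∈ T ×ˢ (Finset.univ : Finset (Fin S)), b p.1 ^ 2 ≤
      S * (G ^ 2 * (Real.exp (4 * ω) * Real.exp (-(ω / N * r)) * ((2 + 2 * d / ω) * N) ^ d)) := by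
    rw [Finset.sum_product]
    simp only [Finset.sum_const, Finset.card_univ, Fintype.card_fin, nsmul_eq_mul]
    rw [← Finset.mul_sum]
    refine mul_le_mul_of_nonneg_left ?_ (Nat.cast_nonneg S)
    -- one factor of the weight supplies the decay in `r`, the other one summability
    have hterm : ∀ x ∈ T, b x ^ 2 ≤ G ^ 2 * (Real.exp (4 * ω) * Real.exp (-(ω / N * r)) *
        Real.exp (-(ω / N * dist x x₀))) := by
      intro x _
      simp only [hb]
      split_ifs with hx
      · have h2 := dist_corner_le hL x
        have w1 : w x ≤ Real.exp (3 * ω) * Real.exp (-(ω / N * r)) := by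
          rw [← Real.exp_add]
          refine Real.exp_le_exp.mpr ?_
          have h3 : r - 3 * N ≤ dist (corner L (blk L x)) x₀ := by
            have := dist_triangle x (corner L (blk L x)) x₀
            rw [dist_comm x (corner L (blk L x))] at this
            linarith
          have h4 : ω / N * (r - 3 * N) ≤ ω / N * dist (corner L (blk L x)) x₀ := by gcongr
          have h5 : ω / N * (r - 3 * N) = ω / N * r - 3 * ω := by field_simp
          linarith
        have w2 : w x ≤ Real.exp ω * Real.exp (-(ω / N * dist x x₀)) := by
          rw [← Real.exp_add]
          refine Real.exp_le_exp.mpr ?_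
          have h3 : dist x x₀ - N ≤ dist (corner L (blk L x)) x₀ := by
            have := dist_triangle x (corner L (blk L x)) x₀
            rw [dist_comm x (corner L (blk L x))] at this
            linarith
          have h4 : ω / N * (dist x x₀ - N) ≤ ω / N * dist (corner L (blk L x)) x₀ := by gcongr
          have h5 : ω / N * (dist x x₀ - N) = ω / N * dist x x₀ - ω := by field_simp
          linarith
        have e4 : Real.exp (4 * ω) = Real.exp (3 * ω) * Real.exp ω := by
          rw [← Real.exp_add]; congr 1; ring
        calc (w x * G) ^ 2 = G ^ 2 * (w x * w x) := by ring
          _ ≤ G ^ 2 * ((Real.exp (3 * ω) * Real.exp (-(ω / N * r))) *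
              (Real.exp ω * Real.exp (-(ω / N * dist x x₀)))) :=
            mul_le_mul_of_nonneg_left (mul_le_mul w1 w2 (hw0 x).le (by positivity)) (sq_nonneg G)
          _ = _ := by rw [e4]; ring
      · rw [zero_pow two_ne_zero]; positivity
    refine (Finset.sum_le_sum hterm).trans ?_
    rw [← Finset.mul_sum, ← Finset.mul_sum]
    have := sum_exp_dist_le hd hN hω T x₀
    gcongr
  rw [hXp] at hcs
  have hsq : (κ / 2 * X) ^ 2 ≤ X * (S * (G ^ 2 * (Real.exp (4 * ω) * Real.exp (-(ω / N * r))
        * ((2 + 2 * d / ω) * N) ^ d))) :=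
    (pow_le_pow_left₀ (by positivity) hle 2).trans
      (hcs.trans (mul_le_mul_of_nonneg_left hBp hX0))
  rcases hX0.eq_or_lt with h0 | h0
  · rw [← h0]; positivity
  · have h1 : (κ / 2) ^ 2 * X ≤ S * (G ^ 2 * (Real.exp (4 * ω) * Real.exp (-(ω / N * r))
        * ((2 + 2 * d / ω) * N) ^ d)) := by
      refine le_of_mul_le_mul_left ?_ h0
      linarith [hsq, show (κ / 2 * X) ^ 2 = X * ((κ / 2) ^ 2 * X) by ring]
    have h2 := mul_le_mul_of_nonneg_left h1 (show 0 ≤ (2 / κ) ^ 2 by positivity)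
    have e2 : (2 / κ) ^ 2 * ((κ / 2) ^ 2 * X) = X := by field_simp
    rwa [e2] at h2

end Lattice

section Lattice

variable {d S N L : ℕ} {Q β lam t ζ : ℝ} {u : Fin S → ℝ}
  {q : (Fin d → ℤ) → (Fin d → ℤ) → ℝ} {T : Finset (Fin d → ℤ)}
  {f g : (Fin d → ℤ) → Fin S → ℝ}

/-- From the weighted `ℓ²` bound to a pointwise bound on the potential near `x₀`. The factor
`N ^ d` in the `ℓ²` bound cancels against the size `N ^ (-d)` of the kernel. -/
theorem abs_avg_le_of_weighted (hq : IsLatticeKernel N N Q q) (hN : 0 < N) (hL : 0 < L)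
    (hLN : L ≤ N) {ω B ε : ℝ} (hω : 0 < ω) (hε : 0 ≤ ε) {h : (Fin d → ℤ) → Fin S → ℝ}
    (hT0 : ∀ x, x ∉ T → h x = 0) {x₀ : Fin d → ℤ}
    (hX : ∑ x ∈ T, ∑ s, (blockWeight ω N L x₀ x * h x s) ^ 2 ≤ B * ε ^ 2 * (N : ℝ) ^ d)
    {x : Fin d → ℤ} (hx : dist x x₀ ≤ N) (s : Fin S) :
    |avg (comp q) (fun y => h y s) x| ≤ √(Q * (Real.exp (8 * ω) * B)) * ε := by
  classical
  have hP := hq.comp_self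
  have hN' : (0 : ℝ) < N := by exact_mod_cast hN
  have hLN' : (L : ℝ) ≤ N := by exact_mod_cast hLN
  have hQ := hq.const_nonneg
  set w := blockWeight ω N L x₀ with hw
  have hw0 : ∀ x, 0 < w x := blockWeight_pos ω x₀
  have hP2 : ∑ y ∈ box x (N + N), comp q x y ^ 2 ≤ Q / (N : ℝ) ^ d := by
    calc ∑ y ∈ box x (N + N), comp q x y ^ 2
        ≤ ∑ y ∈ box x (N + N), Q / (N : ℝ) ^ d * comp q x y :=
          Finset.sum_le_sum fun y _ => by
            rw [sq]; exact mul_le_mul_of_nonneg_right (hP.bound _ _) (hP.nonneg _ _)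
      _ = Q / (N : ℝ) ^ d := by rw [← Finset.mul_sum, hP.sum_box, mul_one]
  have hh2 : ∑ y ∈ box x (N + N), h y s ^ 2 ≤ Real.exp (8 * ω) * (B * ε ^ 2 * (N : ℝ) ^ d) := by
    have h1 : ∀ y ∈ box x (N + N), h y s ^ 2 ≤ Real.exp (8 * ω) * (w y * h y s) ^ 2 := by
      intro y hy
      rw [mem_box_iff] at hy
      have h2 := dist_corner_le hL y
      have h3 : dist (corner L (blk L y)) x₀ ≤ 4 * N := by
        have t1 := dist_triangle (corner L (blk L y)) y x₀
        have t2 := dist_triangle y x x₀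
        rw [dist_comm y x] at t2
        push_cast at hy
        linarith
      have h4 : Real.exp (-(4 * ω)) ≤ w y := by
        refine Real.exp_le_exp.mpr (neg_le_neg ?_)
        calc ω / N * dist (corner L (blk L y)) x₀ ≤ ω / N * (4 * N) := by gcongr
          _ = 4 * ω := by field_simp
      have h5 : 1 ≤ Real.exp (8 * ω) * w y ^ 2 := by
        calc (1 : ℝ) = Real.exp (8 * ω) * Real.exp (-(4 * ω)) ^ 2 := by
              rw [sq, ← Real.exp_add, ← Real.exp_add]; ring_nf; rw [Real.exp_zero]
          _ ≤ _ := by gcongr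
      have := mul_le_mul_of_nonneg_right h5 (sq_nonneg (h y s))
      rw [mul_pow, ← mul_assoc]
      linarith
    refine (Finset.sum_le_sum h1).trans ?_
    rw [← Finset.mul_sum]
    refine mul_le_mul_of_nonneg_left (le_trans ?_ hX) (Real.exp_pos _).le
    calc ∑ y ∈ box x (N + N), (w y * h y s) ^ 2
        ≤ ∑ y ∈ box x (N + N) ∪ T, (w y * h y s) ^ 2 :=
          Finset.sum_le_sum_of_subset_of_nonneg Finset.subset_union_left fun _ _ _ => sq_nonneg _
      _ = ∑ y ∈ T, (w y * h y s) ^ 2 :=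
          (Finset.sum_subset Finset.subset_union_right fun y _ hy => by
            rw [hT0 y hy]; simp).symm
      _ ≤ ∑ y ∈ T, ∑ s, (w y * h y s) ^ 2 := Finset.sum_le_sum fun y _ =>
          Finset.single_le_sum (f := fun s => (w y * h y s) ^ 2) (fun _ _ => sq_nonneg _)
            (Finset.mem_univ s)
  have hcs := Finset.sum_mul_sq_le_sq_mul_sq (box x (N + N)) (fun y => comp q x y)
    (fun y => h y s)
  rw [← hP.avg_eq_sum (fun y => h y s) (subset_refl _)] at hcs
  have hsq : avg (comp q) (fun y => h y s) x ^ 2 ≤ Q * (Real.exp (8 * ω) * B) * ε ^ 2 := by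
    refine hcs.trans ((mul_le_mul hP2 hh2 (Finset.sum_nonneg fun _ _ => sq_nonneg _)
      (by positivity)).trans (le_of_eq ?_))
    field_simp
  have := Real.abs_le_sqrt hsq
  rwa [Real.sqrt_mul' _ (sq_nonneg ε), Real.sqrt_sq hε] at this

theorem abs_sub_le_of_log {a c e U : ℝ} (ha : 0 < a) (hc : 0 < c) (hU : c ≤ U)
    (h1 : |Real.log a - Real.log c| ≤ 1) (h : |Real.log a - Real.log c| ≤ e) :
    |a - c| ≤ U * (2 * e) := by
  have e1 : a - c = c * (Real.exp (Real.log a - Real.log c) - 1) := by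
    rw [Real.exp_sub, Real.exp_log ha, Real.exp_log hc]; field_simp
  rw [e1, abs_mul, abs_of_pos hc]
  have h2 := Real.abs_exp_sub_one_le h1
  exact mul_le_mul hU (h2.trans (by linarith)) (abs_nonneg _) (hc.le.trans hU)

/-- Unique solvability of the lattice problem, and exponential decay of the deviation from `u` on
the scale `N`. The constants depend on `u` only through bounds. -/
theorem lattice_minimizer_decay (hd : 0 < d) (hβ : 0 < β) (lam : ℝ) {Q κ A U : ℝ} (hQ : 0 ≤ Q)
    (hκ0 : 0 < κ) (hA0 : 0 < A) (hU0 : 0 < U) :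
    ∃ ε₀ C ω : ℝ, 0 < ε₀ ∧ 0 < C ∧ 0 < ω ∧
      ∀ u : Fin S → ℝ, (∀ s, 0 < u s) → (∀ s, u s ≤ U) →
      (∀ s, offSum u s - lam + (1 / β) * Real.log (u s) = 0) →
      (∀ v : Fin S → ℝ, κ * ∑ s, v s ^ 2 ≤ hessForm β u v) →
      (∀ s, κ ≤ 1 / (β * u s)) → (∀ s, 1 / (β * u s) ≤ A) →
      ∀ (N L : ℕ) (ζ : ℝ), 0 < N → 0 < L → L ≤ N → (L : ℝ) / N ≤ ε₀ → 0 ≤ ζ → ζ ≤ ε₀ →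
      ∀ q : (Fin d → ℤ) → (Fin d → ℤ) → ℝ, IsLatticeKernel N N Q q →
      ∀ T : Finset (Fin d → ℤ), IsBlockSet L (T : Set (Fin d → ℤ)) →
      ∀ g ∈ latticePhase ζ L u (T : Set (Fin d → ℤ))ᶜ, ∀ t ∈ Set.Icc (0 : ℝ) 1,
        (∃! f : (Fin d → ℤ) → Fin S → ℝ, f ∈ latticePhase ζ L u (T : Set (Fin d → ℤ)) ∧
          IsMinOn (latticeEnergy β lam t u (comp q) T g) (latticePhase ζ L u T) f) ∧
        ∀ f ∈ latticePhase ζ L u (T : Set (Fin d → ℤ)),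
          IsMinOn (latticeEnergy β lam t u (comp q) T g) (latticePhase ζ L u T) f →
          ∀ x₀ ∈ T, ∀ r : ℝ, (∀ y, y ∉ T → r ≤ dist y x₀) → ∀ s,
            |f x₀ s - u s| ≤ C * Real.exp (-(ω / N * r)) := by
  -- `e` bounds the deviation of `log f` and the relative variation of the weight over the range of
  -- the interaction; it leaves half of the coercivity constant `κ`
  set e := min 1 (κ / (2 * (A + S))) with he
  have he0 : 0 < e := lt_min one_pos (by positivity)
  have he1 : e ≤ 1 := min_le_left _ _
  have heκ : κ / 2 ≤ κ - e * (A + S) := by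
    have : e * (A + S) ≤ κ / (2 * (A + S)) * (A + S) :=
      mul_le_mul_of_nonneg_right (min_le_right _ _) (by positivity)
    have e2 : κ / (2 * (A + S)) * (A + S) = κ / 2 := by field_simp
    linarith
  set ω := Real.log (1 + e) / 4 with hω
  have hω0 : 0 < ω := div_pos (Real.log_pos (by linarith)) (by norm_num)
  have hωe : Real.exp (4 * ω) - 1 ≤ e := by
    rw [hω, mul_div_cancel₀ _ (by norm_num), Real.exp_log (by linarith)]; linarith
  set V := Q * 7 ^ d * (2 * U + 2) with hV
  have hV0 : 0 ≤ V := by positivity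
  set ε₀ := min 1 (e / (6 * β * S * V + 1)) with hε₀
  have hε0 : 0 < ε₀ := lt_min one_pos (by positivity)
  set G := S * V with hG
  have hG0 : 0 ≤ G := by positivity
  set B := (2 / κ) ^ 2 * (S * (G ^ 2 * (Real.exp (4 * ω) * (2 + 2 * d / ω) ^ d))) with hB
  set M₁ := S * √(Q * (Real.exp (8 * ω) * B)) with hM₁
  have hM10 : 0 ≤ M₁ := by positivity
  set C := U * (2 * (3 * β * (M₁ + G * Real.exp (2 * ω)))) + 1 with hC
  refine ⟨ε₀, C, ω / 2, hε0, by positivity, by positivity, ?_⟩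
  intro u hu hU hcrit hκ hκu hA N L ζ hN hL hLN hLε hζ hζε q hq T hT g hg t ht
  have hP := hq.comp_self
  have hN' : (0 : ℝ) < N := by exact_mod_cast hN
  have hLN' : (L : ℝ) ≤ N := by exact_mod_cast hLN
  have hζ1 : ζ ≤ 1 := hζε.trans (min_le_left _ _)
  have hsmall : Q * 7 ^ d * (ζ + (2 * U + 1) * (L / N)) ≤ V * ε₀ := by
    rw [hV, mul_assoc (Q * 7 ^ d)]
    refine mul_le_mul_of_nonneg_left ?_ (by positivity)
    nlinarith
  -- every minimizer is uniformly close to `u`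
  have hclose : ∀ f ∈ latticePhase ζ L u (T : Set (Fin d → ℤ)),
      IsMinOn (latticeEnergy β lam t u (comp q) T g) (latticePhase ζ L u T) f →
      ∀ x ∈ T, ∀ s, |Real.log (f x s) - Real.log (u s)| ≤ e := by
    intro f hf hmin x hx s
    refine (abs_log_sub_log_le hP hβ hL hζ hu hT hcrit hf hmin hx fun z _ =>
      abs_excess_le hP (by omega) hL hLN hζ hζ1 hu hU ht hT hf hg z s).trans ?_
    have h1 : 3 * β * (2 * (S * (Q * 7 ^ d * (ζ + (2 * U + 1) * (L / N))))) ≤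
        3 * β * (2 * (S * (V * ε₀))) := by gcongr
    refine h1.trans ?_
    have h2 : ε₀ * (6 * β * S * V + 1) ≤ e := by
      rw [← le_div_iff₀ (by positivity)]; exact min_le_right _ _
    nlinarith
  refine ⟨?_, ?_⟩
  · obtain ⟨f, hf, hmin⟩ := exists_latticeMinimizer (β := β) (lam := lam) (t := t) (g := g)
      hP hL hζ hu hT
    exact ⟨f, ⟨hf, hmin⟩, fun f' hf' => latticeMinimizer_unique hq hβ hL hζ hu hT hcrit hκ hκu hA
      he0.le (by linarith) ht hf'.1 hf'.2 hf hmin (hclose f' hf'.1 hf'.2) (hclose f hf hmin)⟩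
  · intro f hf hmin x₀ hx₀ r hr s
    have hGb : ∀ x s, |couple (comp q) (deviation u (T : Set (Fin d → ℤ))ᶜ g) x s| ≤ G := by
      intro x s
      refine (abs_couple_le (abs_avg_deviation_le hP (by omega) hL hLN hζ hζ1 hu hU
        (isBlockSet_compl hT) hg x) s).trans ?_
      rw [hG]
      refine mul_le_mul_of_nonneg_left (hsmall.trans ?_) (Nat.cast_nonneg S)
      exact mul_le_of_le_one_right hV0 (min_le_left _ _)
    have hwd := weighted_deviation_le hq hd hβ hN hL hLN hζ hu hT hcrit hκ0 hκ hκu hA he0.le heκ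
      hω0 hωe ht hf hg hmin (hclose f hf hmin) hGb hr
    set ε := Real.exp (-(ω / 2 / N * r)) with hε
    have hεε : Real.exp (-(ω / N * r)) = ε ^ 2 := by
      rw [hε, sq, ← Real.exp_add]; congr 1; ring
    have hwd' : ∑ x ∈ T, ∑ s, (blockWeight ω N L x₀ x * deviation u T f x s) ^ 2 ≤
        B * ε ^ 2 * (N : ℝ) ^ d := by
      refine hwd.trans (le_of_eq ?_)
      rw [hεε, hB, mul_pow (2 + 2 * (d : ℝ) / ω) (N : ℝ)]; ring
    have hex : ∀ z ∈ block L (blk L x₀), |excess t u (comp q) g f z s| ≤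
        (M₁ + G * Real.exp (2 * ω)) * ε := by
      intro z hz
      have hzx : dist z x₀ ≤ N :=
        (dist_le_of_mem_block hz ((mem_block_iff hL).mpr rfl)).trans hLN'
      have h1 : |couple (comp q) (deviation u (T : Set (Fin d → ℤ)) f) z s| ≤ M₁ * ε := by
        rw [hM₁, mul_assoc]
        exact abs_couple_le (fun s => abs_avg_le_of_weighted hq hN hL hLN hω0 (Real.exp_pos _).le
          (fun x hx => by funext s; exact deviation_of_notMem (by simpa using hx) s) hwd' hzx s) s
      have h2 : |couple (comp q) (deviation u (T : Set (Fin d → ℤ))ᶜ g) z s| ≤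
          G * Real.exp (2 * ω) * ε := by
        -- near the boundary the claim is trivial, as `ε` is bounded below there
        by_cases hr4 : 4 * (N : ℝ) < r
        · rw [couple_eq_zero hP, abs_zero]
          · positivity
          · intro y hy
            funext s'
            refine deviation_of_notMem ?_ s'
            by_contra hyT
            have t1 := hr y (by simpa using hyT)
            have t2 := dist_triangle y z x₀
            rw [dist_comm y z] at t2
            push_cast at hy
            linarith
        · refine (hGb z s).trans ?_
          rw [mul_assoc, hε, ← Real.exp_add]
          refine le_mul_of_one_le_right hG0 (Real.one_le_exp ?_)
          have : ω / 2 / N * r ≤ ω / 2 / N * (4 * N) := by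
            have := not_lt.mp hr4
            gcongr
          have e3 : ω / 2 / N * (4 * N) = 2 * ω := by field_simp; norm_num
          linarith
      rw [excess_eq hP hf hg, ← mul_add, abs_mul, abs_of_nonneg ht.1]
      refine (mul_le_of_le_one_left (abs_nonneg _) ht.2).trans ((abs_add_le _ _).trans ?_)
      linarith
    have hlog := abs_log_sub_log_le hP hβ hL hζ hu hT hcrit hf hmin hx₀ hex
    have hfpos := latticeMinimizer_pos hP hβ hL hζ hu hT hf hmin x₀ hx₀ s
    refine (abs_sub_le_of_log hfpos (hu s) (hU s) ((hclose f hf hmin x₀ hx₀ s).trans he1)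
      hlog).trans ?_
    rw [hC, add_mul _ (1 : ℝ), one_mul]
    have : 0 ≤ ε := (Real.exp_pos _).le
    linarith [show U * (2 * (3 * β * ((M₁ + G * Real.exp (2 * ω)) * ε))) =
      U * (2 * (3 * β * (M₁ + G * Real.exp (2 * ω)))) * ε by ring]

end Lattice

/-! ### Cubes in the continuum -/

section Cubes

variable {d : ℕ} {ℓ : ℝ}

/-- The index of the cube of side `ℓ` that contains `r`. -/
noncomputable def cellIndex (ℓ : ℝ) (r : Space d) : Fin d → ℤ := fun i => ⌊r i / ℓ⌋

theorem mem_cube_iff (hℓ : 0 < ℓ) {z : Fin d → ℤ} {r : Space d} :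
    r ∈ cube ℓ z ↔ cellIndex ℓ r = z := by
  unfold cube cellIndex
  rw [Set.mem_ofPred_eq, funext_iff]
  refine forall_congr' fun i => ?_
  rw [Int.floor_eq_iff, le_div_iff₀ hℓ, div_lt_iff₀ hℓ]
  constructor <;> rintro ⟨h1, h2⟩ <;> constructor <;> linarith

theorem mem_cube_cellIndex (hℓ : 0 < ℓ) (r : Space d) : r ∈ cube ℓ (cellIndex ℓ r) :=
  (mem_cube_iff hℓ).mpr rfl

theorem latticePoint_mem_cube (hℓ : 0 < ℓ) (z : Fin d → ℤ) : latticePoint ℓ z ∈ cube ℓ z := by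
  intro i
  simp only [latticePoint]
  constructor
  · exact le_rfl
  · linarith

theorem cube_eq_preimage (ℓ : ℝ) (z : Fin d → ℤ) :
    cube ℓ z = (MeasurableEquiv.toLp 2 (Fin d → ℝ)).symm ⁻¹'
      (Set.univ.pi fun i => Set.Ico (ℓ * (z i : ℝ)) (ℓ * (z i : ℝ) + ℓ)) := by
  ext r
  simp [cube, Set.mem_pi]

theorem measurableSet_cube (ℓ : ℝ) (z : Fin d → ℤ) : MeasurableSet (cube (d := d) ℓ z) := by
  rw [cube_eq_preimage]
  exact (MeasurableEquiv.measurable _) (MeasurableSet.univ_pi fun _ => measurableSet_Ico)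

theorem volume_cube (ℓ : ℝ) (z : Fin d → ℤ) :
    volume (cube (d := d) ℓ z) = ENNReal.ofReal ℓ ^ d := by
  rw [cube_eq_preimage, (EuclideanSpace.volume_preserving_symm_measurableEquiv_toLp
    (Fin d)).measure_preimage (MeasurableSet.univ_pi fun _ => measurableSet_Ico).nullMeasurableSet,
    Real.volume_pi_Ico]
  simp

theorem volume_cube_lt_top (ℓ : ℝ) (z : Fin d → ℤ) : volume (cube (d := d) ℓ z) < ⊤ := by
  rw [volume_cube]; exact ENNReal.pow_lt_top ENNReal.ofReal_lt_top

theorem volume_real_cube (hℓ : 0 < ℓ) (z : Fin d → ℤ) :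
    volume.real (cube (d := d) ℓ z) = ℓ ^ d := by
  rw [Measure.real, volume_cube, ENNReal.toReal_pow, ENNReal.toReal_ofReal hℓ.le]

theorem disjoint_cube (hℓ : 0 < ℓ) {z z' : Fin d → ℤ} (h : z ≠ z') :
    Disjoint (cube (d := d) ℓ z) (cube ℓ z') :=
  Set.disjoint_left.mpr fun r hr hr' => h (by
    rw [← (mem_cube_iff hℓ).mp hr, ← (mem_cube_iff hℓ).mp hr'])

theorem norm_le_sqrt_mul {v : Space d} {m : ℝ} (hm : 0 ≤ m) (h : ∀ i, |v i| ≤ m) :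
    ‖v‖ ≤ √d * m := by
  rw [EuclideanSpace.norm_eq]
  have : √d * m = √(d * m ^ 2) := by
    rw [Real.sqrt_mul (Nat.cast_nonneg d), Real.sqrt_sq hm]
  rw [this]
  refine Real.sqrt_le_sqrt ?_
  calc ∑ i, ‖v i‖ ^ 2 ≤ ∑ _i : Fin d, m ^ 2 := Finset.sum_le_sum fun i _ => by
        have := h i
        rw [Real.norm_eq_abs]
        gcongr
    _ = d * m ^ 2 := by simp

theorem norm_sub_le_of_mem_cube (hℓ : 0 < ℓ) {x y : Fin d → ℤ} {r r' : Space d}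
    (hr : r ∈ cube ℓ x) (hr' : r' ∈ cube ℓ y) : ‖r - r'‖ ≤ √d * (ℓ * (dist x y + 1)) := by
  have hd := dist_nonneg (x := x) (y := y)
  refine norm_le_sqrt_mul (by positivity) fun i => ?_
  have h1 := hr i
  have h2 := hr' i
  have h3 : |(x i : ℝ) - y i| ≤ dist x y := by
    have := dist_le_pi_dist x y i
    rwa [Int.dist_eq] at this
  have h4 := abs_le.mp h3
  rw [PiLp.sub_apply, abs_le]
  have h5 : ℓ * (-dist x y) ≤ ℓ * ((x i : ℝ) - y i) := mul_le_mul_of_nonneg_left h4.1 hℓ.le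
  have h6 : ℓ * ((x i : ℝ) - y i) ≤ ℓ * dist x y := mul_le_mul_of_nonneg_left h4.2 hℓ.le
  constructor <;> nlinarith

theorem cellIndex_mul {N : ℝ} (L : ℕ) (r : Space d) :
    cellIndex (N * L) r = blk L (cellIndex N r) := by
  funext i
  simp only [cellIndex, blk]
  rw [← div_div, Int.floor_div_natCast]

theorem cube_mul_eq_iUnion {N : ℝ} (hN : 0 < N) {L : ℕ} (hL : 0 < L) (b : Fin d → ℤ) :
    cube (N * L) b = ⋃ z ∈ block L b, cube N z := by
  have hL' : (0 : ℝ) < L := by exact_mod_cast hL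
  ext r
  rw [mem_cube_iff (by positivity), cellIndex_mul, ← mem_block_iff hL]
  simp only [Set.mem_iUnion, mem_cube_iff hN, exists_prop, exists_eq_right']

/-- Averages of a cell function over a large cube are averages over a block of the lattice. -/
theorem average_cube_eq {N : ℝ} (hN : 0 < N) {L : ℕ} (hL : 0 < L) (b : Fin d → ℤ)
    {F : Space d → ℝ} (hF : ∀ z, ∀ r ∈ cube N z, F r = F (latticePoint N z)) :
    (⨍ x in cube (N * L) b, F x) = (∑ z ∈ block L b, F (latticePoint N z)) / (L : ℝ) ^ d := by
  have hL' : (0 : ℝ) < L := by exact_mod_cast hL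
  have hint : ∀ z ∈ block L b, IntegrableOn F (cube N z) := fun z _ =>
    (integrableOn_const (C := F (latticePoint N z)) (volume_cube_lt_top N z).ne).congr_fun
      (fun r hr => (hF z r hr).symm) (measurableSet_cube N z)
  rw [setAverage_eq, volume_real_cube (by positivity), cube_mul_eq_iUnion hN hL,
    integral_biUnion_finset _ (fun z _ => measurableSet_cube N z)
      (fun z _ z' _ h => disjoint_cube hN h) hint]
  have : ∀ z ∈ block L b, ∫ r in cube N z, F r = N ^ d * F (latticePoint N z) := by
    intro z _
    rw [setIntegral_congr_fun (measurableSet_cube N z) (hF z), setIntegral_const,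
      volume_real_cube hN, smul_eq_mul]
  rw [Finset.sum_congr rfl this, ← Finset.mul_sum, smul_eq_mul, mul_pow]
  field_simp

end Cubes

/-! ### The averaged Kac kernel -/

section Kernel

variable {d : ℕ} {J : Space d → Space d → ℝ}

theorem IsKacKernel.eq_zero_sub (hJ : IsKacKernel J) (r r' : Space d) : J r r' = J 0 (r' - r) := by
  have := hJ.translation (-r) r r'
  rw [add_neg_cancel, ← sub_eq_add_neg] at this
  exact this.symm

theorem IsKacKernel.continuous (hJ : IsKacKernel J) :
    Continuous fun p : Space d × Space d => J p.1 p.2 := hJ.smooth.continuous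

theorem IsKacKernel.exists_bounds (hJ : IsKacKernel J) :
    ∃ B Λ : ℝ, 0 ≤ B ∧ 0 ≤ Λ ∧ (∀ r r', |J r r'| ≤ B) ∧
      ∀ r a b, |J r a - J r b| ≤ Λ * ‖a - b‖ := by
  have hsm : ContDiff ℝ ((⊤ : ℕ∞) : WithTop ℕ∞) (fun v : Space d => J 0 v) :=
    hJ.smooth.comp (contDiff_const.prodMk contDiff_id)
  have hcs : HasCompactSupport (fun v : Space d => J 0 v) := by
    refine HasCompactSupport.of_support_subset_isCompact (isCompact_closedBall (0 : Space d) 1)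
      fun v hv => ?_
    rw [mem_closedBall_zero_iff]
    by_contra hcon
    refine hv (hJ.range_one 0 v ?_)
    rw [zero_sub, norm_neg]
    exact (not_le.mp hcon).le
  obtain ⟨B, hB⟩ := hcs.exists_bound_of_continuous hsm.continuous
  obtain ⟨C, hC⟩ := hsm.lipschitzWith_of_hasCompactSupport hcs (by simp)
  refine ⟨B, C, (norm_nonneg _).trans (hB 0), C.2, fun r r' => ?_, fun r a b => ?_⟩
  · rw [hJ.eq_zero_sub]; exact hB _
  · rw [hJ.eq_zero_sub r a, hJ.eq_zero_sub r b]
    have := hC.dist_le_mul (a - r) (b - r)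
    rw [Real.dist_eq, dist_eq_norm, sub_sub_sub_cancel_right] at this
    exact this

theorem IsKacKernel.integral_scaledKernel (hJ : IsKacKernel J) {γ : ℝ} (hγ : 0 < γ)
    (r : Space d) : ∫ r', scaledKernel γ J r r' = 1 := by
  unfold scaledKernel
  rw [integral_const_mul, Measure.integral_comp_smul volume (fun r' => J (γ • r) r') γ,
    hJ.integral_eq_one, finrank_euclideanSpace, Fintype.card_fin, abs_of_pos (by positivity)]
  simp only [smul_eq_mul, mul_one]
  field_simp

/-- The kernel `J_γ`, averaged over cells of side `N = γ^(-1/2)`, as a stochastic kernel. -/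
theorem IsKacKernel.isLatticeKernel (hJ : IsKacKernel J) :
    ∃ Q : ℝ, 0 ≤ Q ∧ ∀ (γ : ℝ) (N : ℕ), 0 < N → γ * (N : ℝ) ^ 2 = 1 → mesh γ = N →
      cellVolume d γ = (N : ℝ) ^ d →
      IsLatticeKernel N N Q fun x y => cellVolume d γ * averagedKernel γ J x y := by
  obtain ⟨B, Λ, hB, hΛ, hJB, hJL⟩ := hJ.exists_bounds
  refine ⟨B + 3 * √d * Λ, by positivity, fun γ N hN hγN hmesh hcell => ?_⟩
  have hN' : (0 : ℝ) < N := by exact_mod_cast hN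
  have hγ : γ = ((N : ℝ) ^ 2)⁻¹ := by field_simp; exact hγN
  have hγ0 : 0 < γ := by rw [hγ]; positivity
  set K : Space d → Space d → ℝ := scaledKernel γ J with hK
  have hKcont : Continuous (Function.uncurry K) := by
    refine continuous_const.mul (hJ.continuous.comp (f := fun p : Space d × Space d =>
      (γ • p.1, γ • p.2)) (by fun_prop))
  have hKB : ∀ r r', |K r r'| ≤ γ ^ d * B := fun r r' => by
    simp only [hK, scaledKernel]
    rw [abs_mul, abs_of_pos (by positivity)]
    exact mul_le_mul_of_nonneg_left (hJB _ _) (by positivity)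
  have hKL : ∀ r a b, |K r a - K r b| ≤ γ ^ d * (Λ * (γ * ‖a - b‖)) := fun r a b => by
    simp only [hK, scaledKernel]
    rw [← mul_sub, abs_mul, abs_of_pos (show 0 < γ ^ d by positivity)]
    refine mul_le_mul_of_nonneg_left ((hJL _ _ _).trans (le_of_eq ?_)) (by positivity)
    rw [← smul_sub, norm_smul, Real.norm_eq_abs, abs_of_pos hγ0]
  have hKsymm : ∀ r r', K r r' = K r' r := fun r r' => by
    simp only [hK, scaledKernel]; rw [hJ.symm]
  have hK0 : ∀ r r', 0 ≤ K r r' := fun r r' => mul_nonneg (by positivity) (hJ.nonneg _ _)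
  have hKr : ∀ x y : Fin d → ℤ, (N : ℝ) < dist x y → ∀ r ∈ cube (N : ℝ) x, ∀ r' ∈ cube (N : ℝ) y,
      K r r' = 0 := by
    intro x y hxy r hr r' hr'
    obtain ⟨i, hi⟩ : ∃ i, (N : ℝ) < dist (x i) (y i) := by
      by_contra hcon
      push Not at hcon
      exact absurd ((dist_pi_le_iff hN'.le).mpr hcon) (not_le.mpr hxy)
    have hi' : ((N : ℤ) : ℝ) < ((|x i - y i| : ℤ) : ℝ) := by
      rw [Int.dist_eq] at hi; push_cast; exact hi
    have hi2 : (N : ℤ) + 1 ≤ |x i - y i| := by exact_mod_cast hi'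
    have hi3 : (N : ℝ) + 1 ≤ |(x i : ℝ) - y i| := by exact_mod_cast hi2
    have h1 := hr i
    have h2 := hr' i
    have h3 : (N : ℝ) ^ 2 ≤ |r i - r' i| := by
      rcases le_abs.mp hi3 with h | h
      · have := mul_le_mul_of_nonneg_left h hN'.le
        exact le_trans (by nlinarith) (le_abs_self _)
      · have := mul_le_mul_of_nonneg_left h hN'.le
        exact le_trans (by nlinarith) (neg_le_abs _)
    have h4 : |r i - r' i| ≤ ‖r - r'‖ := by
      have := PiLp.norm_apply_le (r - r') i
      rwa [PiLp.sub_apply, Real.norm_eq_abs] at this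
    simp only [hK, scaledKernel]
    rw [hJ.range_one, mul_zero]
    rw [← smul_sub, norm_smul, Real.norm_eq_abs, abs_of_pos hγ0, ← hγN]
    exact mul_le_mul_of_nonneg_left (h3.trans h4) hγ0.le
  have hvol : ∀ x : Fin d → ℤ, volume.real (cube (d := d) (N : ℝ) x) = (N : ℝ) ^ d :=
    fun x => volume_real_cube hN' x
  have hq : ∀ x y : Fin d → ℤ, cellVolume d γ * averagedKernel γ J x y =
      ((N : ℝ) ^ d)⁻¹ * ∫ r in cube (N : ℝ) x, ∫ r' in cube (N : ℝ) y, K r r' := by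
    intro x y
    unfold averagedKernel
    rw [hcell, hmesh, setAverage_eq, hvol]
    simp only [setAverage_eq, hvol, smul_eq_mul]
    rw [integral_const_mul, ← hK]
    field_simp
  have hfin : ∀ x : Fin d → ℤ, IsFiniteMeasure (volume.restrict (cube (d := d) (N : ℝ) x)) :=
    fun x => ⟨by rw [Measure.restrict_apply_univ]; exact volume_cube_lt_top _ x⟩
  have hint2 : ∀ x y : Fin d → ℤ, Integrable (Function.uncurry K)
      ((volume.restrict (cube (d := d) (N : ℝ) x)).prod (volume.restrict (cube (N : ℝ) y))) := by
    intro x y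
    have := hfin x
    have := hfin y
    exact Integrable.of_bound hKcont.aestronglyMeasurable (γ ^ d * B)
      (Filter.Eventually.of_forall fun p => hKB p.1 p.2)
  have hint1 : ∀ (r : Space d) (y : Fin d → ℤ), IntegrableOn (K r) (cube (N : ℝ) y) := by
    intro r y
    have := hfin y
    exact Integrable.of_bound
      (hKcont.comp (f := fun r' => (r, r')) (by fun_prop)).aestronglyMeasurable (γ ^ d * B)
      (Filter.Eventually.of_forall fun p => hKB r p)
  have hintI : ∀ x y : Fin d → ℤ, IntegrableOn (fun r => ∫ r' in cube (N : ℝ) y, K r r')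
      (cube (N : ℝ) x) := fun x y => by
    have := hfin x
    have := hfin y
    exact (hint2 x y).integral_prod_left
  have hγd : γ ^ d * (N : ℝ) ^ d = ((N : ℝ) ^ d)⁻¹ := by
    have : γ * N = (N : ℝ)⁻¹ := by rw [hγ]; field_simp
    rw [← mul_pow, this, inv_pow]
  refine ⟨by positivity, fun x y => ?_, fun x y => ?_, fun x y hxy => ?_, fun x => ?_,
    fun x y => ?_, fun x y y' => ?_⟩
  · rw [hq]
    exact mul_nonneg (by positivity) (integral_nonneg fun r => integral_nonneg fun r' => hK0 r r')
  · have := hfin x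
    have := hfin y
    rw [hq, hq, integral_integral_swap (hint2 x y)]
    simp only [hKsymm]
  · rw [hq, setIntegral_eq_zero_of_forall_eq_zero, mul_zero]
    exact fun r hr => setIntegral_eq_zero_of_forall_eq_zero fun r' hr' => hKr x y hxy r hr r' hr'
  · simp only [hq]
    rw [← Finset.mul_sum, ← integral_finsetSum _ fun y _ => hintI x y]
    have hone : ∀ r ∈ cube (N : ℝ) x, ∑ y ∈ box x N, ∫ r' in cube (N : ℝ) y, K r r' = 1 := by
      intro r hr
      rw [← integral_biUnion_finset _ (fun z _ => measurableSet_cube (N : ℝ) z)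
        (fun z _ z' _ h => disjoint_cube hN' h) (fun z _ => hint1 r z),
        setIntegral_eq_integral_of_forall_compl_eq_zero, hJ.integral_scaledKernel hγ0]
      intro r' hr'
      refine hKr x (cellIndex (N : ℝ) r') ?_ r hr r' (mem_cube_cellIndex hN' r')
      by_contra hcon
      refine hr' (Set.mem_biUnion (mem_box_iff.mpr (not_lt.mp hcon)) (mem_cube_cellIndex hN' r'))
    rw [setIntegral_congr_fun (measurableSet_cube _ x) hone, setIntegral_const, hvol]
    simp only [smul_eq_mul, mul_one]
    field_simp
  · rw [hq]
    have h1 : ∀ r, ‖∫ r' in cube (N : ℝ) y, K r r'‖ ≤ γ ^ d * B * (N : ℝ) ^ d := fun r => by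
      rw [← hvol y]
      exact norm_setIntegral_le_of_norm_le_const (volume_cube_lt_top _ y) fun r' _ => hKB r r'
    have h2 := norm_setIntegral_le_of_norm_le_const (volume_cube_lt_top (N : ℝ) x)
      (fun r _ => h1 r)
    rw [hvol x] at h2
    have h3 := (le_abs_self _).trans h2
    calc ((N : ℝ) ^ d)⁻¹ * ∫ r in cube (N : ℝ) x, ∫ r' in cube (N : ℝ) y, K r r'
        ≤ ((N : ℝ) ^ d)⁻¹ * (γ ^ d * B * (N : ℝ) ^ d * (N : ℝ) ^ d) :=
          mul_le_mul_of_nonneg_left h3 (by positivity)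
      _ = B * (γ ^ d * (N : ℝ) ^ d) := by field_simp
      _ = B / (N : ℝ) ^ d := by rw [hγd]; rfl
      _ ≤ _ := by gcongr; exact le_add_of_nonneg_right (by positivity)
  · by_cases hyy : y = y'
    · rw [hyy]; simp
    have hdist : 1 ≤ dist y y' := by
      obtain ⟨i, hi⟩ := Function.ne_iff.mp hyy
      refine le_trans ?_ (dist_le_pi_dist y y' i)
      rw [Int.dist_eq]
      have : 1 ≤ |y i - y' i| := Int.one_le_abs (sub_ne_zero.mpr hi)
      exact_mod_cast this
    have h1 : ∀ r (z : Fin d → ℤ), |(∫ r' in cube (N : ℝ) z, K r r')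
        - (N : ℝ) ^ d * K r (latticePoint N y)| ≤
        γ ^ d * (Λ * (γ * (√d * (N * (dist z y + 1))))) * (N : ℝ) ^ d := by
      intro r z
      have e : (∫ r' in cube (N : ℝ) z, K r r') - (N : ℝ) ^ d * K r (latticePoint N y) =
          ∫ r' in cube (N : ℝ) z, (K r r' - K r (latticePoint N y)) := by
        rw [integral_sub (hint1 r z) (integrableOn_const (volume_cube_lt_top _ z).ne),
          setIntegral_const, hvol, smul_eq_mul]
      rw [e, ← hvol z, ← Real.norm_eq_abs]
      refine norm_setIntegral_le_of_norm_le_const (volume_cube_lt_top _ z) fun r' hr' => ?_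
      rw [Real.norm_eq_abs]
      refine (hKL _ _ _).trans ?_
      have := norm_sub_le_of_mem_cube hN' hr' (latticePoint_mem_cube hN' y)
      gcongr
    have h2 : ∀ r, ‖(∫ r' in cube (N : ℝ) y, K r r') - ∫ r' in cube (N : ℝ) y', K r r'‖ ≤
        γ ^ d * (Λ * (γ * (√d * (N * (3 * dist y y'))))) * (N : ℝ) ^ d := by
      intro r
      have a1 := abs_le.mp (h1 r y)
      have a2 := abs_le.mp (h1 r y')
      have a3 : γ ^ d * (Λ * (γ * (√d * (N * (dist y y + 1))))) * (N : ℝ) ^ d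
          + γ ^ d * (Λ * (γ * (√d * (N * (dist y' y + 1))))) * (N : ℝ) ^ d ≤
          γ ^ d * (Λ * (γ * (√d * (N * (3 * dist y y'))))) * (N : ℝ) ^ d := by
        rw [dist_self, dist_comm y' y]
        have : γ ^ d * (Λ * (γ * (√d * (N * (0 + 1))))) * (N : ℝ) ^ d
          + γ ^ d * (Λ * (γ * (√d * (N * (dist y y' + 1))))) * (N : ℝ) ^ d =
          γ ^ d * (Λ * (γ * (√d * (N * (dist y y' + 2))))) * (N : ℝ) ^ d := by ring
        rw [this]
        gcongr
        linarith
      rw [Real.norm_eq_abs, abs_le]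
      constructor <;> linarith [a1.1, a1.2, a2.1, a2.2]
    have h3 := norm_setIntegral_le_of_norm_le_const (volume_cube_lt_top (N : ℝ) x)
      (fun r _ => h2 r)
    rw [integral_sub (hintI x y) (hintI x y'), hvol, Real.norm_eq_abs] at h3
    rw [hq, hq, ← mul_sub, abs_mul, abs_of_pos (show 0 < ((N : ℝ) ^ d)⁻¹ by positivity)]
    refine (mul_le_mul_of_nonneg_left h3 (by positivity)).trans ?_
    have hγN1 : γ * N = 1 / N := by rw [hγ]; field_simp
    calc ((N : ℝ) ^ d)⁻¹ * (γ ^ d * (Λ * (γ * (√d * (N * (3 * dist y y'))))) * (N : ℝ) ^ d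
          * (N : ℝ) ^ d)
        = 3 * √d * Λ * (γ ^ d * (N : ℝ) ^ d) * ((γ * N) * dist y y') := by field_simp
      _ = 3 * √d * Λ / (N : ℝ) ^ d * (dist y y' / N) := by
          rw [hγd, hγN1]; field_simp
      _ ≤ _ := by gcongr; exact le_add_of_nonneg_left hB

end Kernel

/-! ### From densities in the continuum to configurations on the lattice -/

section Transfer

variable {d S : ℕ} {a αm γ : ℝ} {u : Fin S → ℝ} {N L : ℕ} {J : Space d → Space d → ℝ}
  {A : Set (Space d)} {ρ ρbar : Space d → Fin S → ℝ}

/-- The sites whose lattice points are in `A`. -/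
def latticeSet (N : ℝ) (A : Set (Space d)) : Set (Fin d → ℤ) := {z | latticePoint N z ∈ A}

/-- `A` is a union of cubes of side `ℓ`. Unlike for `IsCubeSet`, it is manifest in this form that
the complement of `A` has the property as well. -/
def IsSaturated (ℓ : ℝ) (A : Set (Space d)) : Prop :=
  ∀ r r', cellIndex ℓ r = cellIndex ℓ r' → r ∈ A → r' ∈ A

theorem IsSaturated.compl {ℓ : ℝ} (h : IsSaturated ℓ A) : IsSaturated ℓ Aᶜ :=
  fun r r' hr hA hA' => hA (h r' r hr.symm hA')

theorem IsCubeSet.isSaturated {N : ℝ} {M : ℕ} (hN : 0 < N) (hM : 0 < M)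
    (h : IsCubeSet (N * M) A) : IsSaturated N A := by
  have hM' : (0 : ℝ) < M := by exact_mod_cast hM
  obtain ⟨I, rfl⟩ := h
  intro r r' hr hA
  simp only [Set.mem_iUnion, mem_cube_iff (show 0 < N * M by positivity), cellIndex_mul,
    exists_prop, exists_eq_right'] at hA ⊢
  rwa [← hr]

theorem cellIndex_latticePoint {ℓ : ℝ} (hℓ : 0 < ℓ) (z : Fin d → ℤ) :
    cellIndex ℓ (latticePoint ℓ z) = z :=
  (mem_cube_iff hℓ).mp (latticePoint_mem_cube hℓ z)

theorem IsSaturated.isBlockSet {N : ℝ} (hN : 0 < N) (h : IsSaturated (N * L) A) :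
    IsBlockSet L (latticeSet N A) := fun x y hxy hx => by
  refine h _ _ ?_ hx
  rw [cellIndex_mul, cellIndex_mul, cellIndex_latticePoint hN, cellIndex_latticePoint hN, hxy]

theorem IsSaturated.mem_iff {N : ℝ} (hN : 0 < N) (h : IsSaturated (N * L) A) (r : Space d) :
    cellIndex N r ∈ latticeSet N A ↔ r ∈ A := by
  have e : cellIndex (N * L) (latticePoint N (cellIndex N r)) = cellIndex (N * L) r := by
    rw [cellIndex_mul, cellIndex_mul, cellIndex_latticePoint hN]
  exact ⟨fun hr => h _ _ e hr, fun hr => h _ _ e.symm hr⟩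

theorem latticeSet_compl (N : ℝ) (A : Set (Space d)) : latticeSet N Aᶜ = (latticeSet N A)ᶜ := rfl

theorem finite_latticeSet {N : ℝ} (hN : 0 < N) (hA : Bornology.IsBounded A) :
    (latticeSet N A).Finite := by
  obtain ⟨R, hR⟩ := hA.exists_norm_le
  refine (Finset.finite_toSet (box (0 : Fin d → ℤ) ⌈R / N⌉₊)).subset fun z hz => ?_
  rw [Finset.mem_coe, mem_box_iff, dist_pi_le_iff (Nat.cast_nonneg _)]
  intro i
  refine le_trans ?_ (Nat.le_ceil _)
  have h1 := PiLp.norm_apply_le (latticePoint N z) i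
  have h2 := h1.trans (hR _ hz)
  simp only [latticePoint, Real.norm_eq_abs] at h2
  rw [abs_mul, abs_of_pos hN] at h2
  rw [le_div_iff₀ hN, Int.dist_eq, Pi.zero_apply, Int.cast_zero, zero_sub, abs_neg]
  linarith

/-- The cell function with given values on the lattice. -/
noncomputable def extend (N : ℝ) (f : (Fin d → ℤ) → Fin S → ℝ) (r : Space d) : Fin S → ℝ :=
  f (cellIndex N r)

theorem IsCubeFun.eq_extend (hN : 0 < mesh γ) (h : IsCubeFun (mesh γ) ρ) :
    ρ = extend (mesh γ) (onLattice γ ρ) := by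
  funext r
  exact h _ r (mem_cube_cellIndex hN r) _ (latticePoint_mem_cube hN _)

theorem onLattice_extend (hN : 0 < mesh γ) (f : (Fin d → ℤ) → Fin S → ℝ) :
    onLattice γ (extend (mesh γ) f) = f := by
  funext z s
  simp only [onLattice, extend, cellIndex_latticePoint hN]

/-- Cell functions in a phase correspond to lattice configurations in the phase. -/
theorem extend_mem_iff (hN : 0 < N) (hL : 0 < L) (hmesh : mesh γ = N)
    (hminus : scaleMinus αm γ = N * L) (hA : IsSaturated ((N : ℝ) * L) A)
    (f : (Fin d → ℤ) → Fin S → ℝ) :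
    extend (mesh γ) f ∈ phaseDensities a αm γ u A ↔
      f ∈ latticePhase (γ ^ a) L u (latticeSet N A) := by
  have hN' : (0 : ℝ) < N := by exact_mod_cast hN
  rw [hmesh]
  have hval : ∀ z, extend (N : ℝ) f (latticePoint N z) = f z := fun z => by
    simp only [extend, cellIndex_latticePoint hN']
  have hcell : ∀ z, ∀ r ∈ cube (N : ℝ) z, extend (N : ℝ) f r = f z := fun z r hr => by
    simp only [extend, (mem_cube_iff hN').mp hr]
  have havg : ∀ r s, (⨍ x in cubeOf (scaleMinus αm γ) r, extend (N : ℝ) f x s) =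
      (∑ z ∈ block L (blk L (cellIndex N r)), f z s) / (L : ℝ) ^ d := by
    intro r s
    rw [hminus]
    change (⨍ x in cube ((N : ℝ) * L) (cellIndex ((N : ℝ) * L) r), extend (N : ℝ) f x s) = _
    rw [average_cube_eq hN' hL (F := fun x => extend (N : ℝ) f x s) _
      (fun z r hr => by rw [hcell z r hr, hval]), cellIndex_mul]
    simp only [hval]
  constructor
  · rintro ⟨⟨h1, -, h3⟩, h4⟩
    refine ⟨fun z s => ?_, fun z hz => ?_, fun z hz s => ?_⟩
    · rw [← hval]; exact h1 _ _
    · rw [← hval]; exact h3 _ hz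
    · have := h4 _ hz s
      rwa [havg, cellIndex_latticePoint hN'] at this
  · rintro ⟨h1, h2, h3⟩
    refine ⟨⟨fun r s => h1 _ _, ?_, fun r hr => h2 _ ?_⟩, fun r hr s => ?_⟩
    · intro z r hr r' hr'
      rw [hmesh] at hr hr'
      rw [hcell z r hr, hcell z r' hr']
    · rwa [hA.mem_iff hN']
    · rw [havg]
      exact h3 _ ((hA.mem_iff hN' r).mpr hr) s

theorem onLattice_mem (hN : 0 < N) (hL : 0 < L) (hmesh : mesh γ = N)
    (hminus : scaleMinus αm γ = N * L) (hA : IsSaturated ((N : ℝ) * L) A)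
    (hρ : ρ ∈ phaseDensities a αm γ u A) :
    onLattice γ ρ ∈ latticePhase (γ ^ a) L u (latticeSet N A) := by
  have hN' : 0 < mesh γ := by rw [hmesh]; exact_mod_cast hN
  rw [← extend_mem_iff hN hL hmesh hminus hA, ← hρ.1.cubeFun.eq_extend hN']
  exact hρ

theorem pairKernel_eq (γ : ℝ) (J : Space d → Space d → ℝ) :
    pairKernel γ J = comp fun x y => cellVolume d γ * averagedKernel γ J x y := by
  funext x x'
  unfold pairKernel comp
  rw [← tsum_mul_left]
  exact tsum_congr fun y => by ring

theorem interaction_eq {P : (Fin d → ℤ) → (Fin d → ℤ) → ℝ} {R : ℕ} {Q : ℝ}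
    (hP : IsLatticeKernel N R Q P) (hJ : pairKernel γ J = P) (g : (Fin d → ℤ) → Fin S → ℝ)
    (x : Fin d → ℤ) (s : Fin S) : interaction γ J g x s = couple P g x s := by
  unfold interaction couple offSum
  rw [hJ, tsum_eq_sum (s := box x R), Finset.sum_comm]
  · refine Finset.sum_congr rfl fun s' _ => ?_
    dsimp only
    rw [hP.avg_eq_sum _ (subset_refl (box x R))]
    split_ifs
    · rfl
    · simp
  · intro y hy
    simp [hP.eq_zero hy]

theorem pairing_eq_sum {T : Finset (Fin d → ℤ)} {f g : (Fin d → ℤ) → Fin S → ℝ}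
    (hf : ∀ x, x ∉ T → f x = 0) : pairing f g = ∑ x ∈ T, ∑ s, f x s * g x s := by
  refine tsum_eq_sum fun x hx => ?_
  simp [hf x hx]

theorem interpolatedFreeEnergy_eq {P : (Fin d → ℤ) → (Fin d → ℤ) → ℝ} {R : ℕ} {Q : ℝ}
    (hP : IsLatticeKernel N R Q P) (hJ : pairKernel γ J = P) {β : ℝ} (hβ : 0 < β) (lam t : ℝ)
    {T : Finset (Fin d → ℤ)} (hT : (T : Set (Fin d → ℤ)) = latticeSet (mesh γ) A)
    (hρ : ∀ x, x ∉ T → onLattice γ ρ x = 0) :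
    interpolatedFreeEnergy β lam γ J u A t ρbar ρ =
      cellVolume d γ * latticeEnergy β lam t u P T (onLattice γ ρbar) (onLattice γ ρ) := by
  have hmem : ∀ x, x ∈ T ↔ latticePoint (mesh γ) x ∈ A := fun x => by
    rw [← Finset.mem_coe, hT]; rfl
  have hind : ∀ G : (Fin d → ℤ) → Fin S → ℝ,
      pairing (latticeIndicator γ A) G = ∑ x ∈ T, ∑ s, G x s := by
    intro G
    rw [pairing_eq_sum (T := T)]
    · refine Finset.sum_congr rfl fun x hx => Finset.sum_congr rfl fun s _ => ?_
      rw [latticeIndicator, Set.indicator_of_mem ((hmem x).mp hx), one_mul]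
    · intro x hx
      funext s
      rw [latticeIndicator, Set.indicator_of_notMem fun h => hx ((hmem x).mpr h)]
      rfl
  unfold interpolatedFreeEnergy freeEnergy oneBodyEnergy latticeEnergy
  rw [hind, hind, hind, pairing_eq_sum hρ, pairing_eq_sum hρ]
  simp only [interaction_eq hP hJ, offSum_eq', Finset.mul_sum, ← Finset.sum_add_distrib,
    ← Finset.sum_sub_distrib]
  refine Finset.sum_congr rfl fun x _ => Finset.sum_congr rfl fun s _ => ?_
  field_simp
  ring

end Transfer

/-! ### The scales -/

section Scales

variable {d : ℕ} {a αm αp γ : ℝ}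

/-- In terms of the integer `N = γ^(-1/2)`, the scales are `ℓ_- = N L` and `ℓ_+ = N L M` with
integers `L` and `M`, and `L / N = γ^αm`. -/
theorem exists_scales (hα : IsExponentChoice d a αm αp) (hγ : 0 < γ) (hγ1 : γ ≤ 1)
    (h : AreDyadicScales αm αp γ) :
    ∃ N L M : ℕ, 0 < N ∧ 0 < L ∧ 0 < M ∧ mesh γ = N ∧ γ * (N : ℝ) ^ 2 = 1 ∧
      cellVolume d γ = (N : ℝ) ^ d ∧ scaleMinus αm γ = N * L ∧
      scalePlus αp γ = (N * L : ℝ) * M ∧ (L : ℝ) / N = γ ^ αm := by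
  obtain ⟨⟨n, hn⟩, ⟨m, hm⟩, ⟨p, hp⟩⟩ := h
  have hαm : 0 < αm := hα.a_pos.trans hα.a_lt
  have hαp : 0 < αp := hαm.trans hα.αm_lt
  have hnm : n ≤ m := by
    have h1 : mesh γ ≤ scaleMinus αm γ :=
      Real.rpow_le_rpow_of_exponent_ge hγ hγ1 (by linarith [hα.cond₅])
    rw [hn, hm] at h1
    exact (pow_le_pow_iff_right₀ (by norm_num)).mp h1
  have hmp : m ≤ p := by
    have h1 : scaleMinus αm γ ≤ scalePlus αp γ :=
      Real.rpow_le_rpow_of_exponent_ge hγ hγ1 (by linarith)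
    rw [hm, hp] at h1
    exact (pow_le_pow_iff_right₀ (by norm_num)).mp h1
  have hmeshsq : γ * mesh γ ^ 2 = 1 := by
    unfold mesh
    rw [← Real.rpow_natCast, ← Real.rpow_mul hγ.le]
    norm_num
    rw [Real.rpow_neg_one]
    exact mul_inv_cancel₀ hγ.ne'
  have hL : ((2 : ℝ) ^ n) * (2 ^ (m - n) : ℝ) = 2 ^ m := by
    rw [← pow_add]; congr 1; omega
  refine ⟨2 ^ n, 2 ^ (m - n), 2 ^ (p - m), by positivity, by positivity, by positivity,
    by rw [hn]; push_cast; rfl, ?_, ?_, ?_, ?_, ?_⟩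
  · push_cast; rw [← hn]; exact hmeshsq
  · push_cast
    rw [← hn, cellVolume, mesh, ← Real.rpow_natCast, ← Real.rpow_mul hγ.le]
    congr 1; ring
  · push_cast; rw [hm, hL]
  · push_cast
    rw [hL, hp, ← pow_add]; congr 1; omega
  · push_cast
    have h2 : (0 : ℝ) < 2 ^ n := by positivity
    have h3 : (2 : ℝ) ^ (m - n) / 2 ^ n = γ * 2 ^ m := by
      rw [div_eq_iff h2.ne', ← hL]
      rw [hn] at hmeshsq
      linear_combination -(2 : ℝ) ^ (m - n) * hmeshsq
    rw [h3, ← hm, scaleMinus, Real.rpow_add hγ, Real.rpow_neg_one]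
    field_simp

end Scales

end KacPotts

/-! ### Unique minimizer and decay in the continuum -/

theorem theorem7p1 (d S : ℕ) (hd : 2 ≤ d) (hS : 3 ≤ S) (β : ℝ) (hβ : 0 < β)
    (J : KacPotts.Space d → KacPotts.Space d → ℝ) (hJ : KacPotts.IsKacKernel J)
    (lamβ : ℝ) (ρ : Fin (S + 1) → Fin S → ℝ)
    (hρ : KacPotts.IsMeanFieldCoexistence β lamβ ρ)
    (a αm αp : ℝ) (hα : KacPotts.IsExponentChoice d a αm αp) :
    ∃ γ₀ c ω : ℝ, 0 < γ₀ ∧ 0 < c ∧ 0 < ω ∧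
      ∀ γ : ℝ, 0 < γ → γ ≤ γ₀ → KacPotts.AreDyadicScales αm αp γ →
      ∀ k : Fin (S + 1), ∀ Λ : Set (KacPotts.Space d),
        Bornology.IsBounded Λ → KacPotts.IsCubeSet (KacPotts.scalePlus αp γ) Λ →
      ∀ ρbar ∈ KacPotts.phaseDensities a αm γ (ρ k) Λᶜ,
      ∀ t ∈ Set.Icc (0 : ℝ) 1,
        (∃! ρhat : KacPotts.Space d → Fin S → ℝ,
          KacPotts.IsConstrainedMinimizer β lamβ γ a αm J (ρ k) Λ t ρbar ρhat) ∧
        ∀ ρhat : KacPotts.Space d → Fin S → ℝ,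
          KacPotts.IsConstrainedMinimizer β lamβ γ a αm J (ρ k) Λ t ρbar ρhat →
          ∀ r ∈ Λ, ∀ s : Fin S,
            |ρhat r s - ρ k s| ≤ c * Real.exp (-(γ * ω * Metric.infDist r Λᶜ)) := by
  open KacPotts in
  have hmin : ∀ k, IsMeanFieldMinimizer β lamβ (ρ k) := fun k => (hρ.2 _).mpr ⟨k, rfl⟩
  have hpos : ∀ k s, 0 < ρ k s := fun k s => (hmin k).pos hβ s
  -- constants which are uniform in the phase
  choose κ hκ0 hκ using fun k => (hmin k).exists_coercive hS hβ
  obtain ⟨k₀, hk₀⟩ := Finite.exists_min κ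
  set U := ∑ k, ∑ s, ρ k s + 1 with hU
  set A := ∑ k, ∑ s, 1 / (β * ρ k s) + 1 with hA
  have hinv : ∀ k s, 0 ≤ 1 / (β * ρ k s) := fun k s => by have := hpos k s; positivity
  have hU0 : 0 < U := by
    have : 0 ≤ ∑ k, ∑ s, ρ k s :=
      Finset.sum_nonneg fun k _ => Finset.sum_nonneg fun s _ => (hpos k s).le
    linarith
  have hA0 : 0 < A := by
    have : 0 ≤ ∑ k, ∑ s, 1 / (β * ρ k s) :=
      Finset.sum_nonneg fun k _ => Finset.sum_nonneg fun s _ => hinv k s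
    linarith
  have hle : ∀ F : Fin (S + 1) → Fin S → ℝ, (∀ k s, 0 ≤ F k s) → ∀ k s,
      F k s ≤ ∑ k, ∑ s, F k s + 1 := by
    intro F hF k s
    have h1 : F k s ≤ ∑ s, F k s :=
      Finset.single_le_sum (f := fun s => F k s) (fun s _ => hF k s) (Finset.mem_univ s)
    have h2 : ∑ s, F k s ≤ ∑ k, ∑ s, F k s :=
      Finset.single_le_sum (f := fun k => ∑ s, F k s)
        (fun k _ => Finset.sum_nonneg fun s _ => hF k s) (Finset.mem_univ k)
    linarith
  have hκ' : ∀ k (v : Fin S → ℝ), κ k₀ * ∑ s, v s ^ 2 ≤ hessForm β (ρ k) v := fun k v =>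
    (mul_le_mul_of_nonneg_right (hk₀ k) (Finset.sum_nonneg fun _ _ => sq_nonneg _)).trans (hκ k v)
  have hκu : ∀ k s, κ k₀ ≤ 1 / (β * ρ k s) := by
    intro k s
    have := hκ' k (fun s' => if s' = s then 1 else 0)
    simpa [hessForm, offSum_eq, ite_pow, ite_div, ite_mul] using this
  obtain ⟨Q, hQ, hker⟩ := hJ.isLatticeKernel
  obtain ⟨ε₀, C, ω, hε0, hC, hω, hmain⟩ := lattice_minimizer_decay (d := d) (S := S)
    (by omega) hβ lamβ hQ (hκ0 k₀) hA0 hU0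
  have ha := hα.a_pos
  have hαm : 0 < αm := ha.trans hα.a_lt
  have hd0 : (0 : ℝ) < √d := Real.sqrt_pos.mpr (by exact_mod_cast (by omega : 0 < d))
  refine ⟨min 1 (min (ε₀ ^ (1 / a)) (ε₀ ^ (1 / αm))), C * Real.exp ω, ω / √d,
    by positivity, by positivity, by positivity, ?_⟩
  intro γ hγ hγ0 hdy k Λ hΛb hΛc ρbar hρbar t ht
  have hγ1 : γ ≤ 1 := hγ0.trans (min_le_left _ _)
  have hsmall : ∀ b : ℝ, 0 < b → γ ≤ ε₀ ^ (1 / b) → γ ^ b ≤ ε₀ := fun b hb h => by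
    have := Real.rpow_le_rpow hγ.le h hb.le
    rwa [← Real.rpow_mul hε0.le, one_div_mul_cancel hb.ne', Real.rpow_one] at this
  have hζε := hsmall a ha (hγ0.trans ((min_le_right _ _).trans (min_le_left _ _)))
  have hLε := hsmall αm hαm (hγ0.trans ((min_le_right _ _).trans (min_le_right _ _)))
  obtain ⟨N, L, M, hN, hL, hM, hmesh, hγN, hcell, hminus, hplus, hLN⟩ :=
    exists_scales (d := d) hα hγ hγ1 hdy
  have hN' : (0 : ℝ) < N := by exact_mod_cast hN
  have hL' : (0 : ℝ) < L := by exact_mod_cast hL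
  have hmesh0 : 0 < mesh γ := by rw [hmesh]; exact hN'
  have hLN1 : L ≤ N := by
    have h1 : (L : ℝ) / N ≤ 1 := by rw [hLN]; exact Real.rpow_le_one hγ.le hγ1 hαm.le
    rw [div_le_one hN'] at h1
    exact_mod_cast h1
  rw [hplus] at hΛc
  have hsat : IsSaturated ((N : ℝ) * L) Λ := hΛc.isSaturated (by positivity) hM
  obtain ⟨T, hT⟩ := (finite_latticeSet hN' hΛb).exists_finset_coe
  have hTmem : ∀ z, z ∈ T ↔ latticePoint (N : ℝ) z ∈ Λ := fun z => by
    rw [← Finset.mem_coe, hT]; rfl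
  have hq := hker γ N hN hγN hmesh hcell
  have hg : onLattice γ ρbar ∈ latticePhase (γ ^ a) L (ρ k) (T : Set (Fin d → ℤ))ᶜ := by
    rw [hT, ← latticeSet_compl]
    exact onLattice_mem hN hL hmesh hminus hsat.compl hρbar
  obtain ⟨⟨f, ⟨hf, hfmin⟩, hfuniq⟩, hdecay⟩ := hmain (ρ k) (hpos k)
    (hle ρ (fun k s => (hpos k s).le) k) (fun s => (hmin k).critical hβ s) (hκ' k) (hκu k)
    (hle (fun k s => 1 / (β * ρ k s)) hinv k) N L (γ ^ a) hN hL hLN1 (by rw [hLN]; exact hLε)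
    (by positivity) hζε _ hq T (by rw [hT]; exact hsat.isBlockSet hN') _ hg t ht
  rw [hT] at hf hfmin hfuniq hdecay
  have hmemL : ∀ σ ∈ phaseDensities a αm γ (ρ k) Λ,
      onLattice γ σ ∈ latticePhase (γ ^ a) L (ρ k) (latticeSet (N : ℝ) Λ) := fun σ hσ =>
    onLattice_mem hN hL hmesh hminus hsat hσ
  have henergy : ∀ σ ∈ phaseDensities a αm γ (ρ k) Λ,
      interpolatedFreeEnergy β lamβ γ J (ρ k) Λ t ρbar σ = cellVolume d γ *
        latticeEnergy β lamβ t (ρ k) (comp fun x y => cellVolume d γ * averagedKernel γ J x y) T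
          (onLattice γ ρbar) (onLattice γ σ) := fun σ hσ =>
    interpolatedFreeEnergy_eq hq.comp_self (pairKernel_eq γ J) hβ lamβ t (by rw [hT, hmesh])
      fun x hx => (hmemL σ hσ).2.1 x (by rw [← hT]; simpa using hx)
  have hcell0 : 0 < cellVolume d γ := by rw [hcell]; positivity
  -- constrained minimizers in the continuum and on the lattice correspond to each other
  have hto : ∀ σ, IsConstrainedMinimizer β lamβ γ a αm J (ρ k) Λ t ρbar σ →
      onLattice γ σ ∈ latticePhase (γ ^ a) L (ρ k) (latticeSet (N : ℝ) Λ) ∧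
      IsMinOn (latticeEnergy β lamβ t (ρ k)
        (comp fun x y => cellVolume d γ * averagedKernel γ J x y) T (onLattice γ ρbar))
        (latticePhase (γ ^ a) L (ρ k) (latticeSet (N : ℝ) Λ)) (onLattice γ σ) := by
    rintro σ ⟨hσ, hσmin⟩
    refine ⟨hmemL σ hσ, fun f' hf' => ?_⟩
    have hm := (extend_mem_iff (a := a) (u := ρ k) hN hL hmesh hminus hsat f').mpr hf'
    have h1 : interpolatedFreeEnergy β lamβ γ J (ρ k) Λ t ρbar σ ≤
      interpolatedFreeEnergy β lamβ γ J (ρ k) Λ t ρbar (extend (mesh γ) f') := hσmin hm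
    rw [henergy _ hσ, henergy _ hm, onLattice_extend hmesh0] at h1
    exact le_of_mul_le_mul_left h1 hcell0
  have hext : ∀ σ, IsConstrainedMinimizer β lamβ γ a αm J (ρ k) Λ t ρbar σ →
      σ = extend (mesh γ) (onLattice γ σ) := fun σ hσ => hσ.1.1.cubeFun.eq_extend hmesh0
  refine ⟨⟨extend (mesh γ) f, ⟨?_, fun σ hσ => ?_⟩, fun σ hσ => ?_⟩, ?_⟩
  · exact (extend_mem_iff hN hL hmesh hminus hsat f).mpr hf
  · have hm := (extend_mem_iff (a := a) (u := ρ k) hN hL hmesh hminus hsat f).mpr hf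
    rw [Set.mem_ofPred_eq, henergy _ hm, henergy _ hσ, onLattice_extend hmesh0]
    exact mul_le_mul_of_nonneg_left (hfmin (hmemL σ hσ)) hcell0.le
  · rw [hext σ hσ, hfuniq _ (hto σ hσ)]
  · intro σ hσ r hr s
    obtain ⟨h1, h2⟩ := hto σ hσ
    have hx₀ : cellIndex (N : ℝ) r ∈ T := by
      rw [← Finset.mem_coe, hT]; exact (hsat.mem_iff hN' r).mpr hr
    -- from the Euclidean distance to the supremum distance of sites, in units of the mesh; the
    -- position inside a cell costs at most one unit
    have h3 := hdecay _ h1 h2 (cellIndex (N : ℝ) r) hx₀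
      (Metric.infDist r Λᶜ / (√d * N) - 1) (fun y hy => by
        have hy' : latticePoint (N : ℝ) y ∈ Λᶜ := fun h => hy ((hTmem y).mpr h)
        have h4 := Metric.infDist_le_dist_of_mem (x := r) hy'
        rw [dist_eq_norm] at h4
        have h5 := h4.trans (norm_sub_le_of_mem_cube hN' (mem_cube_cellIndex hN' r)
          (latticePoint_mem_cube hN' y))
        rw [dist_comm, sub_le_iff_le_add, div_le_iff₀ (by positivity)]
        linarith) s
    have hval : σ r s = onLattice γ σ (cellIndex (N : ℝ) r) s := by
      conv_lhs => rw [hext σ hσ]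
      rw [hmesh]; rfl
    rw [hval]
    refine h3.trans ?_
    rw [mul_assoc, ← Real.exp_add]
    refine mul_le_mul_of_nonneg_left (Real.exp_le_exp.mpr ?_) hC.le
    have hγ' : γ = 1 / (N : ℝ) ^ 2 := by rw [eq_div_iff (by positivity)]; exact hγN
    have e1 : ω / N * (Metric.infDist r Λᶜ / (√d * N) - 1) =
        γ * (ω / √d) * Metric.infDist r Λᶜ - ω / N := by
      rw [hγ']; field_simp
    have e2 : ω / N ≤ ω := div_le_self hω.le (by exact_mod_cast hN)
    rw [e1]
    linarith
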